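/- Let $(M,\boldsymbol p)$ be a connected smooth manifold of dimension $n\ge 2$ with a projective structure: an equivalence class of smooth torsion-free affine connections under $\hat\nabla_XY=\nabla_XY+\Upsilon(X)Y+\Upsilon(Y)X$, $\Upsilon$ a smooth one-form. For $w\in\mathbb R$ let $\mathcal E(w)$ be the oriented line bundle of $w$-densities, normalized by $\mathcal E(2n+2)=(\Lambda^nTM)^2$. In the splitting $\mathcal E(1)\oplus T^*M(1)$ of the cotractor bundle $J^1\mathcal E(1)$ given by $\nabla\in\boldsymbol p$, put $D\sigma=(\sigma,\nabla_a\sigma)$ for $\sigma\in\Gamma(\mathcal E(1))$ and, for $\tau\in\Gamma(\mathcal E(2))$, $$L(\tau)=\left(\tau,\ \tfrac12\nabla_a\tau,\ \tfrac12\nabla_a\nabla_b\tau+P_{ab}\tau\right),$$ a symmetric bilinear form on the tractor bundle; here $P_{ab}$ is the projective Schouten tensor, $\mathrm{Ric}_{ab}=nP_{ab}-P_{ba}$. Both are independent of the choice of $\nabla\in\boldsymbol p$. Let $\tau\in\Gamma(\mathcal E(2))$ be smooth and suppose that $L(\tau)$ has rank $1$ at every point of $M$. Then there is a sign $\varepsilon\in\{1,-1\}$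 such that: 1. Every point of $M$ has an open neighbourhood $U$ with a smooth section $\sigma$ of $\mathcal E(1)|_U$ such that $\sigma^2=\varepsilon\tau$ on $U$. On a connected open set such a $\sigma$ is unique up to sign. 2. Let $U\subseteq M$ be open and let $\sigma$ be any smooth $1$-density on $U$ with $\sigma^2=\varepsilon\tau$. Then - $L(\tau)=\varepsilon\, D\sigma\otimes D\sigma$ on $U$. - $U$ is the disjoint union of the open sets $U_+=\{\sigma>0\}$, $U_-=\{\sigma<0\}$ and the set $U_0=\{\sigma=0\}=U\cap\mathcal Z(\tau)$, where $\mathcal Z(\tau)$ is the zero locus of $\tau$, and $\nabla\sigma\ne0$ at every point of $U_0$. - There is a smooth torsion-free connection $\nabla^\sigma$ on $U_+\cup U_-$ in the projective class with $\nabla^\sigma\sigma=0$, and it is Ricci-flat. - $U\setminus U_-$ and $U\setminus U_+$ are manifolds with boundary $U_0$ and interiors $U_+$ and $U_-$, and $\nabla^\sigma$ is projectively compact of order $1$ on each: near each $x\in U_0$ there is a nonnegative smooth defining function $r$ of the boundary for which $\nabla^\sigma_\mu\xi+\frac{dr(\mu)}{r}\xi+\frac{dr(\xi)}{r}\mu$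 is smooth up to the boundary for all $\mu,\xi$ that are smooth up to the boundary. If $U$ is compact, so are $U\setminus U_\mp$. 3. $\mathcal Z(\tau)$ is empty or a smoothly embedded hypersurface. It is totally geodesic for every $\nabla\in\boldsymbol p$, and it carries a projective structure that contains the restriction of every $\nabla\in\boldsymbol p$. -/

import Mathlib

open Set Filter Topology
open scoped Manifold ContDiff

noncomputable section

namespace ProjGeom

/-! ### Tangent bundle, vector fields, coordinate frames -/

/-- The model space `ℝⁿ` of an `n`-dimensional manifold. -/
abbrev Model (n : ℕ) : Type := EuclideanSpace ℝ (Fin n)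

section basics

variable (n : ℕ) {M : Type*} [TopologicalSpace M] [ChartedSpace (Model n) M]

/-- The tangent space of the `n`-dimensional manifold `M` at `x`. -/
abbrev Tan (x : M) : Type := TangentSpace (𝓡 n) x

variable (M) in
/-- (Rough) vector fields on `M`. -/
abbrev VField : Type _ := ∀ x : M, Tan n x

variable (M) in
/-- (Rough) first order operators `Y ↦ ∇Y` on vector fields; `D Y x v` is `(∇_v Y)(x)`.
Only the values on differentiable vector fields matter. -/
abbrev RawConn : Type _ := (∀ x : M, Tan n x) → ∀ x : M, (Tan n x →L[ℝ] Tan n x)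

/-- A vector field as a map into the total space of the tangent bundle. -/
def toTotal (Y : VField n M) (x : M) : TangentBundle (𝓡 n) M := ⟨x, Y x⟩

variable [IsManifold (𝓡 n) ∞ M]

variable (M) in
/-- Bundled (Koszul) affine connections on the tangent bundle of `M`, from Mathlib. -/
abbrev Conn : Type _ :=
  CovariantDerivative (𝓡 n) (Model n) (TangentSpace (𝓡 n) : M → Type _)

/-- The domain of the preferred chart at `c`. -/
abbrev dom (c : M) : Set M :=
  (trivializationAt (Model n) (TangentSpace (𝓡 n) : M → Type _) c).baseSet

/-- The coordinate basis `∂₁, …, ∂ₙ` of `T_x M` in the chart at `c`. -/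
def coordBasis (c : M) {x : M} (hx : x ∈ dom n c) : Module.Basis (Fin n) ℝ (Tan n x) :=
  (trivializationAt (Model n) (TangentSpace (𝓡 n) : M → Type _) c).basisAt
    (EuclideanSpace.basisFun (Fin n) ℝ).toBasis hx

/-- The coordinate vector field `∂ᵢ` of the chart at `c` (zero outside the chart domain). -/
def coordField (c : M) (i : Fin n) : VField n M :=
  (trivializationAt (Model n) (TangentSpace (𝓡 n) : M → Type _) c).localFrame
    (EuclideanSpace.basisFun (Fin n) ℝ).toBasis i

open scoped Classical in
/-- The `k`-th component of `v ∈ T_x M` in the chart at `c`. -/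
def coordComp (c : M) {x : M} (v : Tan n x) (k : Fin n) : ℝ :=
  if hx : x ∈ dom n c then (coordBasis n c hx).repr v k else 0

/-- The partial derivative `∂_a f` at `x` in the chart at `c`. -/
def pd (c : M) (a : Fin n) (f : M → ℝ) (x : M) : ℝ :=
  fderiv ℝ (f ∘ (extChartAt (𝓡 n) c).symm) (extChartAt (𝓡 n) c x) (EuclideanSpace.single a 1)

/-! ### Connections: Christoffel symbols, Ricci tensor, projective Schouten tensor -/

/-- Christoffel symbols `Γ^k_{ij}` in the chart at `c`: `∇_{∂ᵢ} ∂ⱼ = ∑ₖ Γ^k_{ij} ∂ₖ`. -/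
def christoffel (D : RawConn n M) (c : M) (k i j : Fin n) (x : M) : ℝ :=
  coordComp n c (D (coordField n c j) x (coordField n c i x)) k

/-- Ricci tensor `Ric_{bd} = R_{ab}{}^a{}_d`, where
`(∇_a ∇_b - ∇_b ∇_a) v^c = R_{ab}{}^c{}_d v^d`, in the chart at `c`. -/
def ricci (D : RawConn n M) (c : M) (b d : Fin n) (x : M) : ℝ :=
  ∑ a, (pd n c a (christoffel n D c a b d) x - pd n c b (christoffel n D c a a d) x
    + ∑ e, (christoffel n D c a a e x * christoffel n D c e b d x
      - christoffel n D c a b e x * christoffel n D c e a d x))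

/-- The projective Schouten tensor `P_{ab}` of a torsion-free connection, in the chart at `c`.
It is characterized by `Ric_{ab} = n P_{ab} - P_{ba}`; if `Ric` is symmetric (which is so for
connections that preserve a volume density) then `(n - 1) P_{ab} = Ric_{ab}`. -/
def schouten (D : RawConn n M) (c : M) (a b : Fin n) (x : M) : ℝ :=
  (n * ricci n D c a b x + ricci n D c b a x) / ((n : ℝ) ^ 2 - 1)

/-! ### Projective structures -/

/-- Two connections are projectively related on `V`:
`D'_v Y = D_v Y + Υ(v) Y + Υ(Y) v` for a one-form `Υ` that is smooth on `V`. -/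
def ProjRelatedOn (V : Set M) (D D' : RawConn n M) : Prop :=
  ∃ Υ : ∀ x : M, Tan n x →L[ℝ] ℝ,
    (∀ Y : VField n M, ContMDiffOn (𝓡 n) (𝓡 n).tangent ∞ (toTotal n Y) V →
      ContMDiffOn (𝓡 n) 𝓘(ℝ) ∞ (fun x => Υ x (Y x)) V) ∧
    ∀ (Y : VField n M), ∀ x ∈ V, MDifferentiableAt (𝓡 n) (𝓡 n).tangent (toTotal n Y) x →
      ∀ v : Tan n x, D' Y x v = D Y x v + Υ x v • Y x + Υ x (Y x) • v

/-- `∇` is a smooth torsion-free affine connection on `M`. -/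
def IsAffine (D : Conn n M) : Prop :=
  CovariantDerivative.ContMDiffCovariantDerivative D ∞ ∧ D.torsion = 0

variable (M) in
/-- A projective structure on `M`: an equivalence class of projectively related smooth torsion-free
affine connections. -/
structure ProjectiveStructure where
  /-- the connections in the class -/
  carrier : Set (Conn n M)
  nonempty : carrier.Nonempty
  isAffine : ∀ D ∈ carrier, IsAffine n D
  mem_iff : ∀ D ∈ carrier, ∀ D' : Conn n M, IsAffine n D' →
    (D' ∈ carrier ↔ ProjRelatedOn n univ D.toFun D'.toFun)

/-! ### Densities -/

variable (M) in
/-- (Rough) sections of the density bundle `E(w)`, as functions on frames.  The bundle `E(2n+2)` is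
`(Λⁿ TM)²`, so a section of `E(w)` has in the frame `b'` the component
`|det (b' in b)| ^ (-w/(n+1))` times its component in the frame `b`. -/
structure Density (w : ℝ) where
  /-- the component of the density in a frame at `x` -/
  toFun : ∀ x : M, Module.Basis (Fin n) ℝ (Tan n x) → ℝ
  map_basis : ∀ (x : M) (b b' : Module.Basis (Fin n) ℝ (Tan n x)),
    toFun x b' = |b.det b'| ^ (-w / (n + 1)) * toFun x b

variable {n} {w : ℝ}

open scoped Classical in
/-- The component of a density in the coordinate frame of the chart at `c`. -/
def Density.comp (σ : Density n M w) (c x : M) : ℝ :=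
  if hx : x ∈ dom n c then σ.toFun x (coordBasis n c hx) else 0

/-- The density is smooth on `V`. -/
def Density.SmoothOn (σ : Density n M w) (V : Set M) : Prop :=
  ∀ c : M, ContMDiffOn (𝓡 n) 𝓘(ℝ) ∞ (σ.comp c) (V ∩ dom n c)

/-- The set where the density is zero. -/
def Density.zeroSet (σ : Density n M w) : Set M := {x | ∀ b, σ.toFun x b = 0}

/-- The set where the density is positive (density bundles are oriented). -/
def Density.posSet (σ : Density n M w) : Set M := {x | ∀ b, 0 < σ.toFun x b}

/-- The set where the density is negative. -/
def Density.negSet (σ : Density n M w) : Set M := {x | ∀ b, σ.toFun x b < 0}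

/-- `∇_a σ` in the chart at `c`, for the connection on `E(w)` induced by `D`. -/
def nabla (D : RawConn n M) (σ : Density n M w) (c : M) (a : Fin n) (x : M) : ℝ :=
  pd n c a (σ.comp c) x
    + w / (n + 1) * (∑ k, christoffel n D c k a k x) * σ.comp c x

/-- `∇_a ∇_b σ` in the chart at `c`, for the coupled connection on `T*M ⊗ E(w)`. -/
def nabla2 (D : RawConn n M) (σ : Density n M w) (c : M) (a b : Fin n) (x : M) : ℝ :=
  pd n c a (nabla D σ c b) x - (∑ k, christoffel n D c k a b x * nabla D σ c k x)
    + w / (n + 1) * (∑ k, christoffel n D c k a k x) * nabla D σ c b x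

/-! ### Cotractors

In the splitting given by `∇ ∈ p` the cotractor bundle `J¹(E(1))` is `E(1) ⊕ T*M(1)`; a weighted
cotractor at `x` has, in this splitting and the coordinate frame of the chart at `c`, a component
vector indexed by `Unit ⊕ Fin n`, and a section of the second symmetric power (possibly weighted)
a matrix.  If `∇` is replaced by `∇ + Υ`, the components `(ξ, μ_a)` become `(ξ, μ_a + Υ_a ξ)`. -/

/-- The Thomas operator `D_A σ = (w σ, ∇_a σ)` in the splitting `D` and the chart at `c`. -/
def thomasD (D : RawConn n M) (σ : Density n M w) (c x : M) : Unit ⊕ Fin n → ℝ :=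
  Sum.elim (fun _ => w * σ.comp c x) (fun a => nabla D σ c a x)

/-- The splitting operator `L(τ) = (τ, ½ ∇_a τ, ½ ∇_a ∇_b τ + P_{ab} τ)` of a density of weight
two, in the splitting `D` and the chart at `c`, as a (symmetric) matrix. -/
def splitL (D : RawConn n M) (τ : Density n M 2) (c x : M) :
    Matrix (Unit ⊕ Fin n) (Unit ⊕ Fin n) ℝ :=
  Matrix.fromBlocks
    (Matrix.of fun _ _ => τ.comp c x)
    (Matrix.of fun _ b => 1 / 2 * nabla D τ c b x)
    (Matrix.of fun a _ => 1 / 2 * nabla D τ c a x)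
    (Matrix.of fun a b => 1 / 2 * nabla2 D τ c a b x + schouten n D c a b x * τ.comp c x)

/-- `L(τ)` has rank one at every point.  (The rank at `x` is the same in every splitting and
frame, since the corresponding matrices are congruent.) -/
def ProjectiveStructure.RankOne (p : ProjectiveStructure n M) (τ : Density n M 2) : Prop :=
  ∀ D ∈ p.carrier, ∀ c : M, ∀ x ∈ dom n c, (splitL D.toFun τ c x).rank = 1

/-- `L(τ) = ε • (D σ ⊗ D σ)` holds on `U`, i.e. in every splitting and frame. -/
def ProjectiveStructure.SplitEqOn (p : ProjectiveStructure n M) (τ : Density n M 2) (ε : ℝ)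
    (σ : Density n M 1) (U : Set M) : Prop :=
  ∀ D ∈ p.carrier, ∀ c : M, ∀ x ∈ U ∩ dom n c,
    splitL D.toFun τ c x
      = ε • Matrix.vecMulVec (thomasD D.toFun σ c x) (thomasD D.toFun σ c x)

/-- `σ` is a smooth one-density on `U` with `σ² = ε τ` there. -/
def IsRootOn (ε : ℝ) (τ : Density n M 2) (σ : Density n M 1) (U : Set M) : Prop :=
  σ.SmoothOn U ∧ ∀ x ∈ U, ∀ b, σ.toFun x b ^ 2 = ε * τ.toFun x b

/-- `∇σ` is nonzero at every zero of `σ` in `U`; so `σ` is a defining density there. -/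
def ProjectiveStructure.IsDefiningOn (p : ProjectiveStructure n M) (σ : Density n M w)
    (U : Set M) : Prop :=
  ∀ D ∈ p.carrier, ∀ c : M, ∀ x ∈ U ∩ σ.zeroSet ∩ dom n c, ∃ a, nabla D.toFun σ c a x ≠ 0

/-! ### Scales -/

/-- `D` is the affine connection `∇^σ` on `V` of the scale `σ`: a smooth torsion-free connection on
`V` in the projective class that preserves `σ`. -/
structure ProjectiveStructure.IsScaleConn (p : ProjectiveStructure n M) (σ : Density n M w)
    (V : Set M) (D : RawConn n M) : Prop where
  isCov : IsCovariantDerivativeOn (Model n) D V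
  smooth : ContMDiffCovariantDerivativeOn (Model n) ∞ D V
  torsionFree : ∀ (X Y : VField n M), ∀ x ∈ V,
    MDifferentiableAt (𝓡 n) (𝓡 n).tangent (toTotal n X) x →
    MDifferentiableAt (𝓡 n) (𝓡 n).tangent (toTotal n Y) x →
    D Y x (X x) - D X x (Y x) = VectorField.mlieBracket (𝓡 n) X Y x
  mem_class : ∀ D' ∈ p.carrier, ProjRelatedOn n V D'.toFun D
  preserves : ∀ c : M, ∀ x ∈ V ∩ dom n c, ∀ a, nabla D σ c a x = 0

/-- The connection `D` is Ricci-flat on `V`. -/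
def RicciFlatOn (D : RawConn n M) (V : Set M) : Prop :=
  ∀ c : M, ∀ x ∈ V ∩ dom n c, ∀ a b, ricci n D c a b x = 0

/-! ### Projective compactness -/

/-- `N ⊆ M` is a manifold with boundary `B` and interior `N'` (a domain of `M` that is given near
each point of `B` by an inequality `0 ≤ r` with `r` a defining function of `B`), and the connection
`D` on `N'` is projectively compact of order `α`: for each `x ∈ B` there is such an `r` near `x`
for which the projectively related connection
`D_μ ξ + (dr(μ) / (α r)) ξ + (dr(ξ) / (α r)) μ` is smooth up to the boundary for all `μ`, `ξ` that
are smooth up to the boundary. -/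
structure IsProjectivelyCompact (α : ℝ) (D : RawConn n M) (N N' B : Set M) : Prop where
  eq_union : N = N' ∪ B
  disjoint : Disjoint N' B
  isOpen : IsOpen N'
  compact_at : ∀ x ∈ B, ∃ V : Set M, IsOpen V ∧ x ∈ V ∧ ∃ r : M → ℝ,
    ContMDiffOn (𝓡 n) 𝓘(ℝ) ∞ r V ∧
    (∀ y ∈ V, (y ∈ N ↔ 0 ≤ r y) ∧ (y ∈ B ↔ r y = 0)) ∧
    (∀ y ∈ V ∩ B, mvfderiv (𝓡 n) r y ≠ 0) ∧
    ∀ μ ξ : VField n M,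
      ContMDiffOn (𝓡 n) (𝓡 n).tangent ∞ (toTotal n μ) (V ∩ N) →
      ContMDiffOn (𝓡 n) (𝓡 n).tangent ∞ (toTotal n ξ) (V ∩ N) →
      ∃ S : VField n M, ContMDiffOn (𝓡 n) (𝓡 n).tangent ∞ (toTotal n S) (V ∩ N) ∧
        ∀ y ∈ V ∩ N', S y = D ξ y (μ y)
          + (mvfderiv (𝓡 n) r y (μ y) / (α * r y)) • ξ y
          + (mvfderiv (𝓡 n) r y (ξ y) / (α * r y)) • μ y

end basics

/-! ### Totally geodesic submanifolds -/

section submanifold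

variable {n m : ℕ} {M : Type*} [TopologicalSpace M] [ChartedSpace (Model n) M]
  [IsManifold (𝓡 n) ∞ M]
  {N : Type*} [TopologicalSpace N] [ChartedSpace (Model m) N] [IsManifold (𝓡 m) ∞ N]

/-- The embedded submanifold `i : N → M` is totally geodesic for the torsion-free connection `D`:
the covariant derivative, in directions tangent to `N`, of a vector field that is tangent to `N`
along `N` is tangent to `N`. -/
def IsTotallyGeodesic (i : N → M) (D : RawConn n M) : Prop :=
  ∀ (z : N) (Y : VField n M), MDifferentiableAt (𝓡 n) (𝓡 n).tangent (toTotal n Y) (i z) →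
    (∀ᶠ z' in 𝓝 z, Y (i z') ∈ range (mfderiv (𝓡 m) (𝓡 n) i z')) →
    ∀ v : Tan m z, D Y (i z) (mfderiv (𝓡 m) (𝓡 n) i z v) ∈ range (mfderiv (𝓡 m) (𝓡 n) i z)

/-- The connection `D'` on `N` is the restriction of the connection `D` on `M`. -/
def IsRestriction (i : N → M) (D : RawConn n M) (D' : RawConn m N) : Prop :=
  ∀ (z : N) (Y : VField n M) (Z : VField m N),
    MDifferentiableAt (𝓡 n) (𝓡 n).tangent (toTotal n Y) (i z) →
    MDifferentiableAt (𝓡 m) (𝓡 m).tangent (toTotal m Z) z →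
    (∀ᶠ z' in 𝓝 z, Y (i z') = mfderiv (𝓡 m) (𝓡 n) i z' (Z z')) →
    ∀ v : Tan m z,
      D Y (i z) (mfderiv (𝓡 m) (𝓡 n) i z v) = mfderiv (𝓡 m) (𝓡 n) i z (D' Z z v)

/-- The projective structure `q` on `N` is inherited from `p` on `M`: every connection in `p`
restricts to a connection in `q`. -/
def IsInherited (i : N → M) (p : ProjectiveStructure n M) (q : ProjectiveStructure m N) : Prop :=
  ∀ D ∈ p.carrier, ∃ D' ∈ q.carrier, IsRestriction i D.toFun D'.toFun

end submanifold

end ProjGeom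

end

noncomputable section

namespace ProjGeom

/-! Let `H = ½ ∇∇τ + P τ` be the lower right block of `L(τ)`. Rank one means that `L(τ) ≠ 0` and
that all 2×2 minors vanish; those through the corner entry say `τ H_ab = ¼ ∇_a τ ∇_b τ`
(`splitL_minor`). Where `τ ≠ 0`, `√|τ|` is a root. At a zero of `τ` this identity forces `∇τ = 0`,
so `L(τ)` reduces there to `H`, which is symmetric of rank one and therefore has some `H_ii ≠ 0`.
With `ε` the sign of `H_ii`, the function `½ ∇_i τ / √(ε H_ii)` is smooth nearby, and by the same
identity its square is `ε τ` (`exists_local_root`).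

For a root `σ`, the Leibniz rule and the minors give `L(τ) = ε Dσ ⊗ Dσ` (`IsRootOn.splitEqOn`).
Since `L(τ) ≠ 0`, `Dσ` has no zeros, so `∇σ ≠ 0` wherever `σ = 0`. Moreover `L(τ)` determines `ε` at
every point, and connectedness makes it constant (`exists_sign`). Comparison with the Leibniz rule
for `∇∇(σ²)` gives `σ (∇_a ∇_b σ + P_ab σ) = 0`. The set `σ ≠ 0` is dense, hence `∇_a ∇_b σ + P_ab σ
= 0` everywhere (`IsRootOn.nabla2_add_schouten`).

The geometry follows from this equation. The change by `Υ = -∇σ/σ` produces `∇^σ`, and it replaces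
`P` by `P - ∇Υ + Υ ⊗ Υ`, which the equation makes zero (`ricciFlatOn_scaleConn`). If `r` is `±σ` in
a chart, `dr/r` cancels the singular part of `Υ`, and what remains involves only smooth Christoffel
symbols (`isProjectivelyCompact_scaleConn`). Along `σ = 0` the Hessian of the component `s` of `σ`
is a symmetric product of `ds` with a one-form, so `ds(∇_w Y) = 0` for tangent `w` and `Y`
(`IsAdapted.isTotallyGeodesic`). Hence each `∇` restricts to the zero locus, and projectively
related connections restrict to projectively related ones. -/

lemma minSmoothness_two_le_infty : minSmoothness ℝ 2 ≤ (∞ : ℕ∞ω) := by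
  simp only [minSmoothness_of_isRCLikeNormedField]
  exact (show ((2 : ℕ∞) : ℕ∞ω) ≤ ∞ from WithTop.coe_le_coe.2 le_top)

/-! ### Components of tangent vectors and vector fields in a chart. -/

section coordinates

variable {n : ℕ} {M : Type*} [TopologicalSpace M] [ChartedSpace (Model n) M]
  [IsManifold (𝓡 n) ∞ M] {c x : M}

lemma dom_eq (c : M) : dom n c = (chartAt (Model n) c).source :=
  TangentBundle.trivializationAt_baseSet c

lemma isOpen_dom (c : M) : IsOpen (dom n c) := by
  rw [dom_eq]; exact (chartAt _ c).open_source

lemma mem_dom_self (c : M) : c ∈ dom n c := by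
  rw [dom_eq]; exact mem_chart_source _ c

lemma mem_extChartAt_source_of_mem_dom (hx : x ∈ dom n c) : x ∈ (extChartAt (𝓡 n) c).source := by
  rw [extChartAt_source, ← dom_eq]; exact hx

lemma dom_mem_nhds (hx : x ∈ dom n c) : dom n c ∈ 𝓝 x := (isOpen_dom c).mem_nhds hx

lemma coordField_eq (hx : x ∈ dom n c) (i : Fin n) :
    coordField n c i x = coordBasis n c hx i := by
  exact Bundle.Trivialization.localFrame_apply_of_mem_baseSet _ _ hx

lemma coordComp_eq (hx : x ∈ dom n c) (v : Tan n x) (k : Fin n) :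
    coordComp n c v k = (coordBasis n c hx).repr v k := by
  exact dif_pos hx

lemma coordComp_eq_trivialization (hx : x ∈ dom n c) (v : Tan n x) (k : Fin n) :
    coordComp n c v k =
      (trivializationAt (Model n) (TangentSpace (𝓡 n) : M → Type _) c ⟨x, v⟩).2 k := by
  rw [coordComp_eq hx]
  simp [coordBasis, Bundle.Trivialization.basisAt]

/-- Links frame components, which come from the trivialization, to the differential of the chart;
this turns derivatives along coordinate fields into Euclidean partial derivatives. -/
lemma coordComp_eq_mfderiv (hx : x ∈ dom n c) (v : Tan n x) (k : Fin n) :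
    coordComp n c v k = (mvfderiv (𝓡 n) (extChartAt (𝓡 n) c) x v) k := by
  rw [coordComp_eq_trivialization hx]
  have h := TangentBundle.continuousLinearMapAt_trivializationAt (I := 𝓡 n) (x₀ := c) (x := x)
    (by rw [← dom_eq]; exact hx)
  have h2 := congrArg (fun L => L v) h
  simp only [Bundle.Trivialization.continuousLinearMapAt_apply] at h2
  rw [Bundle.Trivialization.linearMapAt_apply, if_pos hx] at h2
  rw [h2]; rfl

lemma coordComp_add (hx : x ∈ dom n c) (v w : Tan n x) (k : Fin n) :
    coordComp n c (v + w) k = coordComp n c v k + coordComp n c w k := by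
  simp [coordComp_eq hx]

lemma coordComp_sub (hx : x ∈ dom n c) (v w : Tan n x) (k : Fin n) :
    coordComp n c (v - w) k = coordComp n c v k - coordComp n c w k := by
  simp [coordComp_eq hx]

lemma coordComp_smul (hx : x ∈ dom n c) (a : ℝ) (v : Tan n x) (k : Fin n) :
    coordComp n c (a • v) k = a * coordComp n c v k := by
  simp [coordComp_eq hx]

lemma coordComp_zero (hx : x ∈ dom n c) (k : Fin n) :
    coordComp n c (0 : Tan n x) k = 0 := by
  simp [coordComp_eq hx]

lemma coordComp_sum (hx : x ∈ dom n c) {ι : Type*} (s : Finset ι) (f : ι → Tan n x) (k : Fin n) :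
    coordComp n c (∑ i ∈ s, f i) k = ∑ i ∈ s, coordComp n c (f i) k := by
  simp [coordComp_eq hx, Finsupp.finsetSum_apply]

lemma coordComp_coordField (hx : x ∈ dom n c) (i k : Fin n) :
    coordComp n c (coordField n c i x) k = if i = k then 1 else 0 := by
  simp [coordComp_eq hx, coordField_eq hx, Finsupp.single_apply]

lemma sum_coordComp_smul (hx : x ∈ dom n c) (v : Tan n x) :
    ∑ k, coordComp n c v k • coordField n c k x = v := by
  simp only [coordComp_eq hx, coordField_eq hx]
  exact (coordBasis n c hx).sum_repr v

lemma eq_of_coordComp_eq (hx : x ∈ dom n c) {v w : Tan n x}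
    (h : ∀ k, coordComp n c v k = coordComp n c w k) : v = w := by
  rw [← sum_coordComp_smul hx v, ← sum_coordComp_smul hx w]
  simp [h]

lemma coordComp_eq_localFrameCoeff (hx : x ∈ dom n c) (Y : VField n M) (k : Fin n) :
    coordComp n c (Y x) k =
      (trivializationAt (Model n) (TangentSpace (𝓡 n) : M → Type _) c).localFrameCoeff (𝓡 n)
        (EuclideanSpace.basisFun (Fin n) ℝ).toBasis k x (Y x) := by
  rw [Bundle.Trivialization.localFrameCoeff_apply_of_mem_baseSet _ _ hx, coordComp_eq hx]
  rfl

lemma mdifferentiableAt_iff_coordComp (hx : x ∈ dom n c) (Y : VField n M) :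
    MDifferentiableAt (𝓡 n) (𝓡 n).tangent (toTotal n Y) x ↔
      ∀ k, MDifferentiableAt (𝓡 n) 𝓘(ℝ) (fun y => coordComp n c (Y y) k) x := by
  refine (mdifferentiableAt_iff_localFrameCoeff (I := 𝓡 n)
    (e := trivializationAt (Model n) (TangentSpace (𝓡 n) : M → Type _) c)
    (EuclideanSpace.basisFun (Fin n) ℝ).toBasis (s := Y) hx).trans ?_
  refine forall_congr' fun k => ?_
  refine Filter.EventuallyEq.mdifferentiableAt_iff ?_
  filter_upwards [dom_mem_nhds hx] with y hy
  rw [coordComp_eq_localFrameCoeff hy]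
  rfl

omit [IsManifold (𝓡 n) ∞ M] in
lemma contMDiffWithinAt_euclidean_iff {m : ℕ} {s : Set M} {f : M → Model m} :
    ContMDiffWithinAt (𝓡 n) 𝓘(ℝ, Model m) ∞ f s x ↔
      ∀ k, ContMDiffWithinAt (𝓡 n) 𝓘(ℝ) ∞ (fun y => f y k) s x := by
  constructor
  · intro h k
    exact ((EuclideanSpace.proj k : Model m →L[ℝ] ℝ).contMDiff.contMDiffAt (n := ∞)).comp_contMDiffWithinAt x h
  · intro h
    have h1 : ContMDiffWithinAt (𝓡 n) 𝓘(ℝ, Fin m → ℝ) ∞ (fun y k => f y k) s x :=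
      contMDiffWithinAt_pi_space.2 h
    exact ((EuclideanSpace.equiv (Fin m) ℝ).symm.contDiff.contMDiff.contMDiffAt
      (n := ∞)).comp_contMDiffWithinAt x h1

/-- The version relative to a set is needed for vector fields that are smooth only up to a boundary.
-/
lemma contMDiffWithinAt_iff_coordComp {s : Set M} (hx : x ∈ dom n c) (Y : VField n M) :
    ContMDiffWithinAt (𝓡 n) (𝓡 n).tangent ∞ (toTotal n Y) s x ↔
      ∀ k, ContMDiffWithinAt (𝓡 n) 𝓘(ℝ) ∞ (fun y => coordComp n c (Y y) k) s x := by
  refine ((trivializationAt (Model n) (TangentSpace (𝓡 n) : M → Type _) c).contMDiffWithinAt_section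
    s hx).trans (contMDiffWithinAt_euclidean_iff.trans (forall_congr' fun k => ?_))
  have : (fun y => coordComp n c (Y y) k) =ᶠ[𝓝 x] fun y =>
      (trivializationAt (Model n) (TangentSpace (𝓡 n) : M → Type _) c ⟨y, Y y⟩).2 k := by
    filter_upwards [dom_mem_nhds hx] with y hy using coordComp_eq_trivialization hy _ _
  exact ((this.filter_mono nhdsWithin_le_nhds).contMDiffWithinAt_iff this.self_of_nhds).symm

lemma contMDiffAt_iff_coordComp (hx : x ∈ dom n c) (Y : VField n M) :
    ContMDiffAt (𝓡 n) (𝓡 n).tangent ∞ (toTotal n Y) x ↔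
      ∀ k, ContMDiffAt (𝓡 n) 𝓘(ℝ) ∞ (fun y => coordComp n c (Y y) k) x := by
  simp only [← contMDiffWithinAt_univ]
  exact contMDiffWithinAt_iff_coordComp hx Y

lemma contMDiffAt_coordField (hx : x ∈ dom n c) (i : Fin n) :
    ContMDiffAt (𝓡 n) (𝓡 n).tangent ∞ (toTotal n (coordField n c i)) x := by
  rw [contMDiffAt_iff_coordComp hx]
  intro k
  refine (contMDiffAt_const (c := if i = k then (1 : ℝ) else 0)).congr_of_eventuallyEq ?_
  filter_upwards [dom_mem_nhds hx] with y hy using coordComp_coordField hy i k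

lemma mdifferentiableAt_coordField (hx : x ∈ dom n c) (i : Fin n) :
    MDifferentiableAt (𝓡 n) (𝓡 n).tangent (toTotal n (coordField n c i)) x :=
  (contMDiffAt_coordField hx i).mdifferentiableAt (by simp)

/-! ### Partial derivatives -/

lemma contMDiffAt_extChartAt_symm (hx : x ∈ dom n c) :
    ContMDiffAt 𝓘(ℝ, Model n) (𝓡 n) ∞ (extChartAt (𝓡 n) c).symm (extChartAt (𝓡 n) c x) := by
  have h := mem_extChartAt_source_of_mem_dom hx
  exact (contMDiffOn_extChartAt_symm c).contMDiffAt
    (extChartAt_target_mem_nhds' ((extChartAt (𝓡 n) c).map_source h))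

lemma contMDiffAt_extChartAt_of_mem_dom (hx : x ∈ dom n c) :
    ContMDiffAt (𝓡 n) 𝓘(ℝ, Model n) ∞ (extChartAt (𝓡 n) c) x :=
  contMDiffAt_extChartAt' (by rw [← dom_eq]; exact hx)

lemma extChartAt_symm_apply (hx : x ∈ dom n c) :
    (extChartAt (𝓡 n) c).symm (extChartAt (𝓡 n) c x) = x :=
  (extChartAt (𝓡 n) c).left_inv (mem_extChartAt_source_of_mem_dom hx)

lemma differentiableAt_comp_symm (hx : x ∈ dom n c) {f : M → ℝ}
    (hf : MDifferentiableAt (𝓡 n) 𝓘(ℝ) f x) :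
    DifferentiableAt ℝ (f ∘ (extChartAt (𝓡 n) c).symm) (extChartAt (𝓡 n) c x) := by
  rw [← mdifferentiableAt_iff_differentiableAt]
  have h := (contMDiffAt_extChartAt_symm hx).mdifferentiableAt (by simp)
  exact MDifferentiableAt.comp _ (by rw [extChartAt_symm_apply hx]; exact hf) h

lemma contDiffAt_comp_symm (hx : x ∈ dom n c) {f : M → ℝ}
    (hf : ContMDiffAt (𝓡 n) 𝓘(ℝ) ∞ f x) :
    ContDiffAt ℝ ∞ (f ∘ (extChartAt (𝓡 n) c).symm) (extChartAt (𝓡 n) c x) := by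
  rw [← contMDiffAt_iff_contDiffAt]
  exact ContMDiffAt.comp _ (by rw [extChartAt_symm_apply hx]; exact hf)
    (contMDiffAt_extChartAt_symm hx)

lemma eventuallyEq_comp_symm_comp (hx : x ∈ dom n c) {E : Type*} (f : M → E) :
    f =ᶠ[𝓝 x] (f ∘ (extChartAt (𝓡 n) c).symm) ∘ extChartAt (𝓡 n) c := by
  filter_upwards [dom_mem_nhds hx] with y hy
  simp only [Function.comp_apply, extChartAt_symm_apply hy]

lemma mvfderiv_eq_fderiv (hx : x ∈ dom n c) {f : M → ℝ}
    (hf : MDifferentiableAt (𝓡 n) 𝓘(ℝ) f x) (v : Tan n x) :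
    mvfderiv (𝓡 n) f x v = fderiv ℝ (f ∘ (extChartAt (𝓡 n) c).symm) (extChartAt (𝓡 n) c x)
      (mvfderiv (𝓡 n) (extChartAt (𝓡 n) c) x v) := by
  have h1 := (differentiableAt_comp_symm hx hf).mdifferentiableAt
  have h2 := (contMDiffAt_extChartAt_of_mem_dom hx).mdifferentiableAt (by simp)
  have h3 := mfderiv_comp x h1 h2
  have h4 := (eventuallyEq_comp_symm_comp hx f).mfderiv_eq (I := 𝓡 n) (I' := 𝓘(ℝ))
  unfold mvfderiv
  rw [h4.trans h3]
  simp [mfderiv_eq_fderiv]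
  rfl

lemma mvfderiv_extChartAt_coordField (hx : x ∈ dom n c) (a : Fin n) :
    mvfderiv (𝓡 n) (extChartAt (𝓡 n) c) x (coordField n c a x) = EuclideanSpace.single a 1 := by
  ext k
  rw [← coordComp_eq_mfderiv hx, coordComp_coordField hx]
  simp [eq_comm]

lemma pd_eq_mvfderiv (hx : x ∈ dom n c) {f : M → ℝ}
    (hf : MDifferentiableAt (𝓡 n) 𝓘(ℝ) f x) (a : Fin n) :
    pd n c a f x = mvfderiv (𝓡 n) f x (coordField n c a x) := by
  rw [mvfderiv_eq_fderiv hx hf, mvfderiv_extChartAt_coordField hx]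
  rfl

lemma mvfderiv_eq_sum (hx : x ∈ dom n c) {f : M → ℝ}
    (hf : MDifferentiableAt (𝓡 n) 𝓘(ℝ) f x) (v : Tan n x) :
    mvfderiv (𝓡 n) f x v = ∑ k, coordComp n c v k * pd n c k f x := by
  conv_lhs => rw [← sum_coordComp_smul hx v]
  rw [map_sum]
  refine Finset.sum_congr rfl fun k _ => ?_
  rw [map_smul, pd_eq_mvfderiv hx hf, smul_eq_mul]

lemma pd_congr {f g : M → ℝ} (hx : x ∈ dom n c) (h : f =ᶠ[𝓝 x] g) (a : Fin n) :
    pd n c a f x = pd n c a g x := by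
  have h1 : f ∘ (extChartAt (𝓡 n) c).symm =ᶠ[𝓝 (extChartAt (𝓡 n) c x)]
      g ∘ (extChartAt (𝓡 n) c).symm := by
    have h2 := (contMDiffAt_extChartAt_symm hx).continuousAt
    rw [ContinuousAt, extChartAt_symm_apply hx] at h2
    exact h2.eventually h
  simp only [pd, h1.fderiv_eq]

omit [IsManifold (𝓡 n) ∞ M] in
lemma pd_const (r : ℝ) (a : Fin n) : pd n c a (fun _ : M => r) x = 0 := by
  have : (fun _ : M => r) ∘ (extChartAt (𝓡 n) c).symm = fun _ => r := rfl
  rw [pd, this]; simp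

lemma pd_add (hx : x ∈ dom n c) {f g : M → ℝ} (hf : MDifferentiableAt (𝓡 n) 𝓘(ℝ) f x)
    (hg : MDifferentiableAt (𝓡 n) 𝓘(ℝ) g x) (a : Fin n) :
    pd n c a (fun y => f y + g y) x = pd n c a f x + pd n c a g x := by
  have h1 := differentiableAt_comp_symm hx hf
  have h2 := differentiableAt_comp_symm hx hg
  have h3 := fderiv_add h1 h2
  unfold pd
  rw [← _root_.add_apply, ← h3]
  rfl

lemma pd_sub (hx : x ∈ dom n c) {f g : M → ℝ} (hf : MDifferentiableAt (𝓡 n) 𝓘(ℝ) f x)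
    (hg : MDifferentiableAt (𝓡 n) 𝓘(ℝ) g x) (a : Fin n) :
    pd n c a (fun y => f y - g y) x = pd n c a f x - pd n c a g x := by
  have h1 := differentiableAt_comp_symm hx hf
  have h2 := differentiableAt_comp_symm hx hg
  have h3 := fderiv_sub h1 h2
  unfold pd
  rw [← _root_.sub_apply, ← h3]
  rfl

lemma pd_mul (hx : x ∈ dom n c) {f g : M → ℝ} (hf : MDifferentiableAt (𝓡 n) 𝓘(ℝ) f x)
    (hg : MDifferentiableAt (𝓡 n) 𝓘(ℝ) g x) (a : Fin n) :
    pd n c a (fun y => f y * g y) x = f x * pd n c a g x + g x * pd n c a f x := by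
  have h1 := differentiableAt_comp_symm hx hf
  have h2 := differentiableAt_comp_symm hx hg
  have h3 := fderiv_mul h1 h2
  have h4 : (fun y => f y * g y) ∘ (extChartAt (𝓡 n) c).symm =
    (f ∘ (extChartAt (𝓡 n) c).symm) * (g ∘ (extChartAt (𝓡 n) c).symm) := rfl
  unfold pd
  rw [h4, h3]
  simp only [_root_.add_apply, _root_.smul_apply, smul_eq_mul,
    Function.comp_apply, extChartAt_symm_apply hx]

lemma pd_sum (hx : x ∈ dom n c) {ι : Type*} (s : Finset ι) {f : ι → M → ℝ}
    (hf : ∀ i ∈ s, MDifferentiableAt (𝓡 n) 𝓘(ℝ) (f i) x) (a : Fin n) :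
    pd n c a (fun y => ∑ i ∈ s, f i y) x = ∑ i ∈ s, pd n c a (f i) x := by
  have h1 := fun i hi => differentiableAt_comp_symm hx (hf i hi)
  have h3 := fderiv_sum h1
  have h4 : (fun y => ∑ i ∈ s, f i y) ∘ (extChartAt (𝓡 n) c).symm =
    ∑ i ∈ s, f i ∘ (extChartAt (𝓡 n) c).symm := by ext y; simp
  unfold pd
  rw [h4, h3, _root_.sum_apply]

lemma pd_const_mul (hx : x ∈ dom n c) (r : ℝ) {f : M → ℝ}
    (hf : MDifferentiableAt (𝓡 n) 𝓘(ℝ) f x) (a : Fin n) :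
    pd n c a (fun y => r * f y) x = r * pd n c a f x := by
  rw [pd_mul hx mdifferentiableAt_const hf, pd_const]; ring

lemma contMDiffAt_pd (hx : x ∈ dom n c) {f : M → ℝ}
    (hf : ContMDiffAt (𝓡 n) 𝓘(ℝ) ∞ f x) (a : Fin n) :
    ContMDiffAt (𝓡 n) 𝓘(ℝ) ∞ (pd n c a f) x := by
  have h1 : ContDiffAt ℝ ∞ (fun p => fderiv ℝ (f ∘ (extChartAt (𝓡 n) c).symm) p
      (EuclideanSpace.single a 1)) (extChartAt (𝓡 n) c x) :=
    ((contDiffAt_comp_symm hx hf).fderiv_right (m := ∞) (by simp)).clm_apply contDiffAt_const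
  exact h1.contMDiffAt.comp x (contMDiffAt_extChartAt_of_mem_dom hx)

lemma pd_comm (hx : x ∈ dom n c) {f : M → ℝ} (hf : ContMDiffAt (𝓡 n) 𝓘(ℝ) ∞ f x)
    (a b : Fin n) : pd n c a (pd n c b f) x = pd n c b (pd n c a f) x := by
  set F := f ∘ (extChartAt (𝓡 n) c).symm with hF
  have hFd : ContDiffAt ℝ ∞ F (extChartAt (𝓡 n) c x) := contDiffAt_comp_symm hx hf
  have hd : DifferentiableAt ℝ (fderiv ℝ F) (extChartAt (𝓡 n) c x) :=
    (hFd.fderiv_right (m := ∞) (by simp)).differentiableAt (by simp)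
  have key : ∀ a b : Fin n, pd n c a (pd n c b f) x =
      fderiv ℝ (fderiv ℝ F) (extChartAt (𝓡 n) c x) (EuclideanSpace.single a 1)
        (EuclideanSpace.single b 1) := by
    intro a b
    -- The inner partial derivative is an honest directional derivative of `F` only on the chart
    -- target, so the equality is one of germs.
    have h1 : pd n c b f ∘ (extChartAt (𝓡 n) c).symm =ᶠ[𝓝 (extChartAt (𝓡 n) c x)]
        fun p => fderiv ℝ F p (EuclideanSpace.single b 1) := by
      filter_upwards [extChartAt_target_mem_nhds' (I := 𝓡 n)
        ((extChartAt (𝓡 n) c).map_source (mem_extChartAt_source_of_mem_dom hx))] with p hp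
      simp only [pd, Function.comp_apply, (extChartAt (𝓡 n) c).right_inv hp, hF]
    rw [pd, h1.fderiv_eq, fderiv_clm_apply hd (differentiableAt_const _)]
    simp
  rw [key, key]
  exact (hFd.isSymmSndFDerivAt minSmoothness_two_le_infty).eq _ _

end coordinates

section connections

variable {n : ℕ} {M : Type*} [TopologicalSpace M] [ChartedSpace (Model n) M]
  [IsManifold (𝓡 n) ∞ M] {c x : M}

/-! ### Connections in coordinates -/

lemma coordComp_eq_continuousLinearMapAt (hx : x ∈ dom n c) (v : Tan n x) (k : Fin n) :
    coordComp n c v k = (trivializationAt (Model n) (TangentSpace (𝓡 n) : M → Type _)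
      c).continuousLinearMapAt ℝ x v k := by
  rw [coordComp_eq_trivialization hx, Bundle.Trivialization.continuousLinearMapAt_apply,
    Bundle.Trivialization.linearMapAt_apply, if_pos hx]

/-- Differentiability of the sum is carried along because additivity of `D` requires it at each step
of the induction. -/
lemma cov_sum {D : RawConn n M} {V : Set M} (hD : IsCovariantDerivativeOn (Model n) D V)
    (hx : x ∈ V) {ι : Type*} (s : Finset ι) (Y : ι → VField n M)
    (hY : ∀ i ∈ s, MDifferentiableAt (𝓡 n) (𝓡 n).tangent (toTotal n (Y i)) x) :
    MDifferentiableAt (𝓡 n) (𝓡 n).tangent (toTotal n (∑ i ∈ s, Y i)) x ∧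
      D (∑ i ∈ s, Y i) x = ∑ i ∈ s, D (Y i) x := by
  classical
  induction s using Finset.induction_on with
  | empty =>
    simp only [Finset.sum_empty]
    exact ⟨Bundle.mdifferentiableAt_zeroSection .., hD.zero hx⟩
  | insert i s hi ih =>
    have h1 := ih fun j hj => hY j (Finset.mem_insert_of_mem hj)
    have h2 := hY i (Finset.mem_insert_self i s)
    rw [Finset.sum_insert hi, Finset.sum_insert hi]
    refine ⟨mdifferentiableAt_add_section h2 h1.1, ?_⟩
    rw [hD.add h2 h1.1 hx, h1.2]

lemma cov_apply_eq_sum (D : RawConn n M) (hx : x ∈ dom n c) (j k : Fin n) (v : Tan n x) :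
    coordComp n c (D (coordField n c j) x v) k =
      ∑ i, christoffel n D c k i j x * coordComp n c v i := by
  conv_lhs => rw [← sum_coordComp_smul hx v]
  rw [map_sum, coordComp_sum hx]
  refine Finset.sum_congr rfl fun i _ => ?_
  rw [map_smul, coordComp_smul hx, christoffel, mul_comm]

/-- A covariant derivative in coordinates. -/
theorem coordComp_cov {D : RawConn n M} {V : Set M} (hD : IsCovariantDerivativeOn (Model n) D V)
    (hV : V ∈ 𝓝 x) (hx : x ∈ dom n c) {Y : VField n M}
    (hY : MDifferentiableAt (𝓡 n) (𝓡 n).tangent (toTotal n Y) x) (v : Tan n x) (k : Fin n) :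
    coordComp n c (D Y x v) k = mvfderiv (𝓡 n) (fun y => coordComp n c (Y y) k) x v
      + ∑ i, ∑ j, christoffel n D c k i j x * coordComp n c v i * coordComp n c (Y x) j := by
  have hxV : x ∈ V := mem_of_mem_nhds hV
  have hYk := (mdifferentiableAt_iff_coordComp hx Y).1 hY
  -- `Y` agrees with its expansion `∑ Y^j ∂_j` only on the chart domain; locality of `D` allows the
  -- replacement, and the Leibniz rule then yields the two terms.
  set Z : Fin n → VField n M := fun j => (fun y => coordComp n c (Y y) j) • coordField n c j with hZ
  have hZd : ∀ j, MDifferentiableAt (𝓡 n) (𝓡 n).tangent (toTotal n (Z j)) x := fun j =>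
    (hYk j).smul_section (mdifferentiableAt_coordField hx j)
  have hsum := cov_sum hD hxV Finset.univ Z fun j _ => hZd j
  have h1 : D Y x = ∑ j, D (Z j) x := by
    rw [← hsum.2]
    refine hD.congr_of_eventuallyEq hY hsum.1 hV ?_
    filter_upwards [dom_mem_nhds hx] with y hy
    rw [Finset.sum_apply]
    exact (sum_coordComp_smul hy (Y y)).symm
  have h2 : ∀ j, D (Z j) x v = coordComp n c (Y x) j • D (coordField n c j) x v
      + mvfderiv (𝓡 n) (fun y => coordComp n c (Y y) j) x v • coordField n c j x := by
    intro j
    rw [hZ, hD.leibniz (mdifferentiableAt_coordField hx j) (hYk j) hxV]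
    simp
  rw [h1, _root_.sum_apply, coordComp_sum hx]
  simp only [h2, coordComp_add hx, coordComp_smul hx, coordComp_coordField hx,
    cov_apply_eq_sum D hx, Finset.sum_add_distrib]
  rw [add_comm]
  congr 1
  · simp
  · rw [Finset.sum_comm]
    refine Finset.sum_congr rfl fun i _ => ?_
    rw [Finset.mul_sum]
    exact Finset.sum_congr rfl fun j _ => by ring

/-- A vector field that is smooth near `x` agrees near `x` with a smooth vector field. -/
lemma exists_contMDiff_eventuallyEq [T2Space M] {V : Set M} (hV : V ∈ 𝓝 x) {Y : VField n M}
    (hY : ∀ y ∈ V, ContMDiffAt (𝓡 n) (𝓡 n).tangent ∞ (toTotal n Y) y) :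
    ∃ Z : VField n M, ContMDiff (𝓡 n) (𝓡 n).tangent ∞ (toTotal n Z) ∧ ∀ᶠ y in 𝓝 x, Z y = Y y := by
  obtain ⟨f, -, hf⟩ := (SmoothBumpFunction.nhds_basis_tsupport (I := 𝓡 n) x).mem_iff.1 hV
  refine ⟨(f : M → ℝ) • Y, fun y => ?_, ?_⟩
  · by_cases hy : y ∈ tsupport f
    · exact f.contMDiffAt.smul_section (hY y (hf hy))
    · have h0 : ∀ᶠ z in 𝓝 y, f z = 0 := by
        filter_upwards [(isClosed_tsupport f).isOpen_compl.mem_nhds hy] with z hz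
        exact image_eq_zero_of_notMem_tsupport hz
      rw [contMDiffAt_iff_coordComp (mem_dom_self (n := n) y)]
      intro k
      refine (contMDiffAt_const (c := (0 : ℝ))).congr_of_eventuallyEq ?_
      filter_upwards [h0, dom_mem_nhds (mem_dom_self (n := n) y)] with z hz hz'
      rw [Pi.smul_apply', hz, zero_smul, coordComp_zero hz']
  · filter_upwards [f.eventuallyEq_one] with y hy
    simp [hy]

lemma contMDiffAt_coordComp_hom {A : ∀ x : M, Tan n x →L[ℝ] Tan n x} {Y : VField n M}
    (hA : ContMDiffAt (𝓡 n) ((𝓡 n).prod 𝓘(ℝ, Model n →L[ℝ] Model n)) ∞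
      (fun y => (⟨y, A y⟩ : Bundle.TotalSpace (Model n →L[ℝ] Model n)
        fun x : M => Tan n x →L[ℝ] Tan n x)) x)
    (hY : ContMDiffAt (𝓡 n) (𝓡 n).tangent ∞ (toTotal n Y) x) (hx : x ∈ dom n c) (k : Fin n) :
    ContMDiffAt (𝓡 n) 𝓘(ℝ) ∞ (fun y => coordComp n c (A y (Y y)) k) x :=
  (contMDiffAt_iff_coordComp hx (fun y => A y (Y y))).1 (ContMDiffAt.clm_bundle_apply hA hY) k

/-- The Christoffel symbols of a smooth connection are smooth. -/
theorem contMDiffAt_christoffel [T2Space M] {D : Conn n M}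
    (hD : CovariantDerivative.ContMDiffCovariantDerivative D ∞) (hx : x ∈ dom n c)
    (k i j : Fin n) :
    ContMDiffAt (𝓡 n) 𝓘(ℝ) ∞ (christoffel n D.toFun c k i j) x := by
  -- Smoothness of `D` is tested on globally smooth fields, so the coordinate field is first cut
  -- off.
  obtain ⟨Z, hZ, hZx⟩ := exists_contMDiff_eventuallyEq (dom_mem_nhds hx) (Y := coordField n c j)
    fun y hy => contMDiffAt_coordField hy j
  have h1 := hD.contMDiff.contMDiff (σ := Z) hZ.contMDiffOn
  have h2 := contMDiffAt_coordComp_hom (h1.contMDiffAt univ_mem) (contMDiffAt_coordField hx i) hx k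
  refine h2.congr_of_eventuallyEq ?_
  filter_upwards [hZx.eventually_nhds, dom_mem_nhds hx] with y hy hy'
  rw [christoffel]
  congr 2
  exact (D.isCovariantDerivativeOn (s := univ)).congr_of_eventuallyEq
    (mdifferentiableAt_coordField hy' j)
    ((hZ y).mdifferentiableAt (by simp)) univ_mem (hy.mono fun z hz => hz.symm)

/-- Smoothness of a field of endomorphisms can be checked in coordinates. -/
theorem contMDiffWithinAt_hom_of_coordComp {A : ∀ x : M, Tan n x →L[ℝ] Tan n x} {s : Set M}
    (h : ∀ k i, ContMDiffWithinAt (𝓡 n) 𝓘(ℝ) ∞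
      (fun y => coordComp n x (A y (coordField n x i y)) k) s x) :
    ContMDiffWithinAt (𝓡 n) ((𝓡 n).prod 𝓘(ℝ, Model n →L[ℝ] Model n)) ∞
      (fun y => (⟨y, A y⟩ : Bundle.TotalSpace (Model n →L[ℝ] Model n)
        fun x : M => Tan n x →L[ℝ] Tan n x)) s x := by
  rw [contMDiffWithinAt_hom_bundle]
  refine ⟨contMDiffWithinAt_id, ?_⟩
  -- `E k i` is the elementary matrix that sends `e_i` to `e_k`; in the trivialization at `x`, the
  -- field `A` is the combination of these with its coordinate components.
  set E : Fin n → Fin n → (Model n →L[ℝ] Model n) := fun k i =>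
    (EuclideanSpace.proj i : Model n →L[ℝ] ℝ).smulRight (EuclideanSpace.single k (1 : ℝ))
  have h1 : ContMDiffWithinAt (𝓡 n) 𝓘(ℝ, Model n →L[ℝ] Model n) ∞
      (fun y => ∑ k, ∑ i, coordComp n x (A y (coordField n x i y)) k • E k i) s x :=
    contMDiffWithinAt_finsetSum fun k _ => contMDiffWithinAt_finsetSum fun i _ =>
      (h k i).smul contMDiffWithinAt_const
  have h2 : ∀ y ∈ dom n x, ContinuousLinearMap.inCoordinates (Model n)
      (TangentSpace (𝓡 n) : M → Type _) (Model n) (TangentSpace (𝓡 n) : M → Type _) x y x y (A y) =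
      ∑ k, ∑ i, coordComp n x (A y (coordField n x i y)) k • E k i := by
    intro y hy
    have hsymm : ∀ v : Model n, (trivializationAt (Model n) (TangentSpace (𝓡 n) : M → Type _)
        x).symmL ℝ y v = ∑ i, v i • coordField n x i y := by
      intro v
      refine eq_of_coordComp_eq hy fun k => ?_
      rw [coordComp_eq_continuousLinearMapAt hy,
        Bundle.Trivialization.continuousLinearMapAt_symmL _ hy, coordComp_sum hy]
      simp [coordComp_smul hy, coordComp_coordField hy]
    ext v k
    rw [ContinuousLinearMap.inCoordinates, ContinuousLinearMap.comp_apply,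
      ContinuousLinearMap.comp_apply, ← coordComp_eq_continuousLinearMapAt hy, hsymm, map_sum,
      coordComp_sum hy]
    simp [coordComp_smul hy, E, _root_.sum_apply]
    rw [Finset.sum_comm]
    refine Finset.sum_congr rfl fun i _ => ?_
    simp [Pi.single_apply, mul_comm]
  refine h1.congr_of_eventuallyEq ?_ (h2 x (mem_dom_self (n := n) x))
  filter_upwards [nhdsWithin_le_nhds (dom_mem_nhds (mem_dom_self (n := n) x))] with y hy using h2 y hy

variable (n) in
/-- The constant vector field `eᵢ` on the model space. -/
def constField (i : Fin n) : ∀ y : Model n, TangentSpace 𝓘(ℝ, Model n) y :=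
  fun _ => (EuclideanSpace.single i (1 : ℝ) : Model n)

/-- Coordinate fields are pullbacks of constant fields by the chart, and pullback commutes with
brackets. -/
lemma mlieBracket_coordField (hx : x ∈ dom n c) (i j : Fin n) :
    VectorField.mlieBracket (𝓡 n) (coordField n c i) (coordField n c j) x = 0 := by
  have hpull : ∀ i, ∀ y ∈ dom n c, VectorField.mpullback (𝓡 n) 𝓘(ℝ, Model n) (extChartAt (𝓡 n) c)
      (constField n i) y = coordField n c i y := by
    intro i y hy
    have hinv := isInvertible_mfderiv_extChartAt (I := 𝓡 n) (mem_extChartAt_source_of_mem_dom hy)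
    rw [VectorField.mpullback_apply, hinv.inverse_apply_eq]
    exact (mvfderiv_extChartAt_coordField hy i).symm
  have hev : ∀ i, VectorField.mpullback (𝓡 n) 𝓘(ℝ, Model n) (extChartAt (𝓡 n) c)
      (constField n i) =ᶠ[𝓝 x] coordField n c i := fun i => by
    filter_upwards [dom_mem_nhds hx] with y hy using hpull i y hy
  have hdiff : ∀ i : Fin n, MDifferentiableAt 𝓘(ℝ, Model n) 𝓘(ℝ, Model n).tangent
      (fun y => (⟨y, constField n i y⟩ : TangentBundle 𝓘(ℝ, Model n) (Model n)))
      (extChartAt (𝓡 n) c x) := fun i =>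
    ((contMDiff_vectorSpace_iff_contDiff (n := ∞)).2 contDiff_const _).mdifferentiableAt (by simp)
  have : IsManifold (𝓡 n) (minSmoothness ℝ 2) M := IsManifold.of_le minSmoothness_two_le_infty
  rw [← (hev i).mlieBracket_vectorField_eq (hev j),
    ← VectorField.mpullback_mlieBracket (n := ∞) (hdiff i) (hdiff j)
      (contMDiffAt_extChartAt_of_mem_dom hx) minSmoothness_two_le_infty,
    VectorField.mpullback_apply, ← VectorField.mlieBracketWithin_univ,
    VectorField.mlieBracketWithin_eq_lieBracketWithin]
  have hc : ∀ i y, fderivWithin ℝ (constField n i : Model n → Model n) univ y = 0 := fun i y =>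
    fderivWithin_const_apply (EuclideanSpace.single i (1 : ℝ))
  have h0 : VectorField.lieBracketWithin ℝ (constField n i : Model n → Model n)
      (constField n j) univ = 0 := by
    ext1 y
    simp only [VectorField.lieBracketWithin, hc]
    exact sub_self (0 : Model n)
  rw [h0]
  exact map_zero _

theorem christoffel_symm {D : Conn n M} (hD : D.torsion = 0) (hx : x ∈ dom n c) (k i j : Fin n) :
    christoffel n D.toFun c k i j x = christoffel n D.toFun c k j i x := by
  have h := (CovariantDerivative.torsion_eq_zero_iff D).1 hD (mdifferentiableAt_coordField hx i)
    (mdifferentiableAt_coordField hx j)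
  rw [mlieBracket_coordField hx, sub_eq_zero] at h
  simp only [christoffel, h]

end connections

/-- Jacobi's formula for the derivative of a determinant. -/
theorem hasFDerivAt_matrix_det {E : Type*} [NormedAddCommGroup E] [NormedSpace ℝ E] {m : ℕ}
    {B : E → Matrix (Fin m) (Fin m) ℝ} {B' : Fin m → Fin m → E →L[ℝ] ℝ} {p : E}
    (h : ∀ i j, HasFDerivAt (fun q => B q i j) (B' i j) p) :
    HasFDerivAt (fun q => (B q).det) (∑ i, ∑ j, (B p).adjugate i j • B' j i) p := by
  have h1 : HasFDerivAt (fun q => ∑ σ : Equiv.Perm (Fin m),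
      ((Equiv.Perm.sign σ : ℤ) : ℝ) * ∏ i, B q (σ i) i)
      (∑ σ : Equiv.Perm (Fin m), ((Equiv.Perm.sign σ : ℤ) : ℝ) •
        ∑ i, (∏ j ∈ Finset.univ.erase i, B p (σ j) j) • B' (σ i) i) p :=
    HasFDerivAt.fun_sum fun σ _ =>
      (HasFDerivAt.finsetProd fun i _ => h (σ i) i).const_mul _
  have h2 : (fun q => (B q).det) = fun q => ∑ σ : Equiv.Perm (Fin m),
      ((Equiv.Perm.sign σ : ℤ) : ℝ) * ∏ i, B q (σ i) i := by
    ext q; rw [Matrix.det_apply']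
  rw [h2]
  convert h1 using 1
  ext v
  -- Cramer's rule: row `i` of the adjugate paired with a vector is the determinant with column `i`
  -- replaced by that vector. The product rule for the determinant produces the same column
  -- replacements.
  have h3 : ∀ i, ∑ j, (B p).adjugate i j * B' j i v =
      ((B p).updateCol i fun j => B' j i v).det := by
    intro i
    rw [← Matrix.cramer_apply, Matrix.cramer_eq_adjugate_mulVec]
    rfl
  simp only [_root_.sum_apply, _root_.smul_apply, smul_eq_mul, h3, Matrix.det_apply',
    Finset.mul_sum]
  rw [Finset.sum_comm]
  refine Finset.sum_congr rfl fun σ _ => Finset.sum_congr rfl fun i _ => ?_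
  rw [← Finset.mul_prod_erase Finset.univ _ (Finset.mem_univ i), Matrix.updateCol_self]
  rw [mul_comm (B' (σ i) i v)]
  congr 2
  refine Finset.prod_congr rfl fun j hj => ?_
  rw [Matrix.updateCol_ne (Finset.ne_of_mem_erase hj)]

/-! ### Derivatives of determinants and of their powers. -/

section densities

variable {n : ℕ} {M : Type*} [TopologicalSpace M] [ChartedSpace (Model n) M]
  [IsManifold (𝓡 n) ∞ M] {c c' x : M}

lemma mvfderiv_det {m : ℕ} {A : M → Matrix (Fin m) (Fin m) ℝ}
    (hA : ∀ i j, MDifferentiableAt (𝓡 n) 𝓘(ℝ) (fun y => A y i j) x) (v : Tan n x) :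
    MDifferentiableAt (𝓡 n) 𝓘(ℝ) (fun y => (A y).det) x ∧
    mvfderiv (𝓡 n) (fun y => (A y).det) x v =
      ∑ i, ∑ j, (A x).adjugate i j * mvfderiv (𝓡 n) (fun y => A y j i) x v := by
  have hx := mem_dom_self (n := n) x
  have h1 := hasFDerivAt_matrix_det (B := A ∘ (extChartAt (𝓡 n) x).symm) fun i j =>
    (differentiableAt_comp_symm hx (hA i j)).hasFDerivAt
  have h2 : MDifferentiableAt (𝓡 n) 𝓘(ℝ) (fun y => (A y).det) x := by
    refine (h1.differentiableAt.mdifferentiableAt.comp x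
      ((contMDiffAt_extChartAt_of_mem_dom hx).mdifferentiableAt
        (by simp))).congr_of_eventuallyEq ?_
    exact eventuallyEq_comp_symm_comp hx _
  refine ⟨h2, ?_⟩
  rw [mvfderiv_eq_fderiv hx h2]
  erw [h1.fderiv]
  simp only [_root_.sum_apply, _root_.smul_apply, smul_eq_mul]
  refine Finset.sum_congr rfl fun i _ => Finset.sum_congr rfl fun j _ => ?_
  rw [mvfderiv_eq_fderiv hx (hA j i), Function.comp_apply, extChartAt_symm_apply hx]

omit [IsManifold (𝓡 n) ∞ M] in
lemma mvfderiv_comp_real {f : M → ℝ} {g : ℝ → ℝ} {g' : ℝ} (hg : HasDerivAt g g' (f x))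
    (hf : MDifferentiableAt (𝓡 n) 𝓘(ℝ) f x) (v : Tan n x) :
    MDifferentiableAt (𝓡 n) 𝓘(ℝ) (fun y => g (f y)) x ∧
    mvfderiv (𝓡 n) (fun y => g (f y)) x v = g' * mvfderiv (𝓡 n) f x v := by
  refine ⟨hg.differentiableAt.mdifferentiableAt.comp x hf, ?_⟩
  have h := mvfderiv_comp_apply x (g := g) hg.differentiableAt.mdifferentiableAt hf v
  refine h.trans ?_
  have h2 : mvfderiv 𝓘(ℝ) g (f x) = fderiv ℝ g (f x) := by
    unfold mvfderiv; rw [mfderiv_eq_fderiv]; rfl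
  rw [h2, hg.hasFDerivAt.fderiv]
  exact mul_comm _ _

/-- The form `p |t|^p / t` covers both signs of `t`; no orientation is assumed, so transition
determinants may be negative. -/
lemma hasDerivAt_abs_rpow_const {t : ℝ} (ht : t ≠ 0) (p : ℝ) :
    HasDerivAt (fun s : ℝ => |s| ^ p) (p * |t| ^ p / t) t := by
  have h1 := (hasDerivAt_abs ht).rpow_const (p := p) (Or.inl (abs_ne_zero.2 ht))
  convert h1 using 1
  have h2 : |t| ^ p = |t| ^ (p - 1) * |t| := by
    rw [← Real.rpow_add_one (abs_ne_zero.2 ht)]; ring_nf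
  rw [h2]
  rcases lt_or_gt_of_ne ht with h | h
  · simp [abs_of_neg h, sign_neg h]; field_simp
  · simp [abs_of_pos h, sign_pos h]; field_simp

/-! ### Change of charts -/

/-- The matrix that expresses the coordinate frame at `c'` in terms of that at `c`. -/
def transMatrix (c c' x : M) : Matrix (Fin n) (Fin n) ℝ :=
  Matrix.of fun l j => coordComp n c (coordField n c' j x) l

lemma transMatrix_mul (hx : x ∈ dom n c) (hx' : x ∈ dom n c') :
    transMatrix (n := n) c c' x * transMatrix c' c x = 1 := by
  ext l j
  have h : coordComp n c (coordField n c j x) l =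
      ∑ k, coordComp n c' (coordField n c j x) k * coordComp n c (coordField n c' k x) l := by
    conv_lhs => rw [← sum_coordComp_smul hx' (coordField n c j x)]
    rw [coordComp_sum hx]
    exact Finset.sum_congr rfl fun k _ => coordComp_smul hx _ _ _
  rw [coordComp_coordField hx] at h
  rw [Matrix.mul_apply, Matrix.one_apply]
  simp only [transMatrix, Matrix.of_apply]
  rw [show (if l = j then (1 : ℝ) else 0) = if j = l then 1 else 0 by simp [eq_comm], h]
  exact Finset.sum_congr rfl fun k _ => mul_comm _ _

lemma det_transMatrix_ne_zero (hx : x ∈ dom n c) (hx' : x ∈ dom n c') :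
    (transMatrix (n := n) c c' x).det ≠ 0 := by
  intro h
  have h1 := congrArg Matrix.det (transMatrix_mul hx hx')
  rw [Matrix.det_mul, h, Matrix.det_one, zero_mul] at h1
  exact zero_ne_one h1

lemma contMDiffAt_transMatrix (hx : x ∈ dom n c) (hx' : x ∈ dom n c') (l j : Fin n) :
    ContMDiffAt (𝓡 n) 𝓘(ℝ) ∞ (fun y => transMatrix (n := n) c c' y l j) x :=
  (contMDiffAt_iff_coordComp hx _).1 (contMDiffAt_coordField hx' j) l

lemma contMDiffAt_det_transMatrix (hx : x ∈ dom n c) (hx' : x ∈ dom n c') :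
    ContMDiffAt (𝓡 n) 𝓘(ℝ) ∞ (fun y => (transMatrix (n := n) c c' y).det) x := by
  simp only [Matrix.det_apply']
  exact contMDiffAt_finsetSum fun σ _ => contMDiffAt_const.mul
    (contMDiffAt_finsetProd fun i _ => contMDiffAt_transMatrix hx hx' _ _)

lemma det_coordBasis (hx : x ∈ dom n c) (hx' : x ∈ dom n c') :
    (coordBasis n c hx).det (coordBasis n c' hx') = (transMatrix (n := n) c c' x).det := by
  rw [Module.Basis.det_apply]
  congr 1
  ext l j
  simp [Module.Basis.toMatrix_apply, transMatrix, coordComp_eq hx, coordField_eq hx']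

variable {w : ℝ}

lemma Density.comp_eq (σ : Density n M w) (hx : x ∈ dom n c) :
    σ.comp c x = σ.toFun x (coordBasis n c hx) := dif_pos hx

omit [IsManifold (𝓡 n) ∞ M] in
lemma basis_det_ne_zero (b b' : Module.Basis (Fin n) ℝ (Tan n x)) : b.det b' ≠ 0 :=
  (b.isUnit_det b').ne_zero

omit [IsManifold (𝓡 n) ∞ M] in
lemma basis_det_mul_det (b b' b'' : Module.Basis (Fin n) ℝ (Tan n x)) :
    b.det b'' = b.det b' * b'.det b'' := by
  simp only [Module.Basis.det_apply]
  rw [← Matrix.det_mul, Module.Basis.toMatrix_mul_toMatrix]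

lemma Density.toFun_eq (σ : Density n M w) (hx : x ∈ dom n c)
    (b : Module.Basis (Fin n) ℝ (Tan n x)) :
    σ.toFun x b = |(coordBasis n c hx).det b| ^ (-w / (n + 1)) * σ.comp c x := by
  rw [σ.comp_eq hx, σ.map_basis x _ b]

omit [IsManifold (𝓡 n) ∞ M] in
lemma abs_det_rpow_pos (b b' : Module.Basis (Fin n) ℝ (Tan n x)) (r : ℝ) :
    0 < |b.det b'| ^ r :=
  Real.rpow_pos_of_pos (abs_pos.2 (basis_det_ne_zero b b')) r

lemma Density.comp_change (σ : Density n M w) (hx : x ∈ dom n c) (hx' : x ∈ dom n c') :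
    σ.comp c' x = |(transMatrix (n := n) c c' x).det| ^ (-w / (n + 1)) * σ.comp c x := by
  rw [σ.comp_eq hx', σ.toFun_eq hx, det_coordBasis]

lemma Density.mem_zeroSet_iff (σ : Density n M w) (hx : x ∈ dom n c) :
    x ∈ σ.zeroSet ↔ σ.comp c x = 0 := by
  refine ⟨fun h => by rw [σ.comp_eq hx]; exact h _, fun h b => ?_⟩
  rw [σ.toFun_eq hx, h, mul_zero]

lemma Density.mem_posSet_iff (σ : Density n M w) (hx : x ∈ dom n c) :
    x ∈ σ.posSet ↔ 0 < σ.comp c x := by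
  refine ⟨fun h => by rw [σ.comp_eq hx]; exact h _, fun h b => ?_⟩
  rw [σ.toFun_eq hx]
  exact mul_pos (abs_det_rpow_pos _ _ _) h

lemma Density.mem_negSet_iff (σ : Density n M w) (hx : x ∈ dom n c) :
    x ∈ σ.negSet ↔ σ.comp c x < 0 := by
  refine ⟨fun h => by rw [σ.comp_eq hx]; exact h _, fun h b => ?_⟩
  rw [σ.toFun_eq hx]
  exact mul_neg_of_pos_of_neg (abs_det_rpow_pos _ _ _) h

/-- The density with component `s` in the chart at `c` (zero outside the chart domain). -/
def Density.ofComp (w : ℝ) (c : M) (s : M → ℝ) : Density n M w where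
  toFun x b := open scoped Classical in
    if hx : x ∈ dom n c then |(coordBasis n c hx).det b| ^ (-w / (n + 1)) * s x else 0
  map_basis x b b' := by
    by_cases hx : x ∈ dom n c
    · simp only [dif_pos hx]
      rw [basis_det_mul_det _ b b', abs_mul, Real.mul_rpow (abs_nonneg _) (abs_nonneg _)]
      ring
    · simp only [dif_neg hx, mul_zero]

lemma Density.ofComp_toFun (s : M → ℝ) (hx : x ∈ dom n c)
    (b : Module.Basis (Fin n) ℝ (Tan n x)) : (Density.ofComp (n := n) w c s).toFun x b =
      |(coordBasis n c hx).det b| ^ (-w / (n + 1)) * s x :=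
  dif_pos hx

lemma Density.ofComp_comp (s : M → ℝ) (hx : x ∈ dom n c) :
    (Density.ofComp (n := n) w c s).comp c x = s x := by
  rw [Density.comp_eq _ hx, Density.ofComp_toFun s hx, Module.Basis.det_self]
  simp

/-- The two components differ by a real power of `|det J|`, which is smooth because `det J` has no
zeros. -/
lemma Density.contMDiffAt_comp_iff (σ : Density n M w) (hx : x ∈ dom n c) (hx' : x ∈ dom n c') :
    ContMDiffAt (𝓡 n) 𝓘(ℝ) ∞ (σ.comp c) x → ContMDiffAt (𝓡 n) 𝓘(ℝ) ∞ (σ.comp c') x := by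
  intro h
  have hd := contMDiffAt_det_transMatrix hx hx'
  have h0 := det_transMatrix_ne_zero hx hx'
  have h1 : ContDiffAt ℝ ∞ (fun t : ℝ => |t| ^ (-w / (n + 1))) (transMatrix (n := n) c c' x).det :=
    (contDiffAt_abs h0).rpow_const_of_ne (abs_ne_zero.2 h0)
  refine ((h1.contMDiffAt.comp x hd).mul h).congr_of_eventuallyEq ?_
  filter_upwards [dom_mem_nhds hx, dom_mem_nhds hx'] with y hy hy'
  exact σ.comp_change hy hy'

lemma Density.SmoothOn.contMDiffAt {σ : Density n M w} {V : Set M} (h : σ.SmoothOn V)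
    (hV : V ∈ 𝓝 x) (hx : x ∈ dom n c) : ContMDiffAt (𝓡 n) 𝓘(ℝ) ∞ (σ.comp c) x :=
  (h c).contMDiffAt (inter_mem hV (dom_mem_nhds hx))

lemma Density.smoothOn_ofComp {s : M → ℝ} {V : Set M} (hVc : V ⊆ dom n c)
    (hs : ∀ y ∈ V, ContMDiffAt (𝓡 n) 𝓘(ℝ) ∞ s y) :
    (Density.ofComp (n := n) w c s).SmoothOn V := by
  intro c' y hy
  refine (Density.contMDiffAt_comp_iff _ (hVc hy.1) hy.2 ?_).contMDiffWithinAt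
  refine (hs y hy.1).congr_of_eventuallyEq ?_
  filter_upwards [dom_mem_nhds (hVc hy.1)] with z hz using Density.ofComp_comp s hz

/-! ### Tensoriality of the derivative of a density -/

/-- The trace `∑ₖ Γ^k_{v k}` of the Christoffel symbols. -/
def christoffelTrace (D : RawConn n M) (c : M) {x : M} (v : Tan n x) : ℝ :=
  ∑ k, coordComp n c (D (coordField n c k) x v) k

lemma christoffelTrace_eq (D : RawConn n M) (hx : x ∈ dom n c) (v : Tan n x) :
    christoffelTrace D c v = ∑ a, coordComp n c v a * ∑ k, christoffel n D c k a k x := by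
  simp only [christoffelTrace, cov_apply_eq_sum D hx, Finset.mul_sum]
  rw [Finset.sum_comm]
  exact Finset.sum_congr rfl fun a _ => Finset.sum_congr rfl fun k _ => mul_comm _ _

/-- The derivative `∇_v σ` in terms of the component of `σ` in the chart at `c`. -/
def nablaAlong (D : RawConn n M) (σ : Density n M w) (c : M) {x : M} (v : Tan n x) : ℝ :=
  ∑ a, coordComp n c v a * nabla D σ c a x

lemma nablaAlong_eq (D : RawConn n M) {σ : Density n M w} (hx : x ∈ dom n c)
    (hσ : MDifferentiableAt (𝓡 n) 𝓘(ℝ) (σ.comp c) x) (v : Tan n x) :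
    nablaAlong D σ c v = mvfderiv (𝓡 n) (σ.comp c) x v
      + w / (n + 1) * christoffelTrace D c v * σ.comp c x := by
  simp only [nablaAlong, nabla, mul_add, Finset.sum_add_distrib]
  rw [mvfderiv_eq_sum hx hσ, christoffelTrace_eq D hx, Finset.mul_sum, Finset.sum_mul]
  congr 1
  exact Finset.sum_congr rfl fun a _ => by ring

lemma nablaAlong_coordField (D : RawConn n M) (σ : Density n M w) (hx : x ∈ dom n c) (a : Fin n) :
    nablaAlong D σ c (coordField n c a x) = nabla D σ c a x := by
  simp [nablaAlong, coordComp_coordField hx]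

/-- Trace of the inhomogeneous transformation law of Christoffel symbols. With `J` the transition
matrix and `K` its inverse, the extra term is `tr(K dJ)`, the logarithmic derivative of `|det J|`.
-/
lemma christoffelTrace_change {D : RawConn n M} {V : Set M}
    (hD : IsCovariantDerivativeOn (Model n) D V) (hV : V ∈ 𝓝 x) (hx : x ∈ dom n c)
    (hx' : x ∈ dom n c') (v : Tan n x) :
    christoffelTrace D c' v = christoffelTrace D c v + ∑ k, ∑ l,
      transMatrix (n := n) c' c x k l *
        mvfderiv (𝓡 n) (fun y => transMatrix (n := n) c c' y l k) x v := by
  have hcomp : ∀ (u : Tan n x) k, coordComp n c' u k =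
      ∑ l, transMatrix (n := n) c' c x k l * coordComp n c u l := by
    intro u k
    conv_lhs => rw [← sum_coordComp_smul hx u]
    rw [coordComp_sum hx']
    exact Finset.sum_congr rfl fun l _ => by
      rw [coordComp_smul hx', mul_comm]; rfl
  have h1 : ∀ k l, coordComp n c (D (coordField n c' k) x v) l =
      mvfderiv (𝓡 n) (fun y => transMatrix (n := n) c c' y l k) x v +
        ∑ j, coordComp n c (D (coordField n c j) x v) l * transMatrix (n := n) c c' x j k := by
    intro k l
    rw [coordComp_cov hD hV hx (mdifferentiableAt_coordField hx' k)]
    congr 1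
    rw [Finset.sum_comm]
    refine Finset.sum_congr rfl fun j _ => ?_
    rw [cov_apply_eq_sum D hx, Finset.sum_mul]
    rfl
  have h2 : ∀ k, coordComp n c' (D (coordField n c' k) x v) k =
      ∑ l, transMatrix (n := n) c' c x k l *
        mvfderiv (𝓡 n) (fun y => transMatrix (n := n) c c' y l k) x v +
      ∑ l, ∑ j, (transMatrix (n := n) c c' x j k * transMatrix (n := n) c' c x k l) *
        coordComp n c (D (coordField n c j) x v) l := by
    intro k
    rw [hcomp]
    simp only [h1, mul_add, Finset.sum_add_distrib, Finset.mul_sum]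
    congr 1
    exact Finset.sum_congr rfl fun l _ => Finset.sum_congr rfl fun j _ => by ring
  have h3 : ∀ j l, ∑ k, transMatrix (n := n) c c' x j k * transMatrix (n := n) c' c x k l =
      if j = l then 1 else 0 := by
    intro j l
    rw [← Matrix.mul_apply, transMatrix_mul hx hx', Matrix.one_apply]
  rw [christoffelTrace]
  simp only [h2, Finset.sum_add_distrib]
  rw [add_comm]
  congr 1
  rw [Finset.sum_comm, christoffelTrace]
  refine Finset.sum_congr rfl fun l _ => ?_
  rw [Finset.sum_comm]
  simp only [← Finset.sum_mul, h3]
  simp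

/-- By Jacobi's formula the derivative of `|det J|^(-w/(n+1))` contributes `-w/(n+1) tr(J⁻¹ dJ)`,
which cancels the change of the Christoffel trace weighted by `w/(n+1)`. -/
theorem nablaAlong_change {D : RawConn n M} {V : Set M}
    (hD : IsCovariantDerivativeOn (Model n) D V) (hV : V ∈ 𝓝 x) (hx : x ∈ dom n c)
    (hx' : x ∈ dom n c') {σ : Density n M w} (hσ : ContMDiffAt (𝓡 n) 𝓘(ℝ) ∞ (σ.comp c) x)
    (v : Tan n x) :
    nablaAlong D σ c' v =
      |(transMatrix (n := n) c c' x).det| ^ (-w / (n + 1)) * nablaAlong D σ c v := by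
  have hσ1 := hσ.mdifferentiableAt (by simp)
  have hσ2 := (σ.contMDiffAt_comp_iff hx hx' hσ).mdifferentiableAt (by simp)
  rw [nablaAlong_eq D hx hσ1, nablaAlong_eq D hx' hσ2, christoffelTrace_change hD hV hx hx',
    σ.comp_change hx hx']
  set J := transMatrix (n := n) c c' with hJ
  set K := transMatrix (n := n) c' c x with hK
  have hdet := mvfderiv_det (A := J)
    (fun i j => (contMDiffAt_transMatrix hx hx' i j).mdifferentiableAt (by simp)) v
  have h0 := det_transMatrix_ne_zero hx hx'
  have hpow := mvfderiv_comp_real (x := x) (f := fun y => (J y).det)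
    (hasDerivAt_abs_rpow_const h0 (-w / (n + 1))) hdet.1 v
  -- `K` is the inverse of `J x`, so the adjugate in Jacobi's formula becomes `det J • K`.
  have hadj : (J x).adjugate = (J x).det • K := by
    have h1 := congrArg (· * K) (Matrix.adjugate_mul (J x))
    simp only [Matrix.mul_assoc] at h1
    rw [hJ, hK, transMatrix_mul hx hx', mul_one, Matrix.smul_mul, one_mul] at h1
    exact h1
  have hprod : mvfderiv (𝓡 n) (σ.comp c') x v =
      |(J x).det| ^ (-w / (n + 1)) * mvfderiv (𝓡 n) (σ.comp c) x v +
      σ.comp c x * mvfderiv (𝓡 n) (fun y => |(J y).det| ^ (-w / (n + 1))) x v := by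
    have hev : σ.comp c' =ᶠ[𝓝 x] (fun y => |(J y).det| ^ (-w / (n + 1))) * σ.comp c := by
      filter_upwards [dom_mem_nhds hx, dom_mem_nhds hx'] with y hy hy'
      exact σ.comp_change hy hy'
    have h1 : mvfderiv (𝓡 n) (σ.comp c') x v =
        mvfderiv (𝓡 n) ((fun y => |(J y).det| ^ (-w / (n + 1))) * σ.comp c) x v := by
      unfold mvfderiv
      rw [hev.mfderiv_eq]
      rfl
    rw [h1, mvfderiv_mul hpow.1 hσ1]
    rfl
  rw [hprod, hpow.2, hdet.2, hadj]
  have hJx : (J x).det ≠ 0 := h0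
  have hsum : ∑ i, ∑ j, ((J x).det • K) i j * mvfderiv (𝓡 n) (fun y => J y j i) x v =
      (J x).det * ∑ i, ∑ j, K i j * mvfderiv (𝓡 n) (fun y => J y j i) x v := by
    simp only [Finset.mul_sum, Matrix.smul_apply, smul_eq_mul, mul_assoc]
  rw [hsum]
  have hn : (n : ℝ) + 1 ≠ 0 := by positivity
  field_simp
  ring

end densities

/-! ### Matrices of rank one -/

/-- The column space is a line: `u` spans it, and `v` collects the coefficients of the columns. -/
lemma exists_eq_mul_of_rank_eq_one {ι : Type*} [Fintype ι] [DecidableEq ι] {A : Matrix ι ι ℝ}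
    (h : A.rank = 1) : ∃ u v : ι → ℝ, ∀ i j, A i j = u i * v j := by
  rw [Matrix.rank] at h
  obtain ⟨u, -, hu⟩ := finrank_eq_one_iff'.1 h
  choose v hv using fun j => hu ⟨A.mulVecLin (Pi.single j 1), LinearMap.mem_range_self _ _⟩
  refine ⟨u, v, fun i j => ?_⟩
  have h1 := congrFun (congrArg Subtype.val (hv j)) i
  simp only [Submodule.coe_smul, Pi.smul_apply, smul_eq_mul, Matrix.mulVecLin_apply,
    Matrix.mulVec_single_one, Matrix.col_apply] at h1
  rw [← h1, mul_comm]

lemma minor_eq_of_rank_eq_one {ι : Type*} [Fintype ι] [DecidableEq ι] {A : Matrix ι ι ℝ}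
    (h : A.rank = 1) (i j k l : ι) : A i j * A k l = A i l * A k j := by
  obtain ⟨u, v, huv⟩ := exists_eq_mul_of_rank_eq_one h
  simp only [huv]; ring

lemma ne_zero_of_rank_eq_one {ι : Type*} [Fintype ι] [DecidableEq ι] {A : Matrix ι ι ℝ}
    (h : A.rank = 1) : A ≠ 0 := by
  rintro rfl
  simp at h

section roots

variable {n : ℕ} {M : Type*} [TopologicalSpace M] [ChartedSpace (Model n) M]
  [IsManifold (𝓡 n) ∞ M] {c x : M} {w : ℝ}

/-! ### Smoothness of the tensors in a chart -/

lemma exists_frequently_ne_of_pd_ne_zero (hx : x ∈ dom n c) {f : M → ℝ} {a : Fin n}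
    (h : pd n c a f x ≠ 0) : ∃ᶠ y in 𝓝 x, f y ≠ f x := by
  intro h1
  apply h
  rw [pd_congr hx (g := fun _ => f x) (h1.mono fun y hy => not_not.1 hy), pd_const]

lemma contMDiffAt_nabla [T2Space M] {D : Conn n M} (hD : IsAffine n D) {σ : Density n M w}
    (hx : x ∈ dom n c) (hσ : ContMDiffAt (𝓡 n) 𝓘(ℝ) ∞ (σ.comp c) x) (a : Fin n) :
    ContMDiffAt (𝓡 n) 𝓘(ℝ) ∞ (nabla D.toFun σ c a) x :=
  (contMDiffAt_pd hx hσ a).add ((contMDiffAt_const.mul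
    (contMDiffAt_finsetSum fun k _ => contMDiffAt_christoffel hD.1 hx k a k)).mul hσ)

lemma contMDiffAt_nabla2 [T2Space M] {D : Conn n M} (hD : IsAffine n D) {σ : Density n M w}
    (hx : x ∈ dom n c) (hσ : ContMDiffAt (𝓡 n) 𝓘(ℝ) ∞ (σ.comp c) x) (a b : Fin n) :
    ContMDiffAt (𝓡 n) 𝓘(ℝ) ∞ (nabla2 D.toFun σ c a b) x :=
  ((contMDiffAt_pd hx (contMDiffAt_nabla hD hx hσ b) a).sub
    (contMDiffAt_finsetSum fun k _ => (contMDiffAt_christoffel hD.1 hx k a b).mul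
      (contMDiffAt_nabla hD hx hσ k))).add ((contMDiffAt_const.mul
    (contMDiffAt_finsetSum fun k _ => contMDiffAt_christoffel hD.1 hx k a k)).mul
      (contMDiffAt_nabla hD hx hσ b))

lemma contMDiffAt_ricci [T2Space M] {D : Conn n M} (hD : IsAffine n D) (hx : x ∈ dom n c)
    (b d : Fin n) : ContMDiffAt (𝓡 n) 𝓘(ℝ) ∞ (ricci n D.toFun c b d) x := by
  have hΓ := fun k i j => contMDiffAt_christoffel hD.1 hx k i j
  exact contMDiffAt_finsetSum fun a _ => ((contMDiffAt_pd hx (hΓ a b d) a).sub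
    (contMDiffAt_pd hx (hΓ a a d) b)).add (contMDiffAt_finsetSum fun e _ =>
      ((hΓ a a e).mul (hΓ e b d)).sub ((hΓ a b e).mul (hΓ e a d)))

lemma contMDiffAt_schouten [T2Space M] {D : Conn n M} (hD : IsAffine n D) (hx : x ∈ dom n c)
    (a b : Fin n) : ContMDiffAt (𝓡 n) 𝓘(ℝ) ∞ (schouten n D.toFun c a b) x := by
  have h := ((contMDiffAt_const (c := (n : ℝ))).mul (contMDiffAt_ricci hD hx a b)).add
    (contMDiffAt_ricci hD hx b a)
  exact (h.mul (contMDiffAt_const (c := ((n : ℝ) ^ 2 - 1)⁻¹))).congr_of_eventuallyEq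
    (Eventually.of_forall fun y => div_eq_mul_inv _ _)

/-! ### The splitting operator on squares -/

variable {τ : Density n M 2} {σ : Density n M 1} {ε : ℝ} {U : Set M}

lemma IsRootOn.comp_sq (h : IsRootOn ε τ σ U) (hxU : x ∈ U) (hx : x ∈ dom n c) :
    σ.comp c x ^ 2 = ε * τ.comp c x := by
  rw [σ.comp_eq hx, τ.comp_eq hx]
  exact h.2 x hxU _

lemma IsRootOn.comp_eq (hε : ε * ε = 1) (h : IsRootOn ε τ σ U) (hxU : x ∈ U)
    (hx : x ∈ dom n c) : τ.comp c x = ε * (σ.comp c x * σ.comp c x) := by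
  rw [← pow_two, h.comp_sq hxU hx, ← mul_assoc, hε, one_mul]

lemma IsRootOn.contMDiffAt (h : IsRootOn ε τ σ U) (hU : IsOpen U) (hxU : x ∈ U)
    (hx : x ∈ dom n c) : ContMDiffAt (𝓡 n) 𝓘(ℝ) ∞ (σ.comp c) x :=
  h.1.contMDiffAt (hU.mem_nhds hxU) hx

/-- The Leibniz rule holds for the coupled derivative because the weight of `τ` is twice that of
`σ`, so the trace terms match. -/
lemma IsRootOn.nabla_eq (hε : ε * ε = 1) (h : IsRootOn ε τ σ U) (hU : IsOpen U) (hxU : x ∈ U)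
    (hx : x ∈ dom n c) (D : RawConn n M) (a : Fin n) :
    nabla D τ c a x = 2 * ε * (σ.comp c x * nabla D σ c a x) := by
  have hs := (h.contMDiffAt hU hxU hx).mdifferentiableAt (by simp)
  have hev : τ.comp c =ᶠ[𝓝 x] fun y => ε * (σ.comp c y * σ.comp c y) := by
    filter_upwards [hU.mem_nhds hxU, dom_mem_nhds hx] with y hy hy' using h.comp_eq hε hy hy'
  rw [nabla, nabla, pd_congr hx hev, pd_const_mul hx _ (f := fun y => σ.comp c y * σ.comp c y) (hs.mul hs), pd_mul hx hs hs,
    h.comp_eq hε hxU hx]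
  ring

lemma IsRootOn.nabla2_eq [T2Space M] (hε : ε * ε = 1) (h : IsRootOn ε τ σ U) (hU : IsOpen U)
    (hxU : x ∈ U) (hx : x ∈ dom n c) {D : Conn n M} (hD : IsAffine n D) (a b : Fin n) :
    nabla2 D.toFun τ c a b x = 2 * ε * (nabla D.toFun σ c a x * nabla D.toFun σ c b x
      + σ.comp c x * nabla2 D.toFun σ c a b x) := by
  have hs := h.contMDiffAt hU hxU hx
  have hs1 := hs.mdifferentiableAt (by simp)
  have hnb := (contMDiffAt_nabla hD hx hs b).mdifferentiableAt (by simp)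
  have hev : nabla D.toFun τ c b =ᶠ[𝓝 x]
      fun y => 2 * ε * (σ.comp c y * nabla D.toFun σ c b y) := by
    filter_upwards [hU.mem_nhds hxU, dom_mem_nhds hx] with y hy hy'
      using h.nabla_eq hε hU hy hy' _ _
  have hsum : ∑ k, christoffel n D.toFun c k a b x * nabla D.toFun τ c k x =
      2 * ε * (σ.comp c x * ∑ k, christoffel n D.toFun c k a b x * nabla D.toFun σ c k x) := by
    simp only [Finset.mul_sum, h.nabla_eq hε hU hxU hx]
    exact Finset.sum_congr rfl fun k _ => by ring
  rw [nabla2, nabla2, pd_congr hx hev, pd_const_mul hx _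
    (f := fun y => σ.comp c y * nabla D.toFun σ c b y) (hs1.mul hnb), pd_mul hx hs1 hnb, hsum,
    h.nabla_eq hε hU hxU hx]
  simp only [nabla]
  ring

/-- The minor through the corner entry. This identity is used twice: to construct roots, and to
divide by `τ` in the lower right block. -/
lemma splitL_minor {D : RawConn n M} (h : (splitL D τ c x).rank = 1) (a b : Fin n) :
    τ.comp c x * (1 / 2 * nabla2 D τ c a b x + schouten n D c a b x * τ.comp c x) =
      1 / 2 * nabla D τ c a x * (1 / 2 * nabla D τ c b x) := by
  have h1 := minor_eq_of_rank_eq_one h (Sum.inl ()) (Sum.inl ()) (Sum.inr a) (Sum.inr b)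
  simp only [splitL, Matrix.fromBlocks_apply₁₁, Matrix.fromBlocks_apply₂₂,
    Matrix.fromBlocks_apply₁₂, Matrix.fromBlocks_apply₂₁, Matrix.of_apply] at h1
  rw [h1]; ring

variable {p : ProjectiveStructure n M}

/-- The lower right block of `L(τ)` for the square `τ` of a root. -/
lemma IsRootOn.lower_eq [T2Space M] (hε : ε * ε = 1) (h : IsRootOn ε τ σ U) (hU : IsOpen U)
    (hL : p.RankOne τ) (hxU : x ∈ U) (hx : x ∈ dom n c) {D : Conn n M} (hD : D ∈ p.carrier)
    (a b : Fin n) :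
    1 / 2 * nabla2 D.toFun τ c a b x + schouten n D.toFun c a b x * τ.comp c x =
      ε * (nabla D.toFun σ c a x * nabla D.toFun σ c b x) := by
  -- At a zero of `σ` the product rule alone gives the claim, since every other term carries a
  -- factor `σ`. Elsewhere `τ ≠ 0` can be cancelled from the minor.
  by_cases h0 : σ.comp c x = 0
  · rw [h.nabla2_eq hε hU hxU hx (p.isAffine D hD), h.comp_eq hε hxU hx, h0]
    ring
  · have h1 := splitL_minor (hL D hD c x hx) a b
    rw [h.nabla_eq hε hU hxU hx, h.nabla_eq hε hU hxU hx] at h1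
    have ht : τ.comp c x ≠ 0 := by
      intro ht
      have := h.comp_sq hxU hx
      rw [ht, mul_zero] at this
      exact h0 (pow_eq_zero_iff (two_ne_zero) |>.1 this)
    apply mul_left_cancel₀ ht
    rw [h1, h.comp_eq hε hxU hx]
    ring

/-- Only the lower right block needs the rank condition; the other entries are the Leibniz rule. -/
theorem IsRootOn.splitEqOn [T2Space M] (hε : ε * ε = 1) (h : IsRootOn ε τ σ U) (hU : IsOpen U)
    (hL : p.RankOne τ) : p.SplitEqOn τ ε σ U := by
  rintro D hD c x ⟨hxU, hx⟩
  ext i j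
  rcases i with i | a <;> rcases j with j | b <;>
    simp only [splitL, thomasD, Matrix.fromBlocks_apply₁₁, Matrix.fromBlocks_apply₂₂,
      Matrix.fromBlocks_apply₁₂, Matrix.fromBlocks_apply₂₁, Matrix.of_apply, Matrix.smul_apply,
      Matrix.vecMulVec_apply, Sum.elim_inl, Sum.elim_inr, smul_eq_mul]
  · rw [h.comp_eq hε hxU hx]; ring
  · rw [h.nabla_eq hε hU hxU hx]; ring
  · rw [h.nabla_eq hε hU hxU hx]; ring
  · exact h.lower_eq hε hU hL hxU hx hD a b

lemma exists_thomasD_ne_zero [T2Space M] (hε : ε * ε = 1) (h : IsRootOn ε τ σ U) (hU : IsOpen U)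
    (hL : p.RankOne τ) (hxU : x ∈ U) (hx : x ∈ dom n c) {D : Conn n M} (hD : D ∈ p.carrier) :
    ∃ i, thomasD D.toFun σ c x i ≠ 0 := by
  by_contra! h0
  apply ne_zero_of_rank_eq_one (hL D hD c x hx)
  rw [h.splitEqOn hε hU hL D hD c x ⟨hxU, hx⟩]
  ext i j
  simp [Matrix.vecMulVec_apply, h0]

/-- `Dσ ≠ 0`, since otherwise `L(τ) = 0`; where `σ = 0`, the nonzero component must be one of `∇σ`.
-/
theorem IsRootOn.isDefiningOn [T2Space M] (hε : ε * ε = 1) (h : IsRootOn ε τ σ U) (hU : IsOpen U)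
    (hL : p.RankOne τ) : p.IsDefiningOn σ U := by
  rintro D hD c x ⟨⟨hxU, hx0⟩, hx⟩
  rw [σ.mem_zeroSet_iff hx] at hx0
  obtain ⟨i | a, hi⟩ := exists_thomasD_ne_zero hε h hU hL hxU hx hD
  · simp [thomasD, hx0] at hi
  · exact ⟨a, hi⟩

lemma nabla_eq_pd {σ : Density n M w} (h0 : σ.comp c x = 0) (D : RawConn n M) (a : Fin n) :
    nabla D σ c a x = pd n c a (σ.comp c) x := by
  simp [nabla, h0]

/-- Density of the set `σ ≠ 0`, on which division by `σ` is possible: at a zero the derivative is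
nonzero, so `σ` is not locally constant there. -/
lemma IsRootOn.frequently_ne_zero [T2Space M] (hε : ε * ε = 1) (h : IsRootOn ε τ σ U)
    (hU : IsOpen U) (hL : p.RankOne τ) (hxU : x ∈ U) (hx : x ∈ dom n c) :
    ∃ᶠ y in 𝓝 x, σ.comp c y ≠ 0 := by
  by_cases h0 : σ.comp c x = 0
  · obtain ⟨D, hD⟩ := p.nonempty
    obtain ⟨a, ha⟩ := h.isDefiningOn hε hU hL D hD c x ⟨⟨hxU, (σ.mem_zeroSet_iff hx).2 h0⟩, hx⟩
    rw [nabla_eq_pd h0] at ha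
    simpa only [h0] using exists_frequently_ne_of_pd_ne_zero hx ha
  · exact ((h.contMDiffAt hU hxU hx).continuousAt.eventually_ne h0).frequently

/-- The root is a solution of the equation `∇_a ∇_b σ + P_{ab} σ = 0`. -/
theorem IsRootOn.nabla2_add_schouten [T2Space M] (hε : ε * ε = 1) (h : IsRootOn ε τ σ U)
    (hU : IsOpen U) (hL : p.RankOne τ) (hxU : x ∈ U) (hx : x ∈ dom n c) {D : Conn n M}
    (hD : D ∈ p.carrier) (a b : Fin n) :
    nabla2 D.toFun σ c a b x + schouten n D.toFun c a b x * σ.comp c x = 0 := by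
  have hA := p.isAffine D hD
  have hne : ∀ y ∈ U, y ∈ dom n c → σ.comp c y ≠ 0 →
      nabla2 D.toFun σ c a b y + schouten n D.toFun c a b y * σ.comp c y = 0 := by
    intro y hyU hy h0
    have h1 := h.lower_eq hε hU hL hyU hy hD a b
    rw [h.nabla2_eq hε hU hyU hy hA, h.comp_eq hε hyU hy] at h1
    -- The block equals `ε ∇_a σ ∇_b σ`, and the product rule writes it as this plus `ε σ (∇_a ∇_b σ
    -- + P_ab σ)`.
    have h2 : ε * σ.comp c y *
        (nabla2 D.toFun σ c a b y + schouten n D.toFun c a b y * σ.comp c y) = 0 := by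
      linear_combination h1
    have hε0 : ε ≠ 0 := by rintro rfl; simp at hε
    exact (mul_eq_zero.1 h2).resolve_left (mul_ne_zero hε0 h0)
  -- A nonzero value at `x` would persist nearby by continuity, and so at some point with `σ ≠ 0`.
  by_contra hcon
  have hs := h.contMDiffAt hU hxU hx
  have hc : ContinuousAt (fun y => nabla2 D.toFun σ c a b y +
      schouten n D.toFun c a b y * σ.comp c y) x :=
    ((contMDiffAt_nabla2 hA hx hs a b).add
      ((contMDiffAt_schouten hA hx a b).mul hs)).continuousAt
  have hUx : ∀ᶠ y in 𝓝 x, y ∈ U := hU.mem_nhds hxU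
  have hdx : ∀ᶠ y in 𝓝 x, y ∈ dom n c := dom_mem_nhds hx
  obtain ⟨y, h0, h1, hyU, hy⟩ := ((h.frequently_ne_zero hε hU hL hxU hx).and_eventually
    ((hc.eventually_ne hcon).and (hUx.and hdx))).exists
  exact h1 (hne y hyU hy h0)

/-! ### Existence of local roots -/

/-- A root of the component in one chart is enough: squaring the transition factor of weight one
gives that of weight two. -/
lemma exists_isRootOn_of_comp {s : M → ℝ}
    (hs : ∀ᶠ y in 𝓝 x, y ∈ dom n c ∧ ContMDiffAt (𝓡 n) 𝓘(ℝ) ∞ s y ∧ s y ^ 2 = ε * τ.comp c y) :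
    ∃ U : Set M, IsOpen U ∧ x ∈ U ∧ ∃ σ : Density n M 1, IsRootOn ε τ σ U := by
  obtain ⟨U, hUs, hU, hxU⟩ := mem_nhds_iff.1 hs
  refine ⟨U, hU, hxU, Density.ofComp 1 c s, ?_, ?_⟩
  · exact Density.smoothOn_ofComp (fun y hy => (hUs hy).1) fun y hy => (hUs hy).2.1
  · intro y hy b
    have hyc := (hUs hy).1
    rw [Density.ofComp_toFun s hyc, τ.toFun_eq hyc, mul_pow, (hUs hy).2.2, ← Real.rpow_natCast,
      ← Real.rpow_mul (abs_nonneg _)]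
    rw [show -1 / ((n : ℝ) + 1) * (2 : ℕ) = -2 / (n + 1) by push_cast; ring]
    ring

/-- The issue is smoothness at a zero of `τ`. There `τ` vanishes to second order with a Hessian of
rank one, and a normalized first derivative of `τ` serves as the root. -/
theorem exists_local_root [T2Space M] (hτ : τ.SmoothOn univ) (hL : p.RankOne τ) (x : M) :
    ∃ ε : ℝ, (ε = 1 ∨ ε = -1) ∧ ∃ U : Set M, IsOpen U ∧ x ∈ U ∧
      ∃ σ : Density n M 1, IsRootOn ε τ σ U := by
  obtain ⟨D, hD⟩ := p.nonempty
  have hA := p.isAffine D hD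
  have hx := mem_dom_self (n := n) x
  have ht : ∀ y ∈ dom n x, ContMDiffAt (𝓡 n) 𝓘(ℝ) ∞ (τ.comp x) y := fun y hy =>
    hτ.contMDiffAt univ_mem hy
  have hsqrt : ∀ {f : M → ℝ} {y : M}, ContMDiffAt (𝓡 n) 𝓘(ℝ) ∞ f y → 0 < f y →
      ContMDiffAt (𝓡 n) 𝓘(ℝ) ∞ (fun z => √(f z)) y := fun hf hpos =>
    (Real.contDiffAt_sqrt hpos.ne').contMDiffAt.comp _ hf
  have hsign : ∀ r : ℝ, r ≠ 0 → ∃ ε : ℝ, (ε = 1 ∨ ε = -1) ∧ 0 < ε * r := by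
    intro r hr
    rcases lt_or_gt_of_ne hr with h | h
    · exact ⟨-1, Or.inr rfl, by linarith⟩
    · exact ⟨1, Or.inl rfl, by linarith⟩
  by_cases h0 : τ.comp x x = 0
  · have hn0 : ∀ a, nabla D.toFun τ x a x = 0 := by
      intro a
      have h1 := splitL_minor (hL D hD x x hx) a a
      rw [h0, zero_mul] at h1
      nlinarith
    have hp0 : ∀ a, pd n x a (τ.comp x) x = 0 := fun a => by rw [← nabla_eq_pd h0, hn0]
    set H : Fin n → Fin n → M → ℝ := fun a b y =>
      1 / 2 * nabla2 D.toFun τ x a b y + schouten n D.toFun x a b y * τ.comp x y with hH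
    have hHs : ∀ a b, ∀ y ∈ dom n x, ContMDiffAt (𝓡 n) 𝓘(ℝ) ∞ (H a b) y := fun a b y hy =>
      (contMDiffAt_const.mul (contMDiffAt_nabla2 hA hy (ht y hy) a b)).add
        ((contMDiffAt_schouten hA hy a b).mul (ht y hy))
    -- As `τ` and `∇τ` vanish at `x`, all connection and curvature terms drop out. What remains is
    -- half the coordinate Hessian, which is symmetric.
    have hHx : ∀ a b, H a b x = 1 / 2 * pd n x a (pd n x b (τ.comp x)) x := by
      intro a b
      have hγ := contMDiffAt_finsetSum (t := Finset.univ)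
        fun k _ => contMDiffAt_christoffel hA.1 hx k b k
      have hτx := (ht x hx)
      have h1 : pd n x a (nabla D.toFun τ x b) x = pd n x a (pd n x b (τ.comp x)) x := by
        have hmul := ((contMDiffAt_const (c := (2 : ℝ) / (n + 1))).mul hγ).mdifferentiableAt
          (by simp)
        have htd := hτx.mdifferentiableAt (by simp)
        have h2 := pd_add hx ((contMDiffAt_pd hx hτx b).mdifferentiableAt (by simp))
          (hmul.mul htd) a
        have h3 := pd_mul hx hmul htd a
        refine h2.trans ?_
        rw [h0, hp0] at h3
        refine (congrArg (_ + ·) h3).trans ?_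
        ring
      simp only [hH, h0, nabla2, hn0, h1]
      simp
    -- For a symmetric matrix of the form `u vᵀ`, `H_ab² = H_aa H_bb`. A zero diagonal would
    -- therefore give `H = 0` and then `L(τ) = 0`.
    obtain ⟨i, hi⟩ : ∃ i, H i i x ≠ 0 := by
      by_contra! hi
      obtain ⟨u, v, huv⟩ := exists_eq_mul_of_rank_eq_one (hL D hD x x hx)
      have hHuv : ∀ a b, H a b x = u (Sum.inr a) * v (Sum.inr b) := fun a b =>
        huv (Sum.inr a) (Sum.inr b)
      have hall : ∀ a b, H a b x = 0 := by
        intro a b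
        have hsymm : H a b x = H b a x := by rw [hHx, hHx, pd_comm hx (ht x hx)]
        have h1 : H a b x * H b a x = H a a x * H b b x := by simp only [hHuv]; ring
        rw [hi, zero_mul, ← hsymm] at h1
        exact mul_self_eq_zero.1 h1
      apply ne_zero_of_rank_eq_one (hL D hD x x hx)
      ext a b
      rcases a with a | a <;> rcases b with b | b
      · exact h0
      · change 1 / 2 * nabla D.toFun τ x b x = 0
        rw [hn0, mul_zero]
      · change 1 / 2 * nabla D.toFun τ x a x = 0
        rw [hn0, mul_zero]
      · exact hall a b
    obtain ⟨ε, hε, hpos⟩ := hsign _ hi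
    have hpos' := ((hHs i i x hx).continuousAt.const_mul ε).eventually_const_lt hpos
    -- By the diagonal minor at each nearby point, the square is `¼ (∇_i τ)² / (ε H_ii) = τ H_ii /
    -- (ε H_ii) = ε τ`. The root is smooth because `ε H_ii > 0` near `x`.
    refine ⟨ε, hε, exists_isRootOn_of_comp (c := x)
      (s := fun y => (1 / 2 * nabla D.toFun τ x i y) * (√(ε * H i i y))⁻¹) ?_⟩
    filter_upwards [hpos', dom_mem_nhds hx] with y hy hyx
    refine ⟨hyx, ?_, ?_⟩
    · exact (contMDiffAt_const.mul (contMDiffAt_nabla hA hyx (ht y hyx) i)).mul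
        ((hsqrt (contMDiffAt_const.mul (hHs i i y hyx)) hy).inv₀ (Real.sqrt_pos.2 hy).ne')
    · have h1 := splitL_minor (hL D hD x y hyx) i i
      have hε2 : ε * ε = 1 := by rcases hε with rfl | rfl <;> norm_num
      rw [mul_pow, inv_pow, Real.sq_sqrt hy.le, pow_two, ← h1]
      change τ.comp x y * H i i y * (ε * H i i y)⁻¹ = ε * τ.comp x y
      have hHne : H i i y ≠ 0 := by rintro h; rw [h, mul_zero] at hy; exact lt_irrefl _ hy
      have hεne : ε ≠ 0 := by rintro rfl; simp at hε2
      field_simp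
      linear_combination -(τ.comp x y) * hε2
  · obtain ⟨ε, hε, hpos⟩ := hsign _ h0
    have hpos' := ((ht x hx).continuousAt.const_mul ε).eventually_const_lt hpos
    refine ⟨ε, hε, exists_isRootOn_of_comp (c := x) (s := fun y => √(ε * τ.comp x y)) ?_⟩
    filter_upwards [hpos', dom_mem_nhds hx] with y hy hyx
    exact ⟨hyx, hsqrt (contMDiffAt_const.mul (ht y hyx)) hy, Real.sq_sqrt hy.le⟩

/-- The points with roots of a given sign form an open set. The two sets are told apart by `L(τ)`
rather than by `τ`, which may vanish: `Dσ ⊗ Dσ = -Dσ' ⊗ Dσ'` contradicts `Dσ ≠ 0` on the diagonal.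
-/
theorem exists_sign [T2Space M] [ConnectedSpace M] (hτ : τ.SmoothOn univ) (hL : p.RankOne τ) :
    ∃ ε : ℝ, (ε = 1 ∨ ε = -1) ∧ ∀ x : M, ∃ U : Set M, IsOpen U ∧ x ∈ U ∧
      ∃ σ : Density n M 1, IsRootOn ε τ σ U := by
  set A : ℝ → Set M := fun ε => {x | ∃ U : Set M, IsOpen U ∧ x ∈ U ∧
      ∃ σ : Density n M 1, IsRootOn ε τ σ U} with hA
  have hopen : ∀ ε, IsOpen (A ε) := by
    intro ε
    rw [isOpen_iff_mem_nhds]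
    rintro x ⟨U, hU, hxU, σ, hσ⟩
    filter_upwards [hU.mem_nhds hxU] with y hy using ⟨U, hU, hy, σ, hσ⟩
  have hcover : (univ : Set M) ⊆ A 1 ∪ A (-1) := by
    intro x _
    obtain ⟨ε, rfl | rfl, h⟩ := exists_local_root hτ hL x
    · exact Or.inl h
    · exact Or.inr h
  have hdisj : univ ∩ (A 1 ∩ A (-1)) = ∅ := by
    rw [univ_inter, eq_empty_iff_forall_notMem]
    rintro x ⟨⟨U, hU, hxU, σ, hσ⟩, ⟨U', hU', hxU', σ', hσ'⟩⟩
    obtain ⟨D, hD⟩ := p.nonempty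
    have hx := mem_dom_self (n := n) x
    have e1 := hσ.splitEqOn (by norm_num) hU hL D hD x x ⟨hxU, hx⟩
    have e2 := hσ'.splitEqOn (by norm_num) hU' hL D hD x x ⟨hxU', hx⟩
    obtain ⟨i, hi⟩ := exists_thomasD_ne_zero (by norm_num) hσ hU hL hxU hx hD
    have e3 := congrFun (congrFun (e1.symm.trans e2) i) i
    simp only [Matrix.smul_apply, Matrix.vecMulVec_apply, smul_eq_mul] at e3
    nlinarith [mul_self_pos.2 hi, mul_self_nonneg (thomasD D.toFun σ' x x i)]
  rcases (isPreconnected_iff_subset_of_disjoint.1 isPreconnected_univ) _ _ (hopen 1) (hopen (-1))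
    hcover hdisj with h | h
  · exact ⟨1, Or.inl rfl, fun x => h (mem_univ x)⟩
  · exact ⟨-1, Or.inr rfl, fun x => h (mem_univ x)⟩

/-! ### Uniqueness of roots -/

/-- `(σ' - σ)(σ' + σ) = 0`, and near `x` one factor is nonzero on a dense set, either by its value
or by its derivative at `x`; so the other factor vanishes near `x`. -/
lemma eventually_eq_or_eq_neg [T2Space M] (hε : ε * ε = 1) {σ' : Density n M 1}
    (h : IsRootOn ε τ σ U) (h' : IsRootOn ε τ σ' U) (hU : IsOpen U) (hL : p.RankOne τ)
    (hxU : x ∈ U) (hx : x ∈ dom n c) :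
    (∀ᶠ y in 𝓝 x, σ'.comp c y = σ.comp c y) ∨ ∀ᶠ y in 𝓝 x, σ'.comp c y = -σ.comp c y := by
  have hs := fun y hyU (hy : y ∈ dom n c) => h.contMDiffAt hU hyU hy
  have hs' := fun y hyU (hy : y ∈ dom n c) => h'.contMDiffAt hU hyU hy
  -- Near `x` still `∂_a g ≠ 0`. If `f y ≠ 0` at such a point, then `g` would vanish near `y` and
  -- `∂_a g` would be zero there.
  have key : ∀ {f g : M → ℝ} {a : Fin n}, (∀ y ∈ U, y ∈ dom n c → f y * g y = 0) →
      (∀ y ∈ U, y ∈ dom n c → ContMDiffAt (𝓡 n) 𝓘(ℝ) ∞ f y) →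
      (∀ y ∈ U, y ∈ dom n c → ContMDiffAt (𝓡 n) 𝓘(ℝ) ∞ g y) →
      pd n c a g x ≠ 0 → ∀ᶠ y in 𝓝 x, f y = 0 := by
    intro f g a hfg hf hg hga
    have hc := (contMDiffAt_pd hx (hg x hxU hx) a).continuousAt.eventually_ne hga
    filter_upwards [hc, hU.mem_nhds hxU, dom_mem_nhds hx] with y hy hyU hyc
    by_contra hfy
    have h1 := (hf y hyU hyc).continuousAt.eventually_ne hfy
    apply hy
    rw [pd_congr hyc (g := fun _ => 0), pd_const]
    filter_upwards [h1, hU.mem_nhds hyU, dom_mem_nhds hyc] with z hz hzU hzc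
    exact (mul_eq_zero.1 (hfg z hzU hzc)).resolve_left hz
  have hprod : ∀ y ∈ U, y ∈ dom n c →
      (σ'.comp c y - σ.comp c y) * (σ'.comp c y + σ.comp c y) = 0 := by
    intro y hyU hy
    have e1 := h.comp_sq hyU hy
    have e2 := h'.comp_sq hyU hy
    linear_combination e2 - e1
  have hsub := fun y hyU hy => (hs' y hyU hy).sub (hs y hyU hy)
  have hadd := fun y hyU hy => (hs' y hyU hy).add (hs y hyU hy)
  by_cases h0 : σ.comp c x = 0
  · have h0' : σ'.comp c x = 0 := by
      have := hprod x hxU hx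
      rw [h0, sub_zero, add_zero] at this
      exact mul_self_eq_zero.1 this
    obtain ⟨D, hD⟩ := p.nonempty
    obtain ⟨a, ha⟩ := h.isDefiningOn hε hU hL D hD c x ⟨⟨hxU, (σ.mem_zeroSet_iff hx).2 h0⟩, hx⟩
    -- Both roots give the same lower block, so `(∂_a σ)² = (∂_a σ')²` at the common zero; hence the
    -- sum or the difference has `a`-derivative `±2 ∂_a σ ≠ 0`.
    have e1 := (h.lower_eq hε hU hL hxU hx hD a a).symm.trans
      (h'.lower_eq hε hU hL hxU hx hD a a)
    have hε0 : ε ≠ 0 := by rintro rfl; simp at hε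
    have e2 := mul_left_cancel₀ hε0 e1
    rw [nabla_eq_pd h0] at e2 ha
    rw [nabla_eq_pd h0'] at e2
    have hd := (hs x hxU hx).mdifferentiableAt (by simp)
    have hd' := (hs' x hxU hx).mdifferentiableAt (by simp)
    rcases mul_self_eq_mul_self_iff.1 e2 with e | e
    · left
      refine (key hprod hsub hadd (a := a) ?_).mono fun y hy => sub_eq_zero.1 hy
      refine (pd_add hx hd' hd a).trans_ne ?_
      rw [← e]; intro h2; apply ha; linarith
    · right
      refine (key (fun y hyU hy => (mul_comm _ _).trans (hprod y hyU hy)) hadd hsub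
        (a := a) ?_).mono fun y hy => eq_neg_of_add_eq_zero_left hy
      refine (pd_sub hx hd' hd a).trans_ne ?_
      rw [e]; intro h2; apply ha; linarith
  · rcases mul_eq_zero.1 (hprod x hxU hx) with e | e
    · left
      have h1 : σ'.comp c x + σ.comp c x ≠ 0 := by
        rw [sub_eq_zero.1 e]; intro h2; apply h0; linarith
      filter_upwards [(hadd x hxU hx).continuousAt.eventually_ne h1, hU.mem_nhds hxU,
        dom_mem_nhds hx] with y hy hyU hyc
      exact sub_eq_zero.1 ((mul_eq_zero.1 (hprod y hyU hyc)).resolve_right hy)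
    · right
      have h1 : σ'.comp c x - σ.comp c x ≠ 0 := by
        rw [eq_neg_of_add_eq_zero_left e]; intro h2; apply h0; linarith
      filter_upwards [(hsub x hxU hx).continuousAt.eventually_ne h1, hU.mem_nhds hxU,
        dom_mem_nhds hx] with y hy hyU hyc
      exact eq_neg_of_add_eq_zero_left ((mul_eq_zero.1 (hprod y hyU hyc)).resolve_left hy)

/-- The points near which `σ' = σ`, and those near which `σ' = -σ`, form open sets that cover `U`;
they are disjoint in `U` because `σ` vanishes on no nonempty open subset. -/
theorem IsRootOn.eq_or_eq_neg [T2Space M] (hε : ε * ε = 1) {σ' : Density n M 1}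
    (h : IsRootOn ε τ σ U) (h' : IsRootOn ε τ σ' U) (hU : IsOpen U) (hUc : IsPreconnected U)
    (hL : p.RankOne τ) :
    (∀ x ∈ U, ∀ b, σ'.toFun x b = σ.toFun x b) ∨ (∀ x ∈ U, ∀ b, σ'.toFun x b = -σ.toFun x b) := by
  set A : Set M := {x | ∀ᶠ y in 𝓝 x, ∀ b, σ'.toFun y b = σ.toFun y b}
  set B : Set M := {x | ∀ᶠ y in 𝓝 x, ∀ b, σ'.toFun y b = -σ.toFun y b}
  have hAo : IsOpen A := isOpen_iff_mem_nhds.2 fun x hx => eventually_eventually_nhds.2 hx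
  have hBo : IsOpen B := isOpen_iff_mem_nhds.2 fun x hx => eventually_eventually_nhds.2 hx
  have hcover : U ⊆ A ∪ B := by
    intro x hxU
    have hx := mem_dom_self (n := n) x
    rcases eventually_eq_or_eq_neg hε h h' hU hL hxU hx with h1 | h1
    · left
      filter_upwards [h1, dom_mem_nhds hx] with y hy hyx b
      rw [σ'.toFun_eq hyx, σ.toFun_eq hyx, hy]
    · right
      filter_upwards [h1, dom_mem_nhds hx] with y hy hyx b
      rw [σ'.toFun_eq hyx, σ.toFun_eq hyx, hy, mul_neg]
  have hdisj : U ∩ (A ∩ B) = ∅ := by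
    rw [eq_empty_iff_forall_notMem]
    rintro x ⟨hxU, hxA, hxB⟩
    have hx := mem_dom_self (n := n) x
    refine h.frequently_ne_zero hε hU hL hxU hx ?_
    filter_upwards [hxA, hxB, dom_mem_nhds hx] with y hyA hyB hyx
    rw [not_not, σ.comp_eq hyx]
    have e1 := hyA (coordBasis n x hyx)
    have e2 := hyB (coordBasis n x hyx)
    linarith
  rcases (isPreconnected_iff_subset_of_disjoint.1 hUc) _ _ hAo hBo hcover hdisj with h1 | h1
  · exact Or.inl fun x hx => (h1 hx).self_of_nhds
  · exact Or.inr fun x hx => (h1 hx).self_of_nhds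

end roots

section change

variable {n : ℕ} {M : Type*} [TopologicalSpace M] [ChartedSpace (Model n) M]
  [IsManifold (𝓡 n) ∞ M] {c x : M}

/-! ### Projective changes of connections -/

/-- A covariant derivative with smooth Christoffel symbols is smooth. -/
theorem contMDiffCovariantDerivativeOn_of_christoffel {D : RawConn n M} {V : Set M}
    (hV : IsOpen V) (hD : IsCovariantDerivativeOn (Model n) D V)
    (h : ∀ x ∈ V, ∀ k i j, ContMDiffAt (𝓡 n) 𝓘(ℝ) ∞ (christoffel n D x k i j) x) :
    ContMDiffCovariantDerivativeOn (Model n) ∞ D V where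
  contMDiff {Y} hY := by
    intro x hx
    have hY' : ∀ y ∈ V, ContMDiffAt (𝓡 n) (𝓡 n).tangent ∞ (toTotal n Y) y := fun y hy =>
      (hY.contMDiffAt (hV.mem_nhds hy)).of_le (by simp)
    have hxx := mem_dom_self (n := n) x
    refine contMDiffWithinAt_hom_of_coordComp fun k i => ContMDiffAt.contMDiffWithinAt ?_
    have hYc := (contMDiffAt_iff_coordComp hxx Y).1 (hY' x hx)
    have h1 : ContMDiffAt (𝓡 n) 𝓘(ℝ) ∞ (fun y => pd n x i (fun z => coordComp n x (Y z) k) y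
        + ∑ j, christoffel n D x k i j y * coordComp n x (Y y) j) x :=
      (contMDiffAt_pd hxx (hYc k) i).add
        (contMDiffAt_finsetSum fun j _ => (h x hx k i j).mul (hYc j))
    refine h1.congr_of_eventuallyEq ?_
    filter_upwards [hV.mem_nhds hx, dom_mem_nhds hxx] with y hyV hy
    have hYy := (hY' y hyV).mdifferentiableAt (by simp)
    rw [coordComp_cov hD (hV.mem_nhds hyV) hy hYy,
      pd_eq_mvfderiv hy ((mdifferentiableAt_iff_coordComp hy Y).1 hYy k)]
    simp [coordComp_coordField hy]

lemma form_apply_eq_sum (Υ : ∀ x : M, Tan n x →L[ℝ] ℝ) (hx : x ∈ dom n c) (v : Tan n x) :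
    Υ x v = ∑ i, coordComp n c v i * Υ x (coordField n c i x) := by
  conv_lhs => rw [← sum_coordComp_smul hx v]
  simp

/-- A one-form with smooth components is smooth. -/
lemma contMDiffOn_form_apply {Υ : ∀ x : M, Tan n x →L[ℝ] ℝ} {V : Set M}
    (h : ∀ x ∈ V, ∀ i, ContMDiffWithinAt (𝓡 n) 𝓘(ℝ) ∞ (fun y => Υ y (coordField n x i y)) V x)
    {Y : VField n M} (hY : ContMDiffOn (𝓡 n) (𝓡 n).tangent ∞ (toTotal n Y) V) :
    ContMDiffOn (𝓡 n) 𝓘(ℝ) ∞ (fun x => Υ x (Y x)) V := by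
  intro x hx
  have hxx := mem_dom_self (n := n) x
  have h1 := (contMDiffWithinAt_iff_coordComp hxx Y).1 (hY x hx)
  have h2 : ContMDiffWithinAt (𝓡 n) 𝓘(ℝ) ∞
      (fun y => ∑ i, coordComp n x (Y y) i * Υ y (coordField n x i y)) V x :=
    contMDiffWithinAt_finsetSum fun i _ => (h1 i).mul (h x hx i)
  refine h2.congr_of_eventuallyEq ?_ (form_apply_eq_sum Υ hxx _)
  filter_upwards [nhdsWithin_le_nhds (dom_mem_nhds hxx)] with y hy using form_apply_eq_sum Υ hy _

/-- The components of a smooth one-form are smooth. -/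
lemma contMDiffAt_form_coordField [T2Space M] {Υ : ∀ x : M, Tan n x →L[ℝ] ℝ}
    (h : ∀ Y : VField n M, ContMDiffOn (𝓡 n) (𝓡 n).tangent ∞ (toTotal n Y) univ →
      ContMDiffOn (𝓡 n) 𝓘(ℝ) ∞ (fun x => Υ x (Y x)) univ) (hx : x ∈ dom n c) (i : Fin n) :
    ContMDiffAt (𝓡 n) 𝓘(ℝ) ∞ (fun y => Υ y (coordField n c i y)) x := by
  obtain ⟨Z, hZ, hZx⟩ := exists_contMDiff_eventuallyEq (dom_mem_nhds hx) (Y := coordField n c i)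
    fun y hy => contMDiffAt_coordField hy i
  refine ((h Z hZ.contMDiffOn).contMDiffAt univ_mem).congr_of_eventuallyEq ?_
  filter_upwards [hZx] with y hy
  rw [hy]

lemma ProjRelatedOn.refl (D : RawConn n M) (V : Set M) : ProjRelatedOn n V D D :=
  ⟨fun _ => 0, fun _ _ => by simpa using contMDiffOn_const, by simp⟩

lemma ProjRelatedOn.symm {D D' : RawConn n M} {V : Set M} (h : ProjRelatedOn n V D D') :
    ProjRelatedOn n V D' D := by
  obtain ⟨Υ, h1, h2⟩ := h
  refine ⟨fun x => -Υ x, fun Y hY => by simpa using (h1 Y hY).neg, fun Y x hx hY v => ?_⟩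
  rw [h2 Y x hx hY v, _root_.neg_apply, _root_.neg_apply]
  module

lemma ProjRelatedOn.trans {D D' D'' : RawConn n M} {V : Set M} (h : ProjRelatedOn n V D D')
    (h' : ProjRelatedOn n V D' D'') : ProjRelatedOn n V D D'' := by
  obtain ⟨Υ, h1, h2⟩ := h
  obtain ⟨Υ', h1', h2'⟩ := h'
  refine ⟨fun x => Υ x + Υ' x, fun Y hY => (h1 Y hY).add (h1' Y hY),
    fun Y x hx hY v => ?_⟩
  rw [h2' Y x hx hY v, h2 Y x hx hY v, _root_.add_apply, _root_.add_apply]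
  module

/-- Not a mere restriction: a field that is smooth on `V` need not extend smoothly to `M`.
Smoothness of `Υ` is therefore passed through its components. -/
lemma ProjRelatedOn.of_univ [T2Space M] {D D' : RawConn n M} (h : ProjRelatedOn n univ D D')
    (V : Set M) : ProjRelatedOn n V D D' := by
  obtain ⟨Υ, h1, h2⟩ := h
  refine ⟨Υ, fun Y hY => contMDiffOn_form_apply (fun x _ i =>
    (contMDiffAt_form_coordField h1 (mem_dom_self (n := n) x) i).contMDiffWithinAt) hY,
    fun Y x _ => h2 Y x (mem_univ x)⟩

/-- The connection `D + Υ` obtained from `D` by the projective change with the one-form `Υ`. -/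
def projChange (D : RawConn n M) (Υ : ∀ x : M, Tan n x →L[ℝ] ℝ) : RawConn n M := fun Y x =>
  D Y x + (Υ x).smulRight (Y x) + Υ x (Y x) • ContinuousLinearMap.id ℝ (Tan n x)

omit [IsManifold (𝓡 n) ∞ M] in
lemma projChange_apply (D : RawConn n M) (Υ : ∀ x : M, Tan n x →L[ℝ] ℝ) (Y : VField n M)
    (v : Tan n x) : projChange D Υ Y x v = D Y x v + Υ x v • Y x + Υ x (Y x) • v := by
  simp [projChange]

lemma isCovariantDerivativeOn_projChange {D : RawConn n M} {V : Set M}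
    (hD : IsCovariantDerivativeOn (Model n) D V) (Υ : ∀ x : M, Tan n x →L[ℝ] ℝ) :
    IsCovariantDerivativeOn (Model n) (projChange D Υ) V where
  add hY hY' hx := by
    ext1 v
    rw [_root_.add_apply]
    simp only [projChange_apply, hD.add hY hY' hx, Pi.add_apply, map_add, _root_.add_apply]
    module
  leibniz hY hg hx := by
    ext1 v
    rw [_root_.add_apply, _root_.smul_apply]
    simp only [projChange_apply, hD.leibniz hY hg hx, Pi.smul_apply', map_smul, _root_.add_apply,
      _root_.smul_apply, smul_eq_mul]
    module

lemma christoffel_projChange (D : RawConn n M) (Υ : ∀ x : M, Tan n x →L[ℝ] ℝ)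
    (hx : x ∈ dom n c) (k i j : Fin n) :
    christoffel n (projChange D Υ) c k i j x = christoffel n D c k i j x
      + (if j = k then Υ x (coordField n c i x) else 0)
      + (if i = k then Υ x (coordField n c j x) else 0) := by
  simp only [christoffel, projChange_apply, coordComp_add hx, coordComp_smul hx,
    coordComp_coordField hx, mul_ite, mul_one, mul_zero]

lemma sum_christoffel_projChange (D : RawConn n M) (Υ : ∀ x : M, Tan n x →L[ℝ] ℝ)
    (hx : x ∈ dom n c) (a : Fin n) :
    ∑ k, christoffel n (projChange D Υ) c k a k x =
      (∑ k, christoffel n D c k a k x) + (n + 1) * Υ x (coordField n c a x) := by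
  simp only [christoffel_projChange D Υ hx, Finset.sum_add_distrib]
  simp
  ring

lemma nabla_projChange {w : ℝ} (D : RawConn n M) (Υ : ∀ x : M, Tan n x →L[ℝ] ℝ)
    (σ : Density n M w) (hx : x ∈ dom n c) (a : Fin n) :
    nabla (projChange D Υ) σ c a x =
      nabla D σ c a x + w * Υ x (coordField n c a x) * σ.comp c x := by
  rw [nabla, nabla, sum_christoffel_projChange D Υ hx]
  field_simp
  ring

/-- The part of the Ricci change that is quadratic in the Christoffel symbols. Its terms linear in
`u` are those that complete the partial derivatives of `Υ` to covariant ones. -/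
lemma ricci_change_algebra {n : ℕ} (G : Fin n → Fin n → Fin n → ℝ)
    (hs : ∀ k i j, G k i j = G k j i) (u : Fin n → ℝ) (b d : Fin n) :
    ∑ a, ∑ e, ((G a a e + (if e = a then u a else 0) + (if a = a then u e else 0))
      * (G e b d + (if d = e then u b else 0) + (if b = e then u d else 0))
      - (G a b e + (if e = a then u b else 0) + (if b = a then u e else 0))
      * (G e a d + (if d = e then u a else 0) + (if a = e then u d else 0))) =
    ∑ a, ∑ e, (G a a e * G e b d - G a b e * G e a d)
      - (∑ e, G e d b * u e) + n * (∑ e, G e b d * u e) + (n - 1) * (u b * u d) := by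
  -- The Kronecker deltas leave contractions in various orders; these identities bring them to one
  -- form.
  have e1 : ∀ i j, ∑ e, G e i j * u e = ∑ e, u e * G e i j := fun i j =>
    Finset.sum_congr rfl fun x _ => mul_comm _ _
  have e2 : ∑ e, u e * G e d b = ∑ e, u e * G e b d :=
    Finset.sum_congr rfl fun x _ => by rw [hs]
  have e3 : ∀ i, ∑ x, G x i x = ∑ x, G x x i := fun i => Finset.sum_congr rfl fun x _ => hs _ _ _
  simp only [if_true, add_mul, mul_add, Finset.sum_add_distrib, Finset.sum_sub_distrib, ite_mul,
    mul_ite, zero_mul, mul_zero]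
  simp only [Finset.sum_ite_eq, Finset.sum_ite_eq', Finset.mem_univ, if_true,
    Finset.sum_add_distrib, Finset.sum_const, Finset.card_univ, Fintype.card_fin, nsmul_eq_mul,
    Finset.sum_ite_irrel, ← Finset.sum_mul, ← Finset.mul_sum, e1, e2, e3]
  simp only [mul_zero, Finset.sum_ite_eq, Finset.mem_univ, if_true]
  ring

/-- The Ricci tensor under a projective change. -/
theorem ricci_projChange {D : RawConn n M} {Υ : ∀ x : M, Tan n x →L[ℝ] ℝ}
    (hx : x ∈ dom n c)
    (hs : ∀ k i j, christoffel n D c k i j x = christoffel n D c k j i x)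
    (hΓ : ∀ k i j, MDifferentiableAt (𝓡 n) 𝓘(ℝ) (christoffel n D c k i j) x)
    (hΥ : ∀ i, MDifferentiableAt (𝓡 n) 𝓘(ℝ) (fun y => Υ y (coordField n c i y)) x)
    (b d : Fin n) :
    ricci n (projChange D Υ) c b d x = ricci n D c b d x
      + (pd n c d (fun y => Υ y (coordField n c b y)) x
        - ∑ e, christoffel n D c e d b x * Υ x (coordField n c e x))
      - n * (pd n c b (fun y => Υ y (coordField n c d y)) x
        - ∑ e, christoffel n D c e b d x * Υ x (coordField n c e x))
      + (n - 1) * (Υ x (coordField n c b x) * Υ x (coordField n c d x)) := by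
  set u : Fin n → M → ℝ := fun i y => Υ y (coordField n c i y) with hu
  have hΓ' : ∀ k i j a, pd n c a (christoffel n (projChange D Υ) c k i j) x =
      pd n c a (christoffel n D c k i j) x + (if j = k then pd n c a (u i) x else 0)
        + (if i = k then pd n c a (u j) x else 0) := by
    intro k i j a
    have hev : christoffel n (projChange D Υ) c k i j =ᶠ[𝓝 x] fun y => (christoffel n D c k i j y
        + (if j = k then 1 else 0) * u i y) + (if i = k then 1 else 0) * u j y := by
      filter_upwards [dom_mem_nhds hx] with y hy
      rw [christoffel_projChange D Υ hy]
      simp [hu]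
    have m1 : ∀ r i, MDifferentiableAt (𝓡 n) 𝓘(ℝ) (fun y => r * u i y) x := fun r i =>
      mdifferentiableAt_const.mul (hΥ i)
    rw [pd_congr hx hev, pd_add hx (f := fun y => christoffel n D c k i j y
        + (if j = k then 1 else 0) * u i y) ((hΓ k i j).add (m1 _ i)) (m1 _ j),
      pd_add hx (hΓ k i j) (m1 _ i), pd_const_mul hx _ (hΥ i), pd_const_mul hx _ (hΥ j)]
    simp [hu]
  have hc : ∀ k i j, christoffel n (projChange D Υ) c k i j x = christoffel n D c k i j x
      + (if j = k then u i x else 0) + (if i = k then u j x else 0) :=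
    fun k i j => christoffel_projChange D Υ hx k i j
  have hu' : ∀ i, Υ x (coordField n c i x) = u i x := fun i => rfl
  simp only [ricci, hΓ', hc, hu']
  have key := ricci_change_algebra (fun k i j => christoffel n D c k i j x) hs (fun i => u i x) b d
  have hd : ∑ a, (pd n c a (christoffel n D c a b d) x + (if d = a then pd n c a (u b) x else 0)
        + (if b = a then pd n c a (u d) x else 0)
      - (pd n c b (christoffel n D c a a d) x + (if d = a then pd n c b (u a) x else 0)
        + (if a = a then pd n c b (u d) x else 0))) =
      ∑ a, (pd n c a (christoffel n D c a b d) x - pd n c b (christoffel n D c a a d) x)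
        + pd n c d (u b) x - n * pd n c b (u d) x := by
    simp only [if_true, Finset.sum_add_distrib, Finset.sum_sub_distrib, Finset.sum_ite_eq,
      Finset.mem_univ, Finset.sum_const, Finset.card_univ, Fintype.card_fin, nsmul_eq_mul]
    ring
  simp only [Finset.sum_add_distrib] at key hd ⊢
  linarith

/-! ### The affine connection of a scale -/

/-- The one-form `-∇σ / σ`, where `σ ≠ 0`. -/
def scaleForm {w : ℝ} (D : RawConn n M) (σ : Density n M w) (x : M) : Tan n x →L[ℝ] ℝ :=
  ∑ a, (-(nabla D σ x a x) / σ.comp x x) • ((EuclideanSpace.proj a : Model n →L[ℝ] ℝ).comp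
    (mvfderiv (𝓡 n) (extChartAt (𝓡 n) x) x))

/-- `scaleForm` is defined at each point in that point's own chart. Numerator and denominator change
by the same factor, so any chart may be used, and the form can be differentiated in a fixed one. -/
lemma scaleForm_apply {w : ℝ} {D : RawConn n M} {V : Set M}
    (hD : IsCovariantDerivativeOn (Model n) D V) (hV : V ∈ 𝓝 x) (hx : x ∈ dom n c)
    {σ : Density n M w} (hσ : ContMDiffAt (𝓡 n) 𝓘(ℝ) ∞ (σ.comp c) x) (v : Tan n x) :
    scaleForm D σ x v = -nablaAlong D σ c v / σ.comp c x := by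
  have hxx := mem_dom_self (n := n) x
  have h1 : scaleForm D σ x v = -nablaAlong D σ x v / σ.comp x x := by
    simp only [scaleForm, nablaAlong, _root_.sum_apply, _root_.smul_apply, smul_eq_mul,
      ContinuousLinearMap.comp_apply]
    rw [← Finset.sum_neg_distrib, Finset.sum_div]
    refine Finset.sum_congr rfl fun a _ => ?_
    rw [coordComp_eq_mfderiv hxx]
    have : (EuclideanSpace.proj a : Model n →L[ℝ] ℝ) (mvfderiv (𝓡 n) (extChartAt (𝓡 n) x) x v) =
        (mvfderiv (𝓡 n) (extChartAt (𝓡 n) x) x v) a := rfl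
    rw [this]
    ring
  rw [h1, nablaAlong_change hD hV hx hxx hσ, σ.comp_change hx hxx, ← mul_neg,
    mul_div_mul_left]
  exact (Real.rpow_pos_of_pos (abs_pos.2 (det_transMatrix_ne_zero hx hxx)) _).ne'

lemma scaleForm_coordField {w : ℝ} {D : RawConn n M} {V : Set M}
    (hD : IsCovariantDerivativeOn (Model n) D V) (hV : V ∈ 𝓝 x) (hx : x ∈ dom n c)
    {σ : Density n M w} (hσ : ContMDiffAt (𝓡 n) 𝓘(ℝ) ∞ (σ.comp c) x) (a : Fin n) :
    scaleForm D σ x (coordField n c a x) = -nabla D σ c a x / σ.comp c x := by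
  rw [scaleForm_apply hD hV hx hσ, nablaAlong_coordField D σ hx]

variable {σ : Density n M 1} {U : Set M}

/-- The affine connection of the scale `σ`. -/
def scaleConn (D : RawConn n M) (σ : Density n M 1) : RawConn n M :=
  projChange D (scaleForm D σ)

lemma isOpen_diff_zeroSet (hU : IsOpen U) (hσ : σ.SmoothOn U) : IsOpen (U \ σ.zeroSet) := by
  refine isOpen_iff_mem_nhds.2 fun x hx => ?_
  have hxx := mem_dom_self (n := n) x
  have h0 : σ.comp x x ≠ 0 := fun h => hx.2 ((σ.mem_zeroSet_iff hxx).2 h)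
  filter_upwards [hU.mem_nhds hx.1, dom_mem_nhds hxx,
    (hσ.contMDiffAt (hU.mem_nhds hx.1) hxx).continuousAt.eventually_ne h0] with y hyU hy hy0
  exact ⟨hyU, fun h => hy0 ((σ.mem_zeroSet_iff hy).1 h)⟩

lemma scaleForm_coordField_eventuallyEq (D : Conn n M) (hU : IsOpen U) (hσ : σ.SmoothOn U)
    (hxU : x ∈ U) (hx : x ∈ dom n c) (a : Fin n) :
    (fun y => scaleForm D.toFun σ y (coordField n c a y)) =ᶠ[𝓝 x]
      fun y => -nabla D.toFun σ c a y / σ.comp c y := by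
  filter_upwards [hU.mem_nhds hxU, dom_mem_nhds hx] with y hyU hy
  exact scaleForm_coordField D.isCovariantDerivativeOnUniv univ_mem hy
    (hσ.contMDiffAt (hU.mem_nhds hyU) hy) a

lemma contMDiffAt_scaleForm_coordField [T2Space M] {D : Conn n M} (hD : IsAffine n D)
    (hU : IsOpen U) (hσ : σ.SmoothOn U) (hxU : x ∈ U) (hx : x ∈ dom n c)
    (h0 : σ.comp c x ≠ 0) (a : Fin n) : ContMDiffAt (𝓡 n) 𝓘(ℝ) ∞
      (fun y => scaleForm D.toFun σ y (coordField n c a y)) x := by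
  have hs := hσ.contMDiffAt (hU.mem_nhds hxU) hx
  exact ((contMDiffAt_nabla hD hx hs a).neg.div₀ hs h0).congr_of_eventuallyEq
    (scaleForm_coordField_eventuallyEq D hU hσ hxU hx a)

lemma comp_ne_zero_of_mem_diff (hx : x ∈ dom n c) (h : x ∈ U \ σ.zeroSet) : σ.comp c x ≠ 0 :=
  fun h' => h.2 ((σ.mem_zeroSet_iff hx).2 h')

/-- A projective change turns `∇σ` into `∇σ + Υ σ`, which is zero for `Υ = -∇σ/σ`. The added terms
are symmetric in the two fields, so the torsion stays zero. -/
theorem isScaleConn_scaleConn [T2Space M] {p : ProjectiveStructure n M} {D : Conn n M}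
    (hD : D ∈ p.carrier) (hU : IsOpen U) (hσ : σ.SmoothOn U) :
    p.IsScaleConn σ (U \ σ.zeroSet) (scaleConn D.toFun σ) := by
  have hA := p.isAffine D hD
  have hO := isOpen_diff_zeroSet hU hσ
  have hcov : IsCovariantDerivativeOn (Model n) (scaleConn D.toFun σ) (U \ σ.zeroSet) :=
    isCovariantDerivativeOn_projChange (D.isCovariantDerivativeOnUniv.mono (subset_univ _)) _
  have hΥ : ∀ x ∈ U \ σ.zeroSet, ∀ c, x ∈ dom n c → ∀ i, ContMDiffAt (𝓡 n) 𝓘(ℝ) ∞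
      (fun y => scaleForm D.toFun σ y (coordField n c i y)) x := fun x hx c hxc i =>
    contMDiffAt_scaleForm_coordField hA hU hσ hx.1 hxc (comp_ne_zero_of_mem_diff hxc hx) i
  refine ⟨hcov, contMDiffCovariantDerivativeOn_of_christoffel hO hcov fun x hx k i j => ?_, ?_, ?_,
    ?_⟩
  · have hxx := mem_dom_self (n := n) x
    have hite : ∀ (P : Prop) [Decidable P] (i : Fin n), ContMDiffAt (𝓡 n) 𝓘(ℝ) ∞
        (fun y => if P then scaleForm D.toFun σ y (coordField n x i y) else 0) x := by
      intro P _ i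
      split_ifs
      · exact hΥ x hx x hxx i
      · exact contMDiffAt_const
    refine (((contMDiffAt_christoffel hA.1 hxx k i j).add (hite (j = k) i)).add
      (hite (i = k) j)).congr_of_eventuallyEq ?_
    filter_upwards [dom_mem_nhds hxx] with y hy
    exact christoffel_projChange _ _ hy k i j
  · intro X Y x _ hX hY
    rw [← (CovariantDerivative.torsion_eq_zero_iff D).1 hA.2 hX hY]
    simp only [scaleConn, projChange_apply]
    module
  · intro D' hD'
    refine (((p.mem_iff D' hD' D hA).1 hD).of_univ _).trans ⟨scaleForm D.toFun σ, fun Y hY =>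
      contMDiffOn_form_apply (fun x hx i =>
        (hΥ x hx x (mem_dom_self (n := n) x) i).contMDiffWithinAt) hY,
      fun Y x _ _ v => projChange_apply _ _ Y v⟩
  · intro c x hx a
    rw [scaleConn, nabla_projChange _ _ _ hx.2,
      scaleForm_coordField D.isCovariantDerivativeOnUniv univ_mem hx.2
        (hσ.contMDiffAt (hU.mem_nhds hx.1.1) hx.2)]
    have := comp_ne_zero_of_mem_diff hx.2 hx.1
    field_simp
    ring

lemma ricci_eq_schouten (hn : 2 ≤ n) (D : RawConn n M) (b d : Fin n) :
    ricci n D c b d x = n * schouten n D c b d x - schouten n D c d b x := by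
  have h2 : (2 : ℝ) ≤ n := by exact_mod_cast hn
  have : (n : ℝ) ^ 2 - 1 ≠ 0 := by nlinarith
  rw [schouten, schouten]
  field_simp
  ring

/-- The equation `∇_a ∇_b σ + P_ab σ = 0` becomes `∇_a Υ_b = P_ab + Υ_a Υ_b`. Substituted in the
Ricci change, together with `Ric_ab = n P_ab - P_ba`, it cancels every term. -/
theorem ricciFlatOn_scaleConn [T2Space M] {p : ProjectiveStructure n M} {D : Conn n M}
    (hn : 2 ≤ n) {τ : Density n M 2} {ε : ℝ} (hε : ε * ε = 1) (h : IsRootOn ε τ σ U)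
    (hL : p.RankOne τ) (hD : D ∈ p.carrier) (hU : IsOpen U) :
    RicciFlatOn (scaleConn D.toFun σ) (U \ σ.zeroSet) := by
  intro c x hx b d
  have hA := p.isAffine D hD
  have h0 := comp_ne_zero_of_mem_diff hx.2 hx.1
  have hs := h.contMDiffAt hU hx.1.1 hx.2
  have hΥ : ∀ i, scaleForm D.toFun σ x (coordField n c i x) = -nabla D.toFun σ c i x / σ.comp c x :=
    fun i => scaleForm_coordField D.isCovariantDerivativeOnUniv univ_mem hx.2 hs i
  have hpd : ∀ a b, pd n c a (fun y => scaleForm D.toFun σ y (coordField n c b y)) x =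
      schouten n D.toFun c a b x
        + ∑ e, christoffel n D.toFun c e a b x * scaleForm D.toFun σ x (coordField n c e x)
        + scaleForm D.toFun σ x (coordField n c a x)
          * scaleForm D.toFun σ x (coordField n c b x) := by
    intro a b
    have hev := scaleForm_coordField_eventuallyEq D hU h.1 hx.1.1 hx.2 b
    -- Differentiating `Υ_b σ = -∇_b σ` avoids the quotient rule.
    have hmul : (fun y => scaleForm D.toFun σ y (coordField n c b y) * σ.comp c y) =ᶠ[𝓝 x]
        fun y => (-1) * nabla D.toFun σ c b y := by
      filter_upwards [hev, hs.continuousAt.eventually_ne h0] with y hy hy0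
      rw [hy]
      field_simp
    have h1 := pd_congr hx.2 hmul a
    rw [pd_mul hx.2 ((contMDiffAt_scaleForm_coordField hA hU h.1 hx.1.1 hx.2 h0 b).mdifferentiableAt
      (by simp)) (hs.mdifferentiableAt (by simp)), pd_const_mul hx.2 _
        ((contMDiffAt_nabla hA hx.2 hs b).mdifferentiableAt (by simp))] at h1
    have h2 := h.nabla2_add_schouten hε hU hL hx.1.1 hx.2 hD a b
    have h3 : ∀ i, nabla D.toFun σ c i x =
        -scaleForm D.toFun σ x (coordField n c i x) * σ.comp c x := fun i => by
      rw [hΥ]; field_simp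
    have h4 : pd n c a (σ.comp c) x = nabla D.toFun σ c a x
        - 1 / (n + 1) * (∑ k, christoffel n D.toFun c k a k x) * σ.comp c x := by
      rw [nabla]; ring
    simp only [nabla2, h3] at h2
    rw [h4, h3] at h1
    have h5 : ∑ k, christoffel n D.toFun c k a b x *
        (-scaleForm D.toFun σ x (coordField n c k x) * σ.comp c x) =
        -(∑ e, christoffel n D.toFun c e a b x * scaleForm D.toFun σ x (coordField n c e x))
          * σ.comp c x := by
      rw [neg_mul, Finset.sum_mul, ← Finset.sum_neg_distrib]
      exact Finset.sum_congr rfl fun k _ => by ring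
    rw [h5] at h2
    apply mul_left_cancel₀ h0
    linear_combination h1 - h2
  rw [scaleConn, ricci_projChange hx.2 (fun k i j => christoffel_symm hA.2 hx.2 k i j)
    (fun k i j => (contMDiffAt_christoffel hA.1 hx.2 k i j).mdifferentiableAt (by simp))
    (fun i => (contMDiffAt_scaleForm_coordField hA hU h.1 hx.1.1 hx.2 h0 i).mdifferentiableAt
      (by simp)), hpd, hpd, ricci_eq_schouten hn]
  ring

end change

/-! ### Projective compactness -/

/-- A set that is given near a point of its boundary by an inequality `0 ≤ F`, where `F` has
nonzero derivative, has unique derivatives there. -/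
lemma uniqueDiffWithinAt_of_hasFDerivAt {E : Type*} [NormedAddCommGroup E] [NormedSpace ℝ E]
    {F : E → ℝ} {L : E →L[ℝ] ℝ} {q : E} {T : Set E} (hF : HasFDerivAt F L q) (hL : L ≠ 0)
    (h0 : F q = 0) (hq : q ∈ T) (hT : ∀ᶠ q' in 𝓝 q, 0 < F q' → q' ∈ T) :
    UniqueDiffWithinAt ℝ T q := by
  -- A direction along which `F` increases points into `T`; such directions form an open half-space,
  -- which spans.
  have hcone : ∀ v, 0 < L v → v ∈ tangentConeAt ℝ T q := by
    intro v hv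
    have hl : HasDerivAt (fun t : ℝ => F (q + t • v)) (L v) 0 := by
      have h1 : HasDerivAt (fun t : ℝ => q + t • v) v 0 := by
        simpa using ((hasDerivAt_id (0 : ℝ)).smul_const v).const_add q
      have h2 : HasFDerivAt F L (q + (0 : ℝ) • v) := by simpa using hF
      exact h2.comp_hasDerivAt (0 : ℝ) h1
    have hpos : ∀ᶠ t in 𝓝[>] (0 : ℝ), 0 < F (q + t • v) := by
      have hsl := (hasDerivAt_iff_tendsto_slope.1 hl).eventually (lt_mem_nhds hv)
      have h3 : 𝓝[>] (0 : ℝ) ≤ 𝓝[≠] 0 := nhdsWithin_mono _ fun t ht => ne_of_gt ht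
      filter_upwards [h3 hsl, self_mem_nhdsWithin] with t ht ht0
      have ht0' : 0 < t := ht0
      rw [slope_def_field] at ht
      simp only [zero_smul, add_zero, h0, sub_zero] at ht
      exact (div_pos_iff_of_pos_right ht0').1 ht
    have htend : Tendsto (fun t : ℝ => q + t • v) (𝓝[>] 0) (𝓝 q) := by
      have : Continuous fun t : ℝ => q + t • v := by fun_prop
      simpa using (this.tendsto 0).mono_left nhdsWithin_le_nhds
    have hmem : ∀ᶠ t in 𝓝[>] (0 : ℝ), q + t • v ∈ T := by
      filter_upwards [hpos, htend.eventually hT] with t h1 h2 using h2 h1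
    have h3 : 𝓝[>] (0 : ℝ) ≤ 𝓝[≠] 0 := nhdsWithin_mono _ fun t ht => ne_of_gt ht
    exact mem_tangentConeAt_of_add_smul_mem (tendsto_id.mono_right h3) hmem
  obtain ⟨e, he⟩ : ∃ e, 0 < L e := by
    obtain ⟨e, he⟩ := ContinuousLinearMap.exists_ne_zero hL
    rcases lt_or_gt_of_ne he with h | h
    · exact ⟨-e, by simpa using h⟩
    · exact ⟨e, h⟩
  refine ⟨?_, subset_closure hq⟩
  have htop : Submodule.span ℝ (tangentConeAt ℝ T q) = ⊤ := by
    rw [eq_top_iff]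
    intro w _
    -- The coefficient makes the value of `L` equal to `L w + |L w| + 1 > 0`, so `w` is a difference
    -- of two vectors of the half-space.
    have h1 : w + ((|L w| + 1) / L e) • e ∈ Submodule.span ℝ (tangentConeAt ℝ T q) := by
      refine Submodule.subset_span (hcone _ ?_)
      rw [map_add, map_smul, smul_eq_mul, div_mul_cancel₀ _ he.ne']
      linarith [neg_abs_le (L w)]
    have h2 : ((|L w| + 1) / L e) • e ∈ Submodule.span ℝ (tangentConeAt ℝ T q) :=
      Submodule.smul_mem _ _ (Submodule.subset_span (hcone _ he))
    simpa using Submodule.sub_mem _ h1 h2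
  rw [htop]
  exact dense_univ

section compact

variable {n : ℕ} {M : Type*} [TopologicalSpace M] [ChartedSpace (Model n) M]
  [IsManifold (𝓡 n) ∞ M] {c x : M}

/-- The set `A` in the coordinates of the chart at `c`. -/
def coordImage (n : ℕ) {M : Type*} [TopologicalSpace M] [ChartedSpace (Model n) M] (c : M)
    (A : Set M) : Set (Model n) :=
  (extChartAt (𝓡 n) c).target ∩ (extChartAt (𝓡 n) c).symm ⁻¹' A

/-- The partial derivative of `f` in the chart at `c`, relative to the set `A`. -/
def pdWithin (n : ℕ) {M : Type*} [TopologicalSpace M] [ChartedSpace (Model n) M] (c : M)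
    (A : Set M) (a : Fin n) (f : M → ℝ) (x : M) : ℝ :=
  fderivWithin ℝ (f ∘ (extChartAt (𝓡 n) c).symm) (coordImage n c A) (extChartAt (𝓡 n) c x)
    (EuclideanSpace.single a 1)

lemma coordImage_mem_nhds {A : Set M} (hx : x ∈ dom n c) (hA : A ∈ 𝓝 x) :
    coordImage n c A ∈ 𝓝 (extChartAt (𝓡 n) c x) := by
  refine inter_mem (extChartAt_target_mem_nhds' ?_) ?_
  · exact (extChartAt (𝓡 n) c).map_source (mem_extChartAt_source_of_mem_dom hx)
  · have h := (contMDiffAt_extChartAt_symm hx).continuousAt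
    rw [ContinuousAt, extChartAt_symm_apply hx] at h
    exact h hA

lemma pdWithin_eq_pd {A : Set M} (hx : x ∈ dom n c) (hA : A ∈ 𝓝 x) (a : Fin n) (f : M → ℝ) :
    pdWithin n c A a f x = pd n c a f x := by
  rw [pdWithin, pd, fderivWithin_of_mem_nhds (coordImage_mem_nhds hx hA)]

/-- A function that is smooth only up to the boundary has no controlled values beyond it, so `pd`
carries no information at boundary points. The relative derivative does, and it is smooth by
uniqueness of derivatives. -/
lemma contMDiffOn_pdWithin {A : Set M} (hA : A ⊆ dom n c)
    (hu : UniqueDiffOn ℝ (coordImage n c A)) {f : M → ℝ}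
    (hf : ContMDiffOn (𝓡 n) 𝓘(ℝ) ∞ f A) (a : Fin n) :
    ContMDiffOn (𝓡 n) 𝓘(ℝ) ∞ (pdWithin n c A a f) A := by
  have h1 : ContDiffOn ℝ ∞ (f ∘ (extChartAt (𝓡 n) c).symm) (coordImage n c A) := by
    rw [← contMDiffOn_iff_contDiffOn]
    exact hf.comp ((contMDiffOn_extChartAt_symm c).mono inter_subset_left) inter_subset_right
  have h2 : ContDiffOn ℝ ∞ (fun q => fderivWithin ℝ (f ∘ (extChartAt (𝓡 n) c).symm)
      (coordImage n c A) q (EuclideanSpace.single a 1)) (coordImage n c A) :=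
    (h1.fderivWithin hu (by simp)).clm_apply contDiffOn_const
  have h3 : ContMDiffOn (𝓡 n) 𝓘(ℝ, Model n) ∞ (extChartAt (𝓡 n) c) A := fun y hy =>
    (contMDiffAt_extChartAt_of_mem_dom (hA hy)).contMDiffWithinAt
  refine (contMDiffOn_iff_contDiffOn.2 h2).comp h3 fun y hy => ⟨?_, ?_⟩
  · exact (extChartAt (𝓡 n) c).map_source (mem_extChartAt_source_of_mem_dom (hA hy))
  · rw [mem_preimage, extChartAt_symm_apply (hA hy)]
    exact hy

lemma uniqueDiffOn_coordImage {V : Set M} {r : M → ℝ} (hV : IsOpen V) (hVc : V ⊆ dom n c)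
    (hr : ContMDiffOn (𝓡 n) 𝓘(ℝ) ∞ r V) {a : Fin n} (ha : ∀ y ∈ V, pd n c a r y ≠ 0) :
    UniqueDiffOn ℝ (coordImage n c (V ∩ {y | 0 ≤ r y})) := by
  rintro q ⟨hq, hqV, hqr⟩
  have hqr : 0 ≤ r ((extChartAt (𝓡 n) c).symm q) := hqr
  have hqV : (extChartAt (𝓡 n) c).symm q ∈ V := hqV
  obtain ⟨y, hy⟩ : ∃ y, y = (extChartAt (𝓡 n) c).symm q := ⟨_, rfl⟩
  have hqy : extChartAt (𝓡 n) c y = q := by rw [hy, (extChartAt (𝓡 n) c).right_inv hq]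
  rw [← hy] at hqr hqV
  have hyc := hVc hqV
  have hry := hr.contMDiffAt (hV.mem_nhds hqV)
  rcases hqr.eq_or_lt with h0 | hpos
  · rw [← hqy]
    refine uniqueDiffWithinAt_of_hasFDerivAt (F := r ∘ (extChartAt (𝓡 n) c).symm)
      (differentiableAt_comp_symm hyc (hry.mdifferentiableAt (by simp))).hasFDerivAt ?_ ?_ ?_ ?_
    · intro h
      apply ha y hqV
      rw [pd, h]
      rfl
    · rw [Function.comp_apply, extChartAt_symm_apply hyc, h0]
    · refine ⟨by rw [hqy]; exact hq, ?_, ?_⟩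
      · rw [extChartAt_symm_apply hyc]; exact hqV
      · change 0 ≤ r _
        rw [extChartAt_symm_apply hyc, ← h0]
    · filter_upwards [coordImage_mem_nhds hyc (hV.mem_nhds hqV)] with q' hq' hpos
      exact ⟨hq'.1, hq'.2, hpos.le⟩
  · rw [← hqy]
    refine uniqueDiffWithinAt_of_mem_nhds (coordImage_mem_nhds hyc (inter_mem (hV.mem_nhds hqV) ?_))
    filter_upwards [hry.continuousAt.eventually (lt_mem_nhds hpos)] with z hz using hz.le

variable {σ : Density n M 1} {U : Set M}

/-- The components of the projectively related connection that is smooth up to the boundary. -/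
lemma coordComp_scaleConn {D : Conn n M} (hU : IsOpen U) (hσ : σ.SmoothOn U)
    (hxU : x ∈ U) (hx : x ∈ dom n c) (h0 : σ.comp c x ≠ 0) {δ : ℝ} (hδ : δ ≠ 0) {ξ : VField n M}
    (hξ : MDifferentiableAt (𝓡 n) (𝓡 n).tangent (toTotal n ξ) x) (v : Tan n x) (k : Fin n) :
    coordComp n c (scaleConn D.toFun σ ξ x v
      + (mvfderiv (𝓡 n) (fun y => δ * σ.comp c y) x v / (1 * (δ * σ.comp c x))) • ξ x
      + (mvfderiv (𝓡 n) (fun y => δ * σ.comp c y) x (ξ x) / (1 * (δ * σ.comp c x))) • v) k =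
    (∑ i, coordComp n c v i * pd n c i (fun y => coordComp n c (ξ y) k) x)
      + (∑ i, ∑ j, christoffel n D.toFun c k i j x * coordComp n c v i * coordComp n c (ξ x) j)
      - 1 / (n + 1) * ((∑ a, coordComp n c v a * ∑ l, christoffel n D.toFun c l a l x)
          * coordComp n c (ξ x) k
        + (∑ a, coordComp n c (ξ x) a * ∑ l, christoffel n D.toFun c l a l x)
          * coordComp n c v k) := by
  have hs := hσ.contMDiffAt (hU.mem_nhds hxU) hx
  have hsd := hs.mdifferentiableAt (n := ∞) (by simp)
  -- In a chart `Υ = -dσ/σ - (1/(n+1)) tr Γ`. The singular part `-dσ/σ` is exactly what `dr/r`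
  -- cancels for `r = δ σ`.
  have hΥ : ∀ w : Tan n x, scaleForm D.toFun σ x w = -(mvfderiv (𝓡 n) (σ.comp c) x w) / σ.comp c x
      - 1 / (n + 1) * ∑ a, coordComp n c w a * ∑ l, christoffel n D.toFun c l a l x := by
    intro w
    rw [scaleForm_apply D.isCovariantDerivativeOnUniv univ_mem hx hs,
      nablaAlong_eq D.toFun hx hsd, christoffelTrace_eq _ hx]
    field_simp
    ring
  have hr : ∀ w : Tan n x, mvfderiv (𝓡 n) (fun y => δ * σ.comp c y) x w =
      δ * mvfderiv (𝓡 n) (σ.comp c) x w := by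
    intro w
    rw [mvfderiv_eq_sum (f := fun y => δ * σ.comp c y) hx (mdifferentiableAt_const.mul hsd),
      mvfderiv_eq_sum hx hsd,
      Finset.mul_sum]
    exact Finset.sum_congr rfl fun k _ => by rw [pd_const_mul hx _ hsd]; ring
  simp only [scaleConn, projChange_apply, coordComp_add hx, coordComp_smul hx, hΥ, hr,
    coordComp_cov D.isCovariantDerivativeOnUniv univ_mem hx hξ]
  rw [mvfderiv_eq_sum hx ((mdifferentiableAt_iff_coordComp hx ξ).1 hξ k)]
  field_simp
  ring

/-- The sign of `δ` selects the side of the hypersurface, and `δ σ` in a chart is the defining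
function. After cancellation the connection is `D` changed by the Christoffel trace, which is smooth
across the boundary. -/
theorem isProjectivelyCompact_scaleConn [T2Space M] {p : ProjectiveStructure n M} {D : Conn n M}
    (hD : D ∈ p.carrier) (hU : IsOpen U) (hσ : σ.SmoothOn U) (hdef : p.IsDefiningOn σ U)
    {δ : ℝ} (hδ : δ ≠ 0) {N N' : Set M}
    (hN : ∀ c, ∀ x ∈ dom n c, x ∈ N ↔ x ∈ U ∧ 0 ≤ δ * σ.comp c x)
    (hN' : ∀ c, ∀ x ∈ dom n c, x ∈ N' ↔ x ∈ U ∧ 0 < δ * σ.comp c x) :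
    IsProjectivelyCompact 1 (scaleConn D.toFun σ) N N' (U ∩ σ.zeroSet) := by
  have hA := p.isAffine D hD
  have hB : ∀ c, ∀ x ∈ dom n c, x ∈ U ∩ σ.zeroSet ↔ x ∈ U ∧ δ * σ.comp c x = 0 := by
    intro c x hx
    rw [mem_inter_iff, σ.mem_zeroSet_iff hx, mul_eq_zero, or_iff_right hδ]
  have hopen : IsOpen N' := by
    refine isOpen_iff_mem_nhds.2 fun x hx => ?_
    have hxx := mem_dom_self (n := n) x
    obtain ⟨hxU, hpos⟩ := (hN' x x hxx).1 hx
    filter_upwards [hU.mem_nhds hxU, dom_mem_nhds hxx, ((hσ.contMDiffAt (hU.mem_nhds hxU)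
      hxx).continuousAt.const_mul δ).eventually (lt_mem_nhds hpos)] with y hyU hy hy0
    exact (hN' x y hy).2 ⟨hyU, hy0⟩
  refine ⟨?_, ?_, hopen, ?_⟩
  · ext x
    have hxx := mem_dom_self (n := n) x
    rw [mem_union, hN x x hxx, hN' x x hxx, hB x x hxx, ← and_or_left, le_iff_lt_or_eq, eq_comm]
  · rw [Set.disjoint_left]
    intro x hx hx'
    have hxx := mem_dom_self (n := n) x
    exact ((hN' x x hxx).1 hx).2.ne' ((hB x x hxx).1 hx').2
  intro c hcB
  have hcc := mem_dom_self (n := n) c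
  have hsU : ∀ y ∈ U, y ∈ dom n c → ContMDiffAt (𝓡 n) 𝓘(ℝ) ∞ (σ.comp c) y := fun y hyU hy =>
    hσ.contMDiffAt (hU.mem_nhds hyU) hy
  obtain ⟨a, ha⟩ := hdef D hD c c ⟨hcB, hcc⟩
  rw [nabla_eq_pd ((σ.mem_zeroSet_iff hcc).1 hcB.2)] at ha
  set V : Set M := {y | (y ∈ U ∧ y ∈ dom n c) ∧ pd n c a (σ.comp c) y ≠ 0} with hVdef
  have hV : IsOpen V := by
    refine isOpen_iff_mem_nhds.2 fun y hy => ?_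
    filter_upwards [hU.mem_nhds hy.1.1, dom_mem_nhds hy.1.2, (contMDiffAt_pd hy.1.2
      (hsU y hy.1.1 hy.1.2) a).continuousAt.eventually_ne hy.2] with z h1 h2 h3 using ⟨⟨h1, h2⟩, h3⟩
  have hVc : V ⊆ dom n c := fun y hy => hy.1.2
  have hr : ContMDiffOn (𝓡 n) 𝓘(ℝ) ∞ (fun y => δ * σ.comp c y) V := fun y hy =>
    (contMDiffAt_const.mul (hsU y hy.1.1 hy.1.2)).contMDiffWithinAt
  have hpd : ∀ y ∈ V, pd n c a (fun y => δ * σ.comp c y) y ≠ 0 := fun y hy => by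
    rw [pd_const_mul hy.1.2 _ ((hsU y hy.1.1 hy.1.2).mdifferentiableAt (by simp))]
    exact mul_ne_zero hδ hy.2
  have hVN : V ∩ N = V ∩ {y | 0 ≤ δ * σ.comp c y} := by
    ext y
    refine and_congr_right fun hy => ?_
    rw [hN c y hy.1.2]
    exact and_iff_right hy.1.1
  refine ⟨V, hV, ⟨⟨hcB.1, hcc⟩, ha⟩, fun y => δ * σ.comp c y, hr, fun y hy => ⟨?_, ?_⟩, ?_, ?_⟩
  · rw [hN c y hy.1.2]
    exact and_iff_right hy.1.1
  · rw [hB c y hy.1.2]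
    exact and_iff_right hy.1.1
  · intro y hy h
    apply hpd y hy.1
    rw [pd_eq_mvfderiv (hVc hy.1) ((hr.contMDiffAt (hV.mem_nhds hy.1)).mdifferentiableAt (by simp)),
      h]
    rfl
  intro μ ξ hμ hξ
  have hsub : V ∩ N ⊆ dom n c := fun y hy => hy.1.1.2
  have hu : UniqueDiffOn ℝ (coordImage n c (V ∩ N)) := by
    rw [hVN]
    exact uniqueDiffOn_coordImage hV hVc hr hpd
  have hμk : ∀ k, ContMDiffOn (𝓡 n) 𝓘(ℝ) ∞ (fun y => coordComp n c (μ y) k) (V ∩ N) :=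
    fun k y hy => (contMDiffWithinAt_iff_coordComp (hsub hy) μ).1 (hμ y hy) k
  have hξk : ∀ k, ContMDiffOn (𝓡 n) 𝓘(ℝ) ∞ (fun y => coordComp n c (ξ y) k) (V ∩ N) :=
    fun k y hy => (contMDiffWithinAt_iff_coordComp (hsub hy) ξ).1 (hξ y hy) k
  have hΓ : ∀ k i j, ContMDiffOn (𝓡 n) 𝓘(ℝ) ∞ (christoffel n D.toFun c k i j) (V ∩ N) :=
    fun k i j y hy => (contMDiffAt_christoffel hA.1 (hsub hy) k i j).contMDiffWithinAt
  have hγ : ∀ {f : Fin n → M → ℝ}, (∀ k, ContMDiffOn (𝓡 n) 𝓘(ℝ) ∞ (f k) (V ∩ N)) →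
      ContMDiffOn (𝓡 n) 𝓘(ℝ) ∞
        (fun y => ∑ a, f a y * ∑ l, christoffel n D.toFun c l a l y) (V ∩ N) := fun hf =>
    contMDiffOn_finsetSum fun a _ => (hf a).mul (contMDiffOn_finsetSum fun l _ => hΓ l a l)
  -- The components from `coordComp_scaleConn`, with partial derivatives of `ξ` taken relative to
  -- the domain so that they make sense on the boundary.
  set F : Fin n → M → ℝ := fun k y =>
    (∑ i, coordComp n c (μ y) i * pdWithin n c (V ∩ N) i (fun y => coordComp n c (ξ y) k) y)
      + (∑ i, ∑ j, christoffel n D.toFun c k i j y * coordComp n c (μ y) i * coordComp n c (ξ y) j)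
      - 1 / (n + 1) * ((∑ a, coordComp n c (μ y) a * ∑ l, christoffel n D.toFun c l a l y)
          * coordComp n c (ξ y) k
        + (∑ a, coordComp n c (ξ y) a * ∑ l, christoffel n D.toFun c l a l y)
          * coordComp n c (μ y) k) with hF
  have hFs : ∀ k, ContMDiffOn (𝓡 n) 𝓘(ℝ) ∞ (F k) (V ∩ N) := by
    intro k
    refine ((contMDiffOn_finsetSum fun i _ => (hμk i).mul
      (contMDiffOn_pdWithin hsub hu (hξk k) i)).add
      (contMDiffOn_finsetSum fun i _ => contMDiffOn_finsetSum fun j _ =>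
        ((hΓ k i j).mul (hμk i)).mul (hξk j))).sub
      (contMDiffOn_const.mul (((hγ hμk).mul (hξk k)).add ((hγ hξk).mul (hμk k))))
  set S : VField n M := fun y => ∑ k, F k y • coordField n c k y with hS
  have hSc : ∀ y ∈ dom n c, ∀ k, coordComp n c (S y) k = F k y := by
    intro y hy k
    rw [hS, coordComp_sum hy]
    simp [coordComp_smul hy, coordComp_coordField hy]
  refine ⟨S, fun y hy => (contMDiffWithinAt_iff_coordComp (hsub hy) S).2 fun k =>
    (hFs k y hy).congr (fun z hz => hSc z (hsub hz) k) (hSc y (hsub hy) k), ?_⟩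
  rintro y ⟨hyV, hyN'⟩
  have hy := hyV.1.2
  have hpos := ((hN' c y hy).1 hyN').2
  have hNy : V ∩ N ∈ 𝓝 y := by
    filter_upwards [hV.mem_nhds hyV, hopen.mem_nhds hyN'] with z hz hz'
    have := (hN' c z hz.1.2).1 hz'
    exact ⟨hz, (hN c z hz.1.2).2 ⟨this.1, this.2.le⟩⟩
  refine eq_of_coordComp_eq hy fun k => ?_
  rw [coordComp_scaleConn hU hσ hyV.1.1 hy (fun h => by rw [h, mul_zero] at hpos; exact hpos.ne rfl)
    hδ ((hξ.contMDiffAt hNy).mdifferentiableAt (by simp)), hSc y hy]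
  simp only [hF, pdWithin_eq_pd hy hNy]

end compact

/-! ### Slice charts -/

/-- Insertion of a coordinate at the index `j`. -/
def insertCoord {m : ℕ} (j : Fin (m + 1)) : (Model m × ℝ) ≃L[ℝ] Model (m + 1) :=
  LinearEquiv.toContinuousLinearEquiv
    { toFun := fun p => WithLp.toLp 2 (j.insertNth p.2 (fun i => p.1 i) : Fin (m + 1) → ℝ)
      map_add' := fun p q => by
        ext k
        refine Fin.succAboveCases j ?_ (fun i => ?_) k <;> simp
      map_smul' := fun r p => by
        ext k
        refine Fin.succAboveCases j ?_ (fun i => ?_) k <;> simp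
      invFun := fun q => (WithLp.toLp 2 fun i => q (j.succAbove i), q j)
      left_inv := fun p => by
        refine Prod.ext ?_ ?_
        · ext i; simp
        · simp
      right_inv := fun q => by
        ext k
        refine Fin.succAboveCases j ?_ (fun i => ?_) k <;> simp }

/-- Removal of the coordinate with the index `j`. -/
def dropCoord {m : ℕ} (j : Fin (m + 1)) : Model (m + 1) →L[ℝ] Model m :=
  (ContinuousLinearMap.fst ℝ (Model m) ℝ).comp (insertCoord j).symm.toContinuousLinearMap

lemma insertCoord_self {m : ℕ} (j : Fin (m + 1)) (p : Model m × ℝ) : insertCoord j p j = p.2 := by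
  simp [insertCoord]

lemma insertCoord_succAbove {m : ℕ} (j : Fin (m + 1)) (p : Model m × ℝ) (i : Fin m) :
    insertCoord j p (j.succAbove i) = p.1 i := by
  simp [insertCoord]

lemma dropCoord_apply {m : ℕ} (j : Fin (m + 1)) (q : Model (m + 1)) (i : Fin m) :
    dropCoord j q i = q (j.succAbove i) := rfl

lemma dropCoord_insertCoord {m : ℕ} (j : Fin (m + 1)) (p : Model m × ℝ) :
    dropCoord j (insertCoord j p) = p.1 := by
  ext i
  rw [dropCoord_apply, insertCoord_succAbove]

lemma insertCoord_dropCoord {m : ℕ} (j : Fin (m + 1)) (q : Model (m + 1)) :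
    insertCoord j (dropCoord j q, q j) = q := by
  ext k
  refine Fin.succAboveCases j ?_ (fun i => ?_) k
  · rw [insertCoord_self]
  · rw [insertCoord_succAbove, dropCoord_apply]

section slice

variable {m : ℕ} {M : Type*} [TopologicalSpace M] [ChartedSpace (Model (m + 1)) M]
  [IsManifold (𝓡 (m + 1)) ∞ M]

/-- A linear map that replaces the coordinate with index `j`. -/
lemma exists_equiv_replaceCoord (j : Fin (m + 1)) {L : Model (m + 1) →L[ℝ] ℝ}
    (hL : L (EuclideanSpace.single j 1) ≠ 0) :
    ∃ e : Model (m + 1) ≃L[ℝ] Model (m + 1), (e : Model (m + 1) →L[ℝ] Model (m + 1)) =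
      (insertCoord j).toContinuousLinearMap.comp ((dropCoord j).prod L) := by
  set A : Model (m + 1) →L[ℝ] Model (m + 1) :=
    (insertCoord j).toContinuousLinearMap.comp ((dropCoord j).prod L) with hA
  have hinj : Function.Injective (A : Model (m + 1) →ₗ[ℝ] Model (m + 1)) := by
    refine (injective_iff_map_eq_zero _).2 fun q hq => ?_
    have h1 : (dropCoord j q, L q) = 0 := (insertCoord j).injective (by
      rw [map_zero]; exact hq)
    have h2 : dropCoord j q = 0 := congrArg Prod.fst h1
    have h3 : L q = 0 := congrArg Prod.snd h1
    -- A kernel vector has only its `j`-th coordinate, and `L` does not kill `e_j`.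
    have h4 : q = q j • EuclideanSpace.single j (1 : ℝ) := by
      ext k
      refine Fin.succAboveCases j ?_ (fun i => ?_) k
      · simp
      · rw [← dropCoord_apply, h2]
        simp [Fin.succAbove_ne]
    rw [h4, map_smul, smul_eq_mul, mul_eq_zero, or_iff_left hL] at h3
    rw [h4, h3, zero_smul]
  refine ⟨(LinearEquiv.ofInjectiveEndo (A : Model (m + 1) →ₗ[ℝ] Model (m + 1))
    hinj).toContinuousLinearEquiv, ?_⟩
  ext q : 1
  rfl

/-- The zero set of a function with nonzero partial derivative with respect to the `j`-th
coordinate is a slice in the chart in which the `j`-th coordinate is replaced by the function. -/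
theorem exists_sliceChart {z : M} {W : Set M} (hW : IsOpen W) (hzW : z ∈ W)
    (hWd : W ⊆ dom (m + 1) z) {s : M → ℝ} {j : Fin (m + 1)}
    (hs : ∀ y ∈ W, ContMDiffAt (𝓡 (m + 1)) 𝓘(ℝ) ∞ s y)
    (hj : ∀ y ∈ W, pd (m + 1) z j s y ≠ 0) :
    ∃ Ψ : OpenPartialHomeomorph M (Model (m + 1)),
      Ψ ∈ IsManifold.maximalAtlas (𝓡 (m + 1)) ∞ M ∧ z ∈ Ψ.source ∧ Ψ.source ⊆ W ∧
      ∀ y ∈ Ψ.source,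
        Ψ y = insertCoord j (dropCoord j (extChartAt (𝓡 (m + 1)) z y), s y) := by
  set φ := chartAt (Model (m + 1)) z with hφ
  set F : Model (m + 1) → Model (m + 1) := fun q =>
    insertCoord j (dropCoord j q, (s ∘ (extChartAt (𝓡 (m + 1)) z).symm) q) with hF
  have hFc : ∀ y ∈ W, ContDiffAt ℝ ∞ F (extChartAt (𝓡 (m + 1)) z y) := fun y hy =>
    (insertCoord j).contDiff.contDiffAt.comp _ (((dropCoord j).contDiff.contDiffAt).prodMk
      (contDiffAt_comp_symm (hWd hy) (hs y hy)))
  have hFd : ∀ y ∈ W, ∃ e : Model (m + 1) ≃L[ℝ] Model (m + 1),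
      HasFDerivAt F (e : Model (m + 1) →L[ℝ] Model (m + 1)) (extChartAt (𝓡 (m + 1)) z y) := by
    intro y hy
    obtain ⟨e, he⟩ := exists_equiv_replaceCoord j (hj y hy)
    refine ⟨e, ?_⟩
    rw [he]
    exact (insertCoord j).toContinuousLinearMap.hasFDerivAt.comp _
      ((dropCoord j).hasFDerivAt.prodMk (differentiableAt_comp_symm (hWd hy)
        ((hs y hy).mdifferentiableAt (by simp))).hasFDerivAt)
  obtain ⟨e, he⟩ := hFd z hzW
  set g := (hFc z hzW).toOpenPartialHomeomorph F he (by simp) with hg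
  have hgF : ∀ q, g q = F q := fun q => rfl
  set Ψ := (φ.restrOpen W hW).trans g with hΨ
  have hsrc : Ψ.source ⊆ W := fun y hy => hy.1.2
  have hform : ∀ y ∈ Ψ.source,
      Ψ y = insertCoord j (dropCoord j (extChartAt (𝓡 (m + 1)) z y), s y) := by
    intro y hy
    change insertCoord j (dropCoord j (extChartAt (𝓡 (m + 1)) z y),
      s ((extChartAt (𝓡 (m + 1)) z).symm (extChartAt (𝓡 (m + 1)) z y))) = _
    rw [extChartAt_symm_apply (hWd (hsrc hy))]
  refine ⟨Ψ, ?_, ?_, hsrc, hform⟩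
  · refine Ψ.mem_maximalAtlas_of_contMDiffOn ?_ ?_
    · intro y hy
      have hyW := hsrc hy
      have h1 : ContMDiffAt (𝓡 (m + 1)) 𝓘(ℝ, Model (m + 1)) ∞ (fun y =>
          insertCoord j (dropCoord j (extChartAt (𝓡 (m + 1)) z y), s y)) y :=
        (insertCoord j).contDiff.contMDiff.contMDiffAt.comp y
          (((dropCoord j).contDiff.contMDiff.contMDiffAt.comp y
            (contMDiffAt_extChartAt_of_mem_dom (hWd hyW))).prodMk_space (hs y hyW))
      exact h1.contMDiffWithinAt.congr (fun y hy => hform y hy) (hform y hy)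
    · intro a ha
      have hy : Ψ.symm a ∈ Ψ.source := Ψ.map_target ha
      set y := Ψ.symm a with hya
      have hyW := hsrc hy
      have hag : a ∈ g.target := ha.1
      have hga : g.symm a ∈ φ.target := ha.2.1
      have hext : extChartAt (𝓡 (m + 1)) z y = g.symm a := φ.right_inv hga
      obtain ⟨e, he⟩ := hFd y hyW
      -- The inverse function theorem is applied at `z`, but smoothness of the inverse is needed on
      -- the whole target; `dF` is invertible at all points of `W`.
      have h1 : ContDiffAt ℝ ∞ g.symm a := by
        refine g.contDiffAt_symm hag (f₀' := e) ?_ ?_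
        · rw [← hext]; exact he
        · rw [← hext]; exact hFc y hyW
      have h2 := contMDiffAt_extChartAt_symm (hWd hyW)
      rw [hext] at h2
      exact (h2.comp a h1.contMDiffAt).contMDiffWithinAt
  · refine ⟨⟨mem_chart_source _ z, hzW⟩, ?_⟩
    exact (hFc z hzW).mem_toOpenPartialHomeomorph_source he (by simp)

/-- The restriction of a slice chart to the slice. -/
def sliceChart {Z : Set M} (Ψ : OpenPartialHomeomorph M (Model (m + 1))) (j : Fin (m + 1))
    (h : ∀ y ∈ Ψ.source, y ∈ Z ↔ Ψ y j = 0) (z : Z) : OpenPartialHomeomorph Z (Model m) :=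
  have hmem : ∀ u : Model m, insertCoord j (u, 0) ∈ Ψ.target → Ψ.symm (insertCoord j (u, 0)) ∈ Z :=
    fun u hu => (h _ (Ψ.map_target hu)).2 (by rw [Ψ.right_inv hu, insertCoord_self])
  have hins : ∀ y : Z, y.1 ∈ Ψ.source → insertCoord j (dropCoord j (Ψ y.1), 0) = Ψ y.1 := by
    intro y hy
    conv_rhs => rw [← insertCoord_dropCoord j (Ψ y.1)]
    rw [(h _ hy).1 y.2]
  open scoped Classical in
  { toFun := fun y => dropCoord j (Ψ y.1)
    -- `z` is only a default value; for `u` in the target the point lies in `Z`.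
    invFun := fun u => if hu : Ψ.symm (insertCoord j (u, 0)) ∈ Z then ⟨_, hu⟩ else z
    source := Subtype.val ⁻¹' Ψ.source
    target := {u | insertCoord j (u, 0) ∈ Ψ.target}
    map_source' := fun y hy => by
      rw [mem_ofPred_eq, hins y hy]
      exact Ψ.map_source hy
    map_target' := fun u hu => by
      rw [dif_pos (hmem u hu)]
      exact Ψ.map_target hu
    left_inv' := fun y hy => by
      have h1 : Ψ.symm (insertCoord j (dropCoord j (Ψ y.1), 0)) = y.1 := by
        rw [hins y hy, Ψ.left_inv hy]
      rw [dif_pos (by rw [h1]; exact y.2)]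
      exact Subtype.ext h1
    right_inv' := fun u hu => by
      rw [dif_pos (hmem u hu)]
      change dropCoord j (Ψ (Ψ.symm _)) = u
      rw [Ψ.right_inv hu, dropCoord_insertCoord]
    open_source := Ψ.open_source.preimage continuous_subtype_val
    open_target := Ψ.open_target.preimage (by fun_prop)
    continuousOn_toFun := (dropCoord j).continuous.comp_continuousOn
      (Ψ.continuousOn.comp continuous_subtype_val.continuousOn fun _ hy => hy)
    continuousOn_invFun := by
      rw [Topology.IsInducing.subtypeVal.continuousOn_iff]
      have h1 : ContinuousOn (fun u : Model m => Ψ.symm (insertCoord j (u, 0)))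
          {u | insertCoord j (u, 0) ∈ Ψ.target} :=
        Ψ.continuousOn_symm.comp (Continuous.continuousOn (by fun_prop)) fun _ hu => hu
      refine h1.congr fun u hu => ?_
      rw [Function.comp_apply, dif_pos (hmem u hu)] }

omit [ChartedSpace (Model (m + 1)) M] [IsManifold (𝓡 (m + 1)) ∞ M] in
lemma sliceChart_symm_apply {Z : Set M} (Ψ : OpenPartialHomeomorph M (Model (m + 1)))
    (j : Fin (m + 1)) (h : ∀ y ∈ Ψ.source, y ∈ Z ↔ Ψ y j = 0) (z : Z) {u : Model m}
    (hu : insertCoord j (u, 0) ∈ Ψ.target) :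
    ((sliceChart Ψ j h z).symm u).1 = Ψ.symm (insertCoord j (u, 0)) := by
  have hmem : Ψ.symm (insertCoord j (u, 0)) ∈ Z :=
    (h _ (Ψ.map_target hu)).2 (by rw [Ψ.right_inv hu, insertCoord_self])
  exact congrArg Subtype.val (dif_pos hmem)

/-- A locally regular level set is a smoothly embedded hypersurface; around each point it has
coordinates that are obtained from those of the ambient manifold by omission of one of them. -/
theorem exists_hypersurface_structure {Z : Set M} (j : Z → Fin (m + 1)) (s : Z → M → ℝ)
    (W : Z → Set M) (hW : ∀ z, IsOpen (W z)) (hzW : ∀ z, z.1 ∈ W z)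
    (hWd : ∀ z, W z ⊆ dom (m + 1) z.1)
    (hs : ∀ z, ∀ y ∈ W z, ContMDiffAt (𝓡 (m + 1)) 𝓘(ℝ) ∞ (s z) y)
    (hj : ∀ z, ∀ y ∈ W z, pd (m + 1) z.1 (j z) (s z) y ≠ 0)
    (hZ : ∀ z, ∀ y ∈ W z, y ∈ Z ↔ s z y = 0) :
    ∃ (_ : ChartedSpace (Model m) Z) (_ : IsManifold (𝓡 m) ∞ Z),
      Manifold.IsSmoothEmbedding (𝓡 m) (𝓡 (m + 1)) ∞ (Subtype.val : Z → M) ∧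
      ∀ z, ∀ y ∈ dom m z, y.1 ∈ W z ∧
        extChartAt (𝓡 m) z y = dropCoord (j z) (extChartAt (𝓡 (m + 1)) z.1 y.1) := by
  choose Ψ hmax hzΨ hΨW hΨ using fun z =>
    exists_sliceChart (hW z) (hzW z) (hWd z) (hs z) (hj z)
  have hslice : ∀ z, ∀ y ∈ (Ψ z).source, y ∈ Z ↔ Ψ z y (j z) = 0 := by
    intro z y hy
    rw [hΨ z y hy, insertCoord_self]
    exact hZ z y (hΨW z hy)
  set e : Z → OpenPartialHomeomorph Z (Model m) := fun z => sliceChart (Ψ z) (j z) (hslice z) z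
  let cs : ChartedSpace (Model m) Z :=
    { atlas := range e
      chartAt := e
      mem_chart_source := hzΨ
      chart_mem_atlas := fun z => mem_range_self z }
  have hman : IsManifold (𝓡 m) ∞ Z := by
    refine isManifold_of_contDiffOn (𝓡 m) ∞ Z ?_
    rintro _ _ ⟨z, rfl⟩ ⟨z', rfl⟩
    intro u hu
    have hu1 : insertCoord (j z) (u, 0) ∈ (Ψ z).target := hu.1.1
    have hu2 : ((e z).symm u).1 ∈ (Ψ z').source := hu.1.2
    rw [sliceChart_symm_apply _ _ _ _ hu1] at hu2
    have h1 : ContMDiffAt 𝓘(ℝ, Model m) (𝓡 (m + 1)) ∞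
        (fun u : Model m => (Ψ z).symm (insertCoord (j z) (u, 0))) u :=
      (contMDiffAt_symm_of_mem_maximalAtlas (hmax z) hu1).comp u
        (ContDiff.contMDiff (by fun_prop)).contMDiffAt
    have h2 := (contMDiffAt_of_mem_maximalAtlas (hmax z') hu2).comp u h1
    have h3 : ContDiffAt ℝ ∞ (fun u : Model m =>
        dropCoord (j z') (Ψ z' ((Ψ z).symm (insertCoord (j z) (u, 0))))) u :=
      (dropCoord (j z')).contDiff.contDiffAt.comp u (contMDiffAt_iff_contDiffAt.1 h2)
    refine h3.contDiffWithinAt.congr ?_ ?_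
    · intro v hv
      change dropCoord (j z') (Ψ z' ((e z).symm v).1) = _
      have hv1 : insertCoord (j z) (v, 0) ∈ (Ψ z).target := hv.1.1
      rw [sliceChart_symm_apply _ _ _ _ hv1]
    · change dropCoord (j z') (Ψ z' ((e z).symm u).1) = _
      rw [sliceChart_symm_apply _ _ _ _ hu1]
  refine ⟨cs, hman, ⟨⟨ℝ, inferInstance, inferInstance, fun z => ?_⟩, .subtypeVal⟩, ?_⟩
  -- In the charts `e z` and `Ψ z` the inclusion is `u ↦ (u, 0)`, with the zero inserted at index `j
  -- z`.
  · refine Manifold.IsImmersionAtOfComplement.mk_of_continuousAt continuous_subtype_val.continuousAt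
      (insertCoord (j z)) (e z) (Ψ z) (hzΨ z) (hzΨ z)
      (StructureGroupoid.chart_mem_maximalAtlas _ z) (hmax z) ?_
    intro u hu
    have hu' : insertCoord (j z) (u, 0) ∈ (Ψ z).target := by
      rw [OpenPartialHomeomorph.extend_target] at hu
      exact hu.1
    change Ψ z ((e z).symm u).1 = insertCoord (j z) (u, 0)
    rw [sliceChart_symm_apply _ _ _ _ hu', (Ψ z).right_inv hu']
  · intro z y hy
    have hy' : y.1 ∈ (Ψ z).source := by
      rw [dom_eq] at hy
      exact hy
    refine ⟨hΨW z hy', ?_⟩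
    change dropCoord (j z) (Ψ z y.1) = _
    rw [hΨ z y.1 hy', dropCoord_insertCoord]

end slice

/-! ### Vector components as derivatives of coordinate functions. -/

section coordinates

variable {n : ℕ} {M : Type*} [TopologicalSpace M] [ChartedSpace (Model n) M]
  {c x : M}

lemma mvfderiv_congr {f g : M → ℝ} (h : f =ᶠ[𝓝 x] g) (v : Tan n x) :
    mvfderiv (𝓡 n) f x v = mvfderiv (𝓡 n) g x v := by
  unfold mvfderiv
  rw [h.mfderiv_eq]
  rfl

lemma mdifferentiableAt_finsetSum {ι : Type} {t : Finset ι} {f : ι → M → ℝ}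
    (hf : ∀ k ∈ t, MDifferentiableAt (𝓡 n) 𝓘(ℝ) (f k) x) :
    MDifferentiableAt (𝓡 n) 𝓘(ℝ) (fun y => ∑ k ∈ t, f k y) x := by
  have h : MDifferentiableAt (𝓡 n) 𝓘(ℝ) (∑ k ∈ t, f k) x := MDifferentiableAt.sum hf
  rwa [Finset.sum_fn] at h

variable [IsManifold (𝓡 n) ∞ M]

lemma contMDiffAt_coord (hx : x ∈ dom n c) (k : Fin n) :
    ContMDiffAt (𝓡 n) 𝓘(ℝ) ∞ (fun y => extChartAt (𝓡 n) c y k) x :=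
  contMDiffWithinAt_euclidean_iff.1 (contMDiffAt_extChartAt_of_mem_dom hx) k

lemma coordComp_eq_mvfderiv_coord (hx : x ∈ dom n c) (v : Tan n x) (k : Fin n) :
    coordComp n c v k = mvfderiv (𝓡 n) (fun y => extChartAt (𝓡 n) c y k) x v := by
  rw [coordComp_eq_mfderiv hx]
  have h := mvfderiv_comp_apply x
    (g := (EuclideanSpace.proj k : Model n →L[ℝ] ℝ))
    (EuclideanSpace.proj k : Model n →L[ℝ] ℝ).differentiableAt.mdifferentiableAt
    ((contMDiffAt_extChartAt_of_mem_dom hx).mdifferentiableAt (by simp)) v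
  refine Eq.trans ?_ h.symm
  unfold mvfderiv
  rw [mfderiv_eq_fderiv, ContinuousLinearMap.fderiv]
  rfl

/-- The default value zero off the chart domain keeps components linear everywhere; the extension of
vector fields is thereby linear without restriction on the point. -/
lemma coordComp_smul' (c : M) (a : ℝ) (v : Tan n x) (k : Fin n) :
    coordComp n c (a • v) k = a * coordComp n c v k := by
  by_cases hx : x ∈ dom n c
  · exact coordComp_smul hx a v k
  · simp only [coordComp, dif_neg hx, mul_zero]

lemma coordComp_add' (c : M) (v w : Tan n x) (k : Fin n) :
    coordComp n c (v + w) k = coordComp n c v k + coordComp n c w k := by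
  by_cases hx : x ∈ dom n c
  · exact coordComp_add hx v w k
  · simp only [coordComp, dif_neg hx, add_zero]

end coordinates

/-- Coordinate form of `ds(∇_w Y) = w(ds(Y)) - (∇ds)(w, Y)`: here `s` is `ds`, `H` its second
partials, `G` the Christoffel symbols and `dY` the partials of `Y`. The first term is zero by `hd`.
The second is zero because the Hessian is `γ` times `ds`, symmetrized, and `ds` kills `w` and `Y`.
-/
lemma sum_hessian_eq_zero {ι : Type*} [Fintype ι] {w y s γ : ι → ℝ} {dY H : ι → ι → ℝ}
    {G : ι → ι → ι → ℝ} (hγ : ∀ a b, H a b - ∑ k, G k a b * s k = γ a * s b + γ b * s a)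
    (hw : ∑ a, w a * s a = 0) (hy : ∑ k, y k * s k = 0)
    (hd : ∑ a, w a * ∑ k, (y k * H a k + s k * dY a k) = 0) :
    ∑ k, s k * (∑ a, w a * dY a k + ∑ a, ∑ b, G k a b * w a * y b) = 0 := by
  have h1 : ∑ a, ∑ b, w a * y b * (γ a * s b + γ b * s a) = 0 := by
    have e1 : ∑ a, ∑ b, w a * y b * (γ a * s b + γ b * s a) =
        (∑ a, w a * γ a) * (∑ b, y b * s b) + (∑ b, y b * γ b) * ∑ a, w a * s a := by
      rw [Finset.sum_mul_sum, mul_comm (∑ b, y b * γ b), Finset.sum_mul_sum,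
        ← Finset.sum_add_distrib]
      refine Finset.sum_congr rfl fun a _ => ?_
      rw [← Finset.sum_add_distrib]
      exact Finset.sum_congr rfl fun b _ => by ring
    rw [e1, hw, hy, mul_zero, mul_zero, add_zero]
  have h2 : ∑ a, ∑ b, w a * y b * ∑ k, G k a b * s k =
      ∑ k, s k * ∑ a, ∑ b, G k a b * w a * y b := by
    simp only [Finset.mul_sum]
    rw [Finset.sum_congr rfl fun a _ => Finset.sum_comm, Finset.sum_comm]
    exact Finset.sum_congr rfl fun k _ => Finset.sum_congr rfl fun a _ =>
      Finset.sum_congr rfl fun b _ => by ring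
  have h3 : ∑ a, w a * ∑ k, (y k * H a k + s k * dY a k) =
      ∑ a, ∑ b, w a * y b * H a b + ∑ k, s k * ∑ a, w a * dY a k := by
    simp only [Finset.mul_sum]
    rw [Finset.sum_comm (γ := ι) (f := fun k a => s k * (w a * dY a k)),
      ← Finset.sum_add_distrib]
    refine Finset.sum_congr rfl fun a _ => ?_
    rw [← Finset.sum_add_distrib]
    exact Finset.sum_congr rfl fun b _ => by ring
  have h4 : ∀ a b, H a b = (∑ k, G k a b * s k) + (γ a * s b + γ b * s a) := fun a b => by
    rw [← hγ]; ring
  rw [h3] at hd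
  simp only [mul_add, Finset.sum_add_distrib] at h1 ⊢
  simp only [h4, mul_add, Finset.sum_add_distrib] at hd
  linarith

/-! ### Hypersurfaces in adapted coordinates. -/

section hypersurface

variable {m : ℕ} {M : Type*} [TopologicalSpace M] [ChartedSpace (Model (m + 1)) M]
  [IsManifold (𝓡 (m + 1)) ∞ M]
  {N : Type*} [TopologicalSpace N] [ChartedSpace (Model m) N] [IsManifold (𝓡 m) ∞ N]

/-- The hypersurface `i : N → M` has around each point `z` coordinates that are obtained from
those of `M` around `i z` by omission of the coordinate with index `j z`. -/
structure IsAdapted (i : N → M) (j : N → Fin (m + 1)) : Prop where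
  smooth : ContMDiff (𝓡 m) (𝓡 (m + 1)) ∞ i
  mem_dom : ∀ z, ∀ y ∈ dom m z, i y ∈ dom (m + 1) (i z)
  chart_eq : ∀ z, ∀ y ∈ dom m z,
    extChartAt (𝓡 m) z y = dropCoord (j z) (extChartAt (𝓡 (m + 1)) (i z) (i y))

variable {i : N → M} {j : N → Fin (m + 1)} {c : M} {z y : N}

omit [IsManifold (𝓡 (m + 1)) ∞ M] [IsManifold (𝓡 m) ∞ N] in
lemma mvfderiv_comp_emb (hi : ContMDiff (𝓡 m) (𝓡 (m + 1)) ∞ i) {f : M → ℝ}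
    (hf : MDifferentiableAt (𝓡 (m + 1)) 𝓘(ℝ) f (i y)) (u : Tan m y) :
    mvfderiv (𝓡 m) (fun y => f (i y)) y u =
      mvfderiv (𝓡 (m + 1)) f (i y) (mfderiv (𝓡 m) (𝓡 (m + 1)) i y u) :=
  mvfderiv_comp_apply y hf (hi.mdifferentiable (by simp) y) u

omit [IsManifold (𝓡 m) ∞ N] in
lemma coordComp_emb (hi : ContMDiff (𝓡 m) (𝓡 (m + 1)) ∞ i) (hy : i y ∈ dom (m + 1) c)
    (u : Tan m y) (k : Fin (m + 1)) :
    coordComp (m + 1) c (mfderiv (𝓡 m) (𝓡 (m + 1)) i y u) k =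
      mvfderiv (𝓡 m) (fun y => extChartAt (𝓡 (m + 1)) c (i y) k) y u := by
  rw [coordComp_eq_mvfderiv_coord hy, mvfderiv_comp_emb hi
    (f := fun x => extChartAt (𝓡 (m + 1)) c x k)
    ((contMDiffAt_coord hy k).mdifferentiableAt (by simp))]

omit [IsManifold (𝓡 m) ∞ N] in
lemma contMDiffAt_coord_emb (hi : ContMDiff (𝓡 m) (𝓡 (m + 1)) ∞ i) (hy : i y ∈ dom (m + 1) c)
    (k : Fin (m + 1)) :
    ContMDiffAt (𝓡 m) 𝓘(ℝ) ∞ (fun y => extChartAt (𝓡 (m + 1)) c (i y) k) y :=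
  (contMDiffAt_coord hy k).comp y (hi y)

lemma coordComp_emb_coordField (hi : ContMDiff (𝓡 m) (𝓡 (m + 1)) ∞ i)
    (hy : i y ∈ dom (m + 1) c) (hyz : y ∈ dom m z) (l : Fin m) (k : Fin (m + 1)) :
    coordComp (m + 1) c (mfderiv (𝓡 m) (𝓡 (m + 1)) i y (coordField m z l y)) k =
      pd m z l (fun y => extChartAt (𝓡 (m + 1)) c (i y) k) y := by
  rw [coordComp_emb hi hy, pd_eq_mvfderiv hyz
    ((contMDiffAt_coord_emb hi hy k).mdifferentiableAt (by simp))]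

lemma coordComp_emb_eq_sum (hi : ContMDiff (𝓡 m) (𝓡 (m + 1)) ∞ i)
    (hy : i y ∈ dom (m + 1) c) (hyz : y ∈ dom m z) (u : Tan m y) (k : Fin (m + 1)) :
    coordComp (m + 1) c (mfderiv (𝓡 m) (𝓡 (m + 1)) i y u) k = ∑ l, coordComp m z u l *
      pd m z l (fun y => extChartAt (𝓡 (m + 1)) c (i y) k) y := by
  rw [coordComp_emb hi hy, mvfderiv_eq_sum hyz
    ((contMDiffAt_coord_emb hi hy k).mdifferentiableAt (by simp))]

lemma coordComp_emb_eventuallyEq (hi : ContMDiff (𝓡 m) (𝓡 (m + 1)) ∞ i)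
    (hy : i y ∈ dom (m + 1) c) (hyz : y ∈ dom m z) (Z : VField m N) (k : Fin (m + 1)) :
    (fun y => coordComp (m + 1) c (mfderiv (𝓡 m) (𝓡 (m + 1)) i y (Z y)) k) =ᶠ[𝓝 y]
      fun y => ∑ l, coordComp m z (Z y) l *
        pd m z l (fun y => extChartAt (𝓡 (m + 1)) c (i y) k) y := by
  filter_upwards [hi.continuous.continuousAt.preimage_mem_nhds (dom_mem_nhds hy),
    dom_mem_nhds hyz] with y' h1 h2
  exact coordComp_emb_eq_sum hi h1 h2 _ _

lemma mdifferentiableAt_coordComp_emb (hi : ContMDiff (𝓡 m) (𝓡 (m + 1)) ∞ i)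
    (hy : i y ∈ dom (m + 1) c) {Z : VField m N}
    (hZ : MDifferentiableAt (𝓡 m) (𝓡 m).tangent (toTotal m Z) y) (k : Fin (m + 1)) :
    MDifferentiableAt (𝓡 m) 𝓘(ℝ)
      (fun y => coordComp (m + 1) c (mfderiv (𝓡 m) (𝓡 (m + 1)) i y (Z y)) k) y := by
  have hyy := mem_dom_self (n := m) y
  refine MDifferentiableAt.congr_of_eventuallyEq ?_ (coordComp_emb_eventuallyEq hi hy hyy Z k)
  exact mdifferentiableAt_finsetSum fun l _ => ((mdifferentiableAt_iff_coordComp hyy Z).1 hZ l).mul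
    ((contMDiffAt_pd hyy (contMDiffAt_coord_emb hi hy k) l).mdifferentiableAt (by simp))

namespace IsAdapted

lemma coordComp_eq (h : IsAdapted i j) (hy : y ∈ dom m z) (u : Tan m y) (k : Fin m) :
    coordComp m z u k = coordComp (m + 1) (i z) (mfderiv (𝓡 m) (𝓡 (m + 1)) i y u)
      ((j z).succAbove k) := by
  rw [coordComp_emb h.smooth (h.mem_dom z y hy), coordComp_eq_mvfderiv_coord hy]
  refine mvfderiv_congr ?_ u
  filter_upwards [dom_mem_nhds hy] with y' hy'
  rw [h.chart_eq z y' hy', dropCoord_apply]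

lemma mfderiv_injective (h : IsAdapted i j) (z : N) :
    Function.Injective (mfderiv (𝓡 m) (𝓡 (m + 1)) i z) := by
  intro u v huv
  have hz := mem_dom_self (n := m) z
  exact eq_of_coordComp_eq hz fun k => by rw [h.coordComp_eq hz, h.coordComp_eq hz, huv]

/-- A tangent vector of `M` that is annihilated by the derivative of a defining function is tangent
to the hypersurface. -/
lemma mem_range_mfderiv (h : IsAdapted i j) {s : M → ℝ}
    (hs : ContMDiffAt (𝓡 (m + 1)) 𝓘(ℝ) ∞ s (i z)) (hj : pd (m + 1) (i z) (j z) s (i z) ≠ 0)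
    (h0 : ∀ᶠ y in 𝓝 z, s (i y) = 0) {w : Tan (m + 1) (i z)}
    (hw : mvfderiv (𝓡 (m + 1)) s (i z) w = 0) :
    w ∈ range (mfderiv (𝓡 m) (𝓡 (m + 1)) i z) := by
  have hz := mem_dom_self (n := m) z
  have hiz := mem_dom_self (n := m + 1) (i z)
  have hsd := hs.mdifferentiableAt (n := ∞) (by simp)
  -- The only candidate: adapted coordinates prescribe all components except the omitted one. The
  -- difference of its image and `w` then lies along `∂_j`, and `∂_j s ≠ 0` forces it to vanish.
  set u : Tan m z := ∑ l, coordComp (m + 1) (i z) w ((j z).succAbove l) • coordField m z l z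
    with hu
  have hul : ∀ l, coordComp m z u l = coordComp (m + 1) (i z) w ((j z).succAbove l) := by
    intro l
    rw [hu, coordComp_sum hz]
    simp [coordComp_smul hz, coordComp_coordField hz]
  refine ⟨u, ?_⟩
  set v := mfderiv (𝓡 m) (𝓡 (m + 1)) i z u with hv
  have hv0 : mvfderiv (𝓡 (m + 1)) s (i z) v = 0 := by
    rw [hv, ← mvfderiv_comp_emb h.smooth hsd, mvfderiv_congr (g := fun _ => (0 : ℝ)) h0]
    unfold mvfderiv
    rw [mfderiv_const]
    rfl
  have hvl : ∀ l, coordComp (m + 1) (i z) (v - w) ((j z).succAbove l) = 0 := fun l => by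
    rw [coordComp_sub hiz, hv, ← h.coordComp_eq hz, hul, sub_self]
  have hd : mvfderiv (𝓡 (m + 1)) s (i z) (v - w) = 0 := by rw [map_sub, hv0, hw, sub_zero]
  rw [mvfderiv_eq_sum hiz hsd, Fin.sum_univ_succAbove _ (j z)] at hd
  simp only [hvl, zero_mul, Finset.sum_const_zero, add_zero, mul_eq_zero, or_iff_left hj] at hd
  rw [← sub_eq_zero]
  refine eq_of_coordComp_eq hiz fun k => ?_
  rw [coordComp_zero hiz]
  exact Fin.succAboveCases (j z) hd hvl k

/-- A hypersurface with a defining function `s` whose Hessian is a multiple of `ds` along it is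
totally geodesic. -/
theorem isTotallyGeodesic (h : IsAdapted i j) (D : Conn (m + 1) M)
    (hH : ∀ z, ∃ (s : M → ℝ) (γ : Fin (m + 1) → ℝ),
      ContMDiffAt (𝓡 (m + 1)) 𝓘(ℝ) ∞ s (i z) ∧ pd (m + 1) (i z) (j z) s (i z) ≠ 0 ∧
      (∀ᶠ y in 𝓝 z, s (i y) = 0) ∧
      ∀ a b, pd (m + 1) (i z) a (pd (m + 1) (i z) b s) (i z)
        - ∑ k, christoffel (m + 1) D.toFun (i z) k a b (i z) * pd (m + 1) (i z) k s (i z) =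
        γ a * pd (m + 1) (i z) b s (i z) + γ b * pd (m + 1) (i z) a s (i z)) :
    IsTotallyGeodesic (n := m + 1) (m := m) i D.toFun := by
  intro z Y hY hYt v
  obtain ⟨s, γ, hs, hj, h0, hγ⟩ := hH z
  have hiz := mem_dom_self (n := m + 1) (i z)
  have hsd := hs.mdifferentiableAt (n := ∞) (by simp)
  have hYk := (mdifferentiableAt_iff_coordComp hiz Y).1 hY
  have hpd := fun k => (contMDiffAt_pd hiz hs k).mdifferentiableAt (n := ∞) (by simp)
  -- Smoothness at a point spreads to a neighbourhood only for a finite order; order one suffices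
  -- here.
  have hs' : ∀ᶠ y in 𝓝 z, ContMDiffAt (𝓡 (m + 1)) 𝓘(ℝ) 1 s (i y) :=
    h.smooth.continuous.continuousAt.eventually
      ((contMDiffAt_iff_contMDiffAt_nhds (n := 1) (by simp)).1 (hs.of_le (by simp)))
  have htan : ∀ᶠ y in 𝓝 z, ∀ u : Tan m y,
      mvfderiv (𝓡 (m + 1)) s (i y) (mfderiv (𝓡 m) (𝓡 (m + 1)) i y u) = 0 := by
    filter_upwards [hs', h0.eventually_nhds] with y h1 h2 u
    rw [← mvfderiv_comp_emb h.smooth (h1.mdifferentiableAt (by simp)),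
      mvfderiv_congr (g := fun _ => (0 : ℝ)) h2]
    unfold mvfderiv
    rw [mfderiv_const]
    rfl
  -- the derivative of `ds(Y) = 0` along the hypersurface
  have hsum0 : ∀ᶠ y in 𝓝 z,
      ∑ k, coordComp (m + 1) (i z) (Y (i y)) k * pd (m + 1) (i z) k s (i y) = 0 := by
    filter_upwards [hs', htan, hYt, h.smooth.continuous.continuousAt.preimage_mem_nhds
      (dom_mem_nhds hiz)] with y h1 h2 h3 h4
    obtain ⟨u, hu⟩ := h3
    rw [← mvfderiv_eq_sum h4 (h1.mdifferentiableAt (by simp)), ← hu, h2]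
  set w := mfderiv (𝓡 m) (𝓡 (m + 1)) i z v with hw
  have hterm : ∀ k, MDifferentiableAt (𝓡 (m + 1)) 𝓘(ℝ)
      (fun x => coordComp (m + 1) (i z) (Y x) k * pd (m + 1) (i z) k s x) (i z) := fun k =>
    (hYk k).mul (hpd k)
  have hder : ∑ a, coordComp (m + 1) (i z) w a * ∑ k,
      (coordComp (m + 1) (i z) (Y (i z)) k * pd (m + 1) (i z) a (pd (m + 1) (i z) k s) (i z)
        + pd (m + 1) (i z) k s (i z)
          * pd (m + 1) (i z) a (fun x => coordComp (m + 1) (i z) (Y x) k) (i z)) = 0 := by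
    have h1 := mvfderiv_comp_emb h.smooth (f := fun x =>
      ∑ k, coordComp (m + 1) (i z) (Y x) k * pd (m + 1) (i z) k s x)
      (mdifferentiableAt_finsetSum fun k _ => hterm k) v
    rw [mvfderiv_congr (g := fun _ => (0 : ℝ)) hsum0, mvfderiv_eq_sum hiz
      (mdifferentiableAt_finsetSum fun k _ => hterm k)] at h1
    have h2 : mvfderiv (𝓡 m) (fun _ : N => (0 : ℝ)) z v = 0 := by
      unfold mvfderiv
      rw [mfderiv_const]
      rfl
    rw [h2] at h1
    rw [h1]
    refine Finset.sum_congr rfl fun a _ => ?_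
    rw [pd_sum hiz _ fun k _ => hterm k]
    congr 1
    exact Finset.sum_congr rfl fun k _ => (pd_mul hiz (hYk k) (hpd k) a).symm
  refine h.mem_range_mfderiv hs hj h0 ?_
  have hwt : ∑ a, coordComp (m + 1) (i z) w a * pd (m + 1) (i z) a s (i z) = 0 := by
    rw [← mvfderiv_eq_sum hiz hsd, hw, htan.self_of_nhds]
  have hYt0 := hsum0.self_of_nhds
  rw [mvfderiv_eq_sum hiz hsd]
  simp only [coordComp_cov D.isCovariantDerivativeOnUniv univ_mem hiz hY,
    mvfderiv_eq_sum hiz (hYk _)]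
  have key := sum_hessian_eq_zero hγ hwt hYt0 hder
  rw [← key]
  exact Finset.sum_congr rfl fun k _ => mul_comm _ _

end IsAdapted

end hypersurface

section restriction

variable {m : ℕ} {M : Type*} [TopologicalSpace M] [ChartedSpace (Model (m + 1)) M]
  [IsManifold (𝓡 (m + 1)) ∞ M]
  {N : Type*} [TopologicalSpace N] [ChartedSpace (Model m) N] [IsManifold (𝓡 m) ∞ N]

/-! ### Extension of vector fields and restriction of connections -/

/-- The retraction of a neighbourhood of `i z` to the hypersurface `i : N → M` along the omitted
coordinate. -/
def retraction (i : N → M) (j : N → Fin (m + 1)) (z : N) (x : M) : N :=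
  (extChartAt (𝓡 m) z).symm (dropCoord (j z) (extChartAt (𝓡 (m + 1)) (i z) x))

/-- The extension of a vector field on the hypersurface to a neighbourhood of `i z` in `M`. -/
def extendField (i : N → M) (j : N → Fin (m + 1)) (z : N) (Z : VField m N) : VField (m + 1) M :=
  fun x => ∑ k, coordComp (m + 1) (i z) (mfderiv (𝓡 m) (𝓡 (m + 1)) i (retraction i j z x)
    (Z (retraction i j z x))) k • coordField (m + 1) (i z) k x

/-- The projection to the tangent space of the hypersurface along the omitted coordinate field. -/
def tangentProj (i : N → M) (j : N → Fin (m + 1)) (z : N) : Tan (m + 1) (i z) →L[ℝ] Tan m z :=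
  ∑ k, ((EuclideanSpace.proj ((j z).succAbove k) : Model (m + 1) →L[ℝ] ℝ).comp
    (mvfderiv (𝓡 (m + 1)) (extChartAt (𝓡 (m + 1)) (i z)) (i z))).smulRight (coordField m z k z)

/-- The restriction of a connection to the hypersurface. -/
def restrictConn (i : N → M) (j : N → Fin (m + 1)) (D : RawConn (m + 1) M) : RawConn m N :=
  fun Z z => (tangentProj i j z).comp
    ((D (extendField i j z Z) (i z)).comp (mfderiv (𝓡 m) (𝓡 (m + 1)) i z))

variable {i : N → M} {j : N → Fin (m + 1)} {c : M} {z y : N}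

omit [IsManifold (𝓡 m) ∞ N] in
/-- The covariant derivative along a submanifold depends only on the values along it. -/
lemma coordComp_cov_emb (hi : ContMDiff (𝓡 m) (𝓡 (m + 1)) ∞ i) (D : Conn (m + 1) M)
    (hy : i y ∈ dom (m + 1) c) {Y : VField (m + 1) M}
    (hY : MDifferentiableAt (𝓡 (m + 1)) (𝓡 (m + 1)).tangent (toTotal (m + 1) Y) (i y))
    (v : Tan m y) (k : Fin (m + 1)) :
    coordComp (m + 1) c (D.toFun Y (i y) (mfderiv (𝓡 m) (𝓡 (m + 1)) i y v)) k =
      mvfderiv (𝓡 m) (fun y => coordComp (m + 1) c (Y (i y)) k) y v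
        + ∑ a, ∑ b, christoffel (m + 1) D.toFun c k a b (i y)
          * coordComp (m + 1) c (mfderiv (𝓡 m) (𝓡 (m + 1)) i y v) a
          * coordComp (m + 1) c (Y (i y)) b := by
  rw [coordComp_cov D.isCovariantDerivativeOnUniv univ_mem hy hY,
    mvfderiv_comp_emb hi (f := fun x => coordComp (m + 1) c (Y x) k)
      ((mdifferentiableAt_iff_coordComp hy Y).1 hY k)]

omit [IsManifold (𝓡 m) ∞ N] in
lemma cov_emb_congr (hi : ContMDiff (𝓡 m) (𝓡 (m + 1)) ∞ i) (D : Conn (m + 1) M)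
    {Y Y' : VField (m + 1) M}
    (hY : MDifferentiableAt (𝓡 (m + 1)) (𝓡 (m + 1)).tangent (toTotal (m + 1) Y) (i y))
    (hY' : MDifferentiableAt (𝓡 (m + 1)) (𝓡 (m + 1)).tangent (toTotal (m + 1) Y') (i y))
    (h : ∀ᶠ y' in 𝓝 y, Y (i y') = Y' (i y')) (v : Tan m y) :
    D.toFun Y (i y) (mfderiv (𝓡 m) (𝓡 (m + 1)) i y v) =
      D.toFun Y' (i y) (mfderiv (𝓡 m) (𝓡 (m + 1)) i y v) := by
  have hy := mem_dom_self (n := m + 1) (i y)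
  refine eq_of_coordComp_eq hy fun k => ?_
  rw [coordComp_cov_emb hi D hy hY, coordComp_cov_emb hi D hy hY', h.self_of_nhds]
  congr 1
  refine mvfderiv_congr ?_ v
  filter_upwards [h] with y' hy'
  rw [hy']

namespace IsAdapted

lemma retraction_emb (h : IsAdapted i j) (hy : y ∈ dom m z) : retraction i j z (i y) = y := by
  rw [retraction, ← h.chart_eq z y hy, extChartAt_symm_apply hy]

lemma contMDiffAt_retraction (h : IsAdapted i j) (hy : y ∈ dom m z) :
    ContMDiffAt (𝓡 (m + 1)) (𝓡 m) ∞ (retraction i j z) (i y) := by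
  have h1 : ContMDiffAt (𝓡 (m + 1)) 𝓘(ℝ, Model m) ∞
      (fun x => dropCoord (j z) (extChartAt (𝓡 (m + 1)) (i z) x)) (i y) :=
    (dropCoord (j z)).contDiff.contMDiff.contMDiffAt.comp _
      (contMDiffAt_extChartAt_of_mem_dom (h.mem_dom z y hy))
  have h2 := contMDiffAt_extChartAt_symm hy
  rw [h.chart_eq z y hy] at h2
  exact h2.comp (i y) h1

lemma extendField_emb (h : IsAdapted i j) (hy : y ∈ dom m z) (Z : VField m N) :
    extendField i j z Z (i y) = mfderiv (𝓡 m) (𝓡 (m + 1)) i y (Z y) := by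
  -- The base point `retraction i j z (i y)` occurs in the type of the tangent vector, so it is
  -- generalized before it is replaced by `y`.
  have h1 : ∀ y', y' = y → ∑ k, coordComp (m + 1) (i z) (mfderiv (𝓡 m) (𝓡 (m + 1)) i y'
      (Z y')) k • coordField (m + 1) (i z) k (i y) = mfderiv (𝓡 m) (𝓡 (m + 1)) i y (Z y) := by
    rintro _ rfl
    exact sum_coordComp_smul (h.mem_dom z _ hy) _
  exact h1 _ (h.retraction_emb hy)

omit [IsManifold (𝓡 m) ∞ N] in
lemma coordComp_extendField (z : N) (Z : VField m N) {x : M} (hx : x ∈ dom (m + 1) (i z))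
    (k : Fin (m + 1)) : coordComp (m + 1) (i z) (extendField i j z Z x) k =
      coordComp (m + 1) (i z) (mfderiv (𝓡 m) (𝓡 (m + 1)) i (retraction i j z x)
        (Z (retraction i j z x))) k := by
  rw [extendField, coordComp_sum hx]
  simp [coordComp_smul hx, coordComp_coordField hx]

lemma mdifferentiableAt_extendField (h : IsAdapted i j) (hy : y ∈ dom m z) {Z : VField m N}
    (hZ : MDifferentiableAt (𝓡 m) (𝓡 m).tangent (toTotal m Z) y) :
    MDifferentiableAt (𝓡 (m + 1)) (𝓡 (m + 1)).tangent
      (toTotal (m + 1) (extendField i j z Z)) (i y) := by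
  have hiy := h.mem_dom z y hy
  refine (mdifferentiableAt_iff_coordComp hiy _).2 fun k => ?_
  have h1 := mdifferentiableAt_coordComp_emb h.smooth hiy hZ k
  rw [← h.retraction_emb hy] at h1
  have h2 := h1.comp (i y) ((h.contMDiffAt_retraction hy).mdifferentiableAt (by simp))
  refine h2.congr_of_eventuallyEq ?_
  filter_upwards [dom_mem_nhds hiy] with x hx
  exact coordComp_extendField z Z hx k

omit [IsManifold (𝓡 m) ∞ N] in
lemma extendField_add (z : N) (Z Z' : VField m N) :
    extendField i j z (Z + Z') = extendField i j z Z + extendField i j z Z' := by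
  funext x
  simp only [extendField, Pi.add_apply, map_add, coordComp_add', add_smul, Finset.sum_add_distrib]

omit [IsManifold (𝓡 m) ∞ N] in
lemma extendField_smul (z : N) (g : N → ℝ) (Z : VField m N) :
    extendField i j z (g • Z) = (g ∘ retraction i j z) • extendField i j z Z := by
  funext x
  simp only [extendField, Pi.smul_apply', map_smul, coordComp_smul', Function.comp_apply,
    Finset.smul_sum, mul_smul]

lemma tangentProj_mfderiv (h : IsAdapted i j) (u : Tan m z) :
    tangentProj i j z (mfderiv (𝓡 m) (𝓡 (m + 1)) i z u) = u := by
  have hz := mem_dom_self (n := m) z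
  have hiz := mem_dom_self (n := m + 1) (i z)
  conv_rhs => rw [← sum_coordComp_smul hz u]
  rw [tangentProj, _root_.sum_apply]
  refine Finset.sum_congr rfl fun k _ => ?_
  rw [h.coordComp_eq hz, coordComp_eq_mfderiv hiz]
  rfl

/-- The retraction composed with `i` is the identity near `z`. This supplies the derivative term of
the Leibniz rule for the restricted connection. -/
lemma mfderiv_retraction (h : IsAdapted i j) (u : Tan m z) {g : N → ℝ}
    (hg : MDifferentiableAt (𝓡 m) 𝓘(ℝ) g z) :
    MDifferentiableAt (𝓡 (m + 1)) 𝓘(ℝ) (g ∘ retraction i j z) (i z) ∧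
    mvfderiv (𝓡 (m + 1)) (g ∘ retraction i j z) (i z) (mfderiv (𝓡 m) (𝓡 (m + 1)) i z u) =
      mvfderiv (𝓡 m) g z u := by
  have hz := mem_dom_self (n := m) z
  have hg' := hg
  rw [← h.retraction_emb hz] at hg'
  have h1 : MDifferentiableAt (𝓡 (m + 1)) 𝓘(ℝ) (g ∘ retraction i j z) (i z) :=
    hg'.comp (i z) ((h.contMDiffAt_retraction hz).mdifferentiableAt (by simp))
  refine ⟨h1, ?_⟩
  rw [← mvfderiv_comp_emb h.smooth h1]
  refine mvfderiv_congr ?_ u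
  filter_upwards [dom_mem_nhds hz] with y hy
  rw [Function.comp_apply, h.retraction_emb hy]

/-- Total geodesy plays no role yet: a connection followed by a projection to the tangent spaces of
the hypersurface is always a connection. -/
theorem isCovariantDerivativeOn_restrictConn (h : IsAdapted i j) (D : Conn (m + 1) M) :
    IsCovariantDerivativeOn (Model m) (restrictConn i j D.toFun) univ where
  add {Z Z' z} hZ hZ' _ := by
    have hz := mem_dom_self (n := m) z
    simp only [restrictConn, extendField_add]
    rw [D.isCovariantDerivativeOnUniv.add (h.mdifferentiableAt_extendField hz hZ)
      (h.mdifferentiableAt_extendField hz hZ'), ContinuousLinearMap.add_comp,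
      ContinuousLinearMap.comp_add]
  leibniz {Z g z} hZ hg _ := by
    have hz := mem_dom_self (n := m) z
    ext1 v
    simp only [restrictConn, extendField_smul]
    rw [D.isCovariantDerivativeOnUniv.leibniz (h.mdifferentiableAt_extendField hz hZ)
      (h.mfderiv_retraction v hg).1]
    simp only [ContinuousLinearMap.comp_apply, _root_.add_apply, _root_.smul_apply,
      ContinuousLinearMap.smulRight_apply, map_add, map_smul]
    have h1 := (h.mfderiv_retraction v hg).2
    rw [h1, h.extendField_emb hz, h.tangentProj_mfderiv, Function.comp_apply, h.retraction_emb hz]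

/-- The restriction of a connection to a totally geodesic hypersurface, as a covariant
derivative. -/
def restriction (h : IsAdapted i j) (D : Conn (m + 1) M) : Conn m N :=
  ⟨restrictConn i j D.toFun, h.isCovariantDerivativeOn_restrictConn D⟩

/-- Total geodesy puts the derivative of the extended field in the image of `di`, where
`tangentProj` inverts `di`. Any other extension has the same tangential derivatives. -/
theorem isRestriction (h : IsAdapted i j) {D : Conn (m + 1) M}
    (hD : IsTotallyGeodesic (n := m + 1) (m := m) i D.toFun) :
    IsRestriction (n := m + 1) (m := m) i D.toFun (h.restriction D).toFun := by
  intro z Y Z hY hZ hYZ v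
  have hz := mem_dom_self (n := m) z
  have hE := h.mdifferentiableAt_extendField hz hZ
  have h1 : ∀ᶠ y in 𝓝 z, extendField i j z Z (i y) = mfderiv (𝓡 m) (𝓡 (m + 1)) i y (Z y) := by
    filter_upwards [dom_mem_nhds hz] with y hy using h.extendField_emb hy Z
  obtain ⟨u, hu⟩ := hD z _ hE (h1.mono fun y hy => ⟨_, hy.symm⟩) v
  have h2 : (h.restriction D).toFun Z z v = u := by
    have h3 := congrArg (tangentProj i j z) hu
    rw [h.tangentProj_mfderiv] at h3
    exact h3.symm
  rw [h2, hu]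
  refine cov_emb_congr h.smooth D hY hE ?_ v
  filter_upwards [h1, hYZ] with y h3 h4
  rw [h3, h4]

/-- The Gauss formula in adapted coordinates. -/
theorem christoffel_restriction (h : IsAdapted i j) {D : Conn (m + 1) M}
    (hD : IsTotallyGeodesic (n := m + 1) (m := m) i D.toFun) (hy : y ∈ dom m z) (k a l : Fin m) :
    christoffel m (h.restriction D).toFun z k a l y =
      pd m z a (pd m z l fun y => extChartAt (𝓡 (m + 1)) (i z) (i y) ((j z).succAbove k)) y
        + ∑ p, ∑ q, christoffel (m + 1) D.toFun (i z) ((j z).succAbove k) p q (i y)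
          * pd m z a (fun y => extChartAt (𝓡 (m + 1)) (i z) (i y) p) y
          * pd m z l (fun y => extChartAt (𝓡 (m + 1)) (i z) (i y) q) y := by
  have hiy := h.mem_dom z y hy
  have hl := mdifferentiableAt_coordField hy l
  have hE := h.mdifferentiableAt_extendField hy hl
  have h1 : ∀ᶠ y' in 𝓝 y, extendField i j z (coordField m z l) (i y') =
      mfderiv (𝓡 m) (𝓡 (m + 1)) i y' (coordField m z l y') := by
    filter_upwards [dom_mem_nhds hy] with y' hy' using h.extendField_emb hy' _
  rw [christoffel, h.coordComp_eq hy, ← h.isRestriction hD y _ _ hE hl h1,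
    coordComp_cov_emb h.smooth D hiy hE, h1.self_of_nhds]
  simp only [coordComp_emb_coordField h.smooth hiy hy]
  congr 1
  rw [pd_eq_mvfderiv hy ((contMDiffAt_pd hy (contMDiffAt_coord_emb h.smooth hiy _)
    l).mdifferentiableAt (by simp))]
  refine mvfderiv_congr ?_ _
  filter_upwards [h1, dom_mem_nhds hy] with y' h2 h3
  rw [h2, coordComp_emb_coordField h.smooth (h.mem_dom z y' h3) h3]

end IsAdapted

/-! ### Torsion from Christoffel symbols. -/

section torsion

variable {n : ℕ} {N : Type*} [TopologicalSpace N] [ChartedSpace (Model n) N]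
  [IsManifold (𝓡 n) ∞ N]

/-- Torsion is tensorial and coordinate fields commute, so symmetry at the centre of each chart
suffices. -/
lemma torsion_eq_zero_of_christoffel_symm {D : Conn n N}
    (h : ∀ z : N, ∀ k a b, christoffel n D.toFun z k a b z = christoffel n D.toFun z k b a z) :
    D.torsion = 0 := by
  funext z
  have hz := mem_dom_self (n := n) z
  have hab : ∀ a b, D.torsion z (coordField n z a z) (coordField n z b z) = 0 := by
    intro a b
    rw [D.torsion_apply (mdifferentiableAt_coordField hz a) (mdifferentiableAt_coordField hz b),
      mlieBracket_coordField hz, sub_zero, sub_eq_zero]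
    exact eq_of_coordComp_eq hz fun k => h z k a b
  ext1 u
  ext1 v
  rw [← sum_coordComp_smul hz u, ← sum_coordComp_smul hz v]
  simp [hab]

end torsion

namespace IsAdapted

/-- Both properties are read off the Gauss formula: its terms are smooth, and it is symmetric
because second partials commute and the ambient symbols are symmetric. -/
theorem isAffine_restriction [T2Space M] (h : IsAdapted i j) {D : Conn (m + 1) M}
    (hD : IsTotallyGeodesic (n := m + 1) (m := m) i D.toFun) (hA : IsAffine (m + 1) D) :
    IsAffine m (h.restriction D) := by
  constructor
  · refine ⟨contMDiffCovariantDerivativeOn_of_christoffel isOpen_univ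
      (h.restriction D).isCovariantDerivativeOnUniv fun z _ k a l => ?_⟩
    have hz := mem_dom_self (n := m) z
    have hiz := mem_dom_self (n := m + 1) (i z)
    have hc := fun p => contMDiffAt_coord_emb h.smooth hiz p
    have h1 : ContMDiffAt (𝓡 m) 𝓘(ℝ) ∞ (fun y =>
        pd m z a (pd m z l fun y => extChartAt (𝓡 (m + 1)) (i z) (i y) ((j z).succAbove k)) y
        + ∑ p, ∑ q, christoffel (m + 1) D.toFun (i z) ((j z).succAbove k) p q (i y)
          * pd m z a (fun y => extChartAt (𝓡 (m + 1)) (i z) (i y) p) y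
          * pd m z l (fun y => extChartAt (𝓡 (m + 1)) (i z) (i y) q) y) z := by
      refine (contMDiffAt_pd hz (contMDiffAt_pd hz (hc _) l) a).add
        (contMDiffAt_finsetSum fun p _ => contMDiffAt_finsetSum fun q _ =>
          (ContMDiffAt.mul ?_ (contMDiffAt_pd hz (hc p) a)).mul (contMDiffAt_pd hz (hc q) l))
      exact (contMDiffAt_christoffel hA.1 hiz _ p q).comp z (h.smooth z)
    refine h1.congr_of_eventuallyEq ?_
    filter_upwards [dom_mem_nhds hz] with y hy using h.christoffel_restriction hD hy k a l
  · refine torsion_eq_zero_of_christoffel_symm fun z k a b => ?_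
    have hz := mem_dom_self (n := m) z
    have hiz := mem_dom_self (n := m + 1) (i z)
    rw [h.christoffel_restriction hD hz, h.christoffel_restriction hD hz,
      pd_comm hz (contMDiffAt_coord_emb h.smooth hiz _)]
    congr 1
    rw [Finset.sum_comm]
    refine Finset.sum_congr rfl fun q _ => Finset.sum_congr rfl fun p _ => ?_
    rw [christoffel_symm hA.2 hiz]
    ring

/-- The one-form is the pullback of `Υ`; the relation is checked after applying the injective map
`di`. -/
theorem projRelatedOn_restriction [T2Space M] (h : IsAdapted i j) {D D' : Conn (m + 1) M}
    (hD : IsTotallyGeodesic (n := m + 1) (m := m) i D.toFun)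
    (hD' : IsTotallyGeodesic (n := m + 1) (m := m) i D'.toFun)
    (hr : ProjRelatedOn (m + 1) univ D.toFun D'.toFun) :
    ProjRelatedOn m univ (h.restriction D).toFun (h.restriction D').toFun := by
  obtain ⟨Υ, h1, h2⟩ := hr
  refine ⟨fun z => (Υ (i z)).comp (mfderiv (𝓡 m) (𝓡 (m + 1)) i z), fun Z hZ =>
    contMDiffOn_form_apply (fun z _ l => ContMDiffAt.contMDiffWithinAt ?_) hZ,
    fun Z z _ hZ v => ?_⟩
  · have hz := mem_dom_self (n := m) z
    have hiz := mem_dom_self (n := m + 1) (i z)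
    have h3 : ContMDiffAt (𝓡 m) 𝓘(ℝ) ∞ (fun y => ∑ k,
        pd m z l (fun y => extChartAt (𝓡 (m + 1)) (i z) (i y) k) y
          * Υ (i y) (coordField (m + 1) (i z) k (i y))) z :=
      contMDiffAt_finsetSum fun k _ =>
        (contMDiffAt_pd hz (contMDiffAt_coord_emb h.smooth hiz k) l).mul
          ((contMDiffAt_form_coordField h1 hiz k).comp z (h.smooth z))
    refine h3.congr_of_eventuallyEq ?_
    filter_upwards [dom_mem_nhds hz] with y hy
    have hiy := h.mem_dom z y hy
    rw [ContinuousLinearMap.comp_apply, form_apply_eq_sum Υ hiy]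
    simp only [coordComp_emb_coordField h.smooth hiy hy]
  · have hz := mem_dom_self (n := m) z
    have hE := h.mdifferentiableAt_extendField hz hZ
    have h3 : ∀ᶠ y in 𝓝 z, extendField i j z Z (i y) =
        mfderiv (𝓡 m) (𝓡 (m + 1)) i y (Z y) := by
      filter_upwards [dom_mem_nhds hz] with y hy using h.extendField_emb hy Z
    apply h.mfderiv_injective z
    rw [map_add, map_add, map_smul, map_smul, ← h.isRestriction hD' z _ Z hE hZ h3,
      ← h.isRestriction hD z _ Z hE hZ h3, h2 _ _ (mem_univ _) hE, h3.self_of_nhds]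
    rfl

/-- A projective structure for which all connections make the hypersurface totally geodesic
induces a projective structure on the hypersurface. -/
theorem exists_isInherited [T2Space M] (h : IsAdapted i j) {p : ProjectiveStructure (m + 1) M}
    (hp : ∀ D ∈ p.carrier, IsTotallyGeodesic (n := m + 1) (m := m) i D.toFun) :
    ∃ q : ProjectiveStructure m N, IsInherited (n := m + 1) (m := m) i p q := by
  obtain ⟨D, hD⟩ := p.nonempty
  have hA := fun D' hD' => h.isAffine_restriction (hp D' hD') (p.isAffine D' hD')
  -- The class of the restriction of one chosen connection; the other restrictions belong to it
  -- because they are projectively related to that one.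
  refine ⟨⟨{D' | IsAffine m D' ∧ ProjRelatedOn m univ (h.restriction D).toFun D'.toFun},
    ⟨h.restriction D, hA D hD, .refl _ _⟩, fun D' hD' => hD'.1, fun D₁ h₁ D₂ h₂ =>
      ⟨fun h3 => h₁.2.symm.trans h3.2, fun h3 => ⟨h₂, h₁.2.trans h3⟩⟩⟩,
    fun D' hD' => ⟨h.restriction D', ⟨hA D' hD', h.projRelatedOn_restriction (hp D hD) (hp D' hD')
      ((p.mem_iff D hD D' (p.isAffine D' hD')).1 hD')⟩, h.isRestriction (hp D' hD')⟩⟩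

end IsAdapted

end restriction

section roots

variable {n : ℕ} {M : Type*} [TopologicalSpace M] [ChartedSpace (Model n) M]
  [IsManifold (𝓡 n) ∞ M] {c x : M} {τ : Density n M 2} {σ : Density n M 1} {ε : ℝ} {U : Set M}
  {p : ProjectiveStructure n M}

/-! ### The decomposition given by a root -/

lemma IsRootOn.mem_zeroSet_iff (hε : ε * ε = 1) (h : IsRootOn ε τ σ U) (hxU : x ∈ U)
    (hx : x ∈ dom n c) : x ∈ τ.zeroSet ↔ σ.comp c x = 0 := by
  have hε0 : ε ≠ 0 := fun h0 => by simp [h0] at hε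
  rw [τ.mem_zeroSet_iff hx, h.comp_eq hε hxU hx, mul_eq_zero, or_iff_right hε0, mul_self_eq_zero]

lemma IsRootOn.inter_zeroSet (hε : ε * ε = 1) (h : IsRootOn ε τ σ U) :
    U ∩ σ.zeroSet = U ∩ τ.zeroSet := by
  ext x
  have hx := mem_dom_self (n := n) x
  exact and_congr_right fun hxU => by rw [h.mem_zeroSet_iff hε hxU hx, σ.mem_zeroSet_iff hx]

lemma Density.eq_union (σ : Density n M 1) (U : Set M) :
    U = (U ∩ σ.posSet) ∪ (U ∩ σ.zeroSet) ∪ (U ∩ σ.negSet) := by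
  ext x
  have hx := mem_dom_self (n := n) x
  simp only [mem_union, mem_inter_iff, σ.mem_posSet_iff hx, σ.mem_zeroSet_iff hx,
    σ.mem_negSet_iff hx]
  have := lt_trichotomy (σ.comp x x) 0
  tauto

lemma Density.disjoint_posSet_zeroSet (σ : Density n M 1) : Disjoint σ.posSet σ.zeroSet := by
  refine Set.disjoint_left.2 fun x h1 h2 => ?_
  have hx := mem_dom_self (n := n) x
  exact ((σ.mem_posSet_iff hx).1 h1).ne' ((σ.mem_zeroSet_iff hx).1 h2)

lemma Density.disjoint_posSet_negSet (σ : Density n M 1) : Disjoint σ.posSet σ.negSet := by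
  refine Set.disjoint_left.2 fun x h1 h2 => ?_
  have hx := mem_dom_self (n := n) x
  exact lt_asymm ((σ.mem_posSet_iff hx).1 h1) ((σ.mem_negSet_iff hx).1 h2)

lemma Density.disjoint_zeroSet_negSet (σ : Density n M 1) : Disjoint σ.zeroSet σ.negSet := by
  refine Set.disjoint_left.2 fun x h1 h2 => ?_
  have hx := mem_dom_self (n := n) x
  exact ((σ.mem_negSet_iff hx).1 h2).ne ((σ.mem_zeroSet_iff hx).1 h1)

theorem exists_scaleConn [T2Space M] (hn : 2 ≤ n) (hε : ε * ε = 1) (h : IsRootOn ε τ σ U)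
    (hU : IsOpen U) (hL : p.RankOne τ) :
    ∃ D : RawConn n M, p.IsScaleConn σ (U \ σ.zeroSet) D ∧ RicciFlatOn D (U \ σ.zeroSet) ∧
      IsProjectivelyCompact 1 D (U \ σ.negSet) (U ∩ σ.posSet) (U ∩ σ.zeroSet) ∧
      IsProjectivelyCompact 1 D (U \ σ.posSet) (U ∩ σ.negSet) (U ∩ σ.zeroSet) := by
  obtain ⟨D, hD⟩ := p.nonempty
  have hdef := h.isDefiningOn hε hU hL
  refine ⟨scaleConn D.toFun σ, isScaleConn_scaleConn hD hU h.1,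
    ricciFlatOn_scaleConn hn hε h hL hD hU,
    -- `δ = 1` gives the side `σ ≥ 0` and `δ = -1` the side `σ ≤ 0`, with the same connection.
    isProjectivelyCompact_scaleConn hD hU h.1 hdef one_ne_zero (fun c x hx => ?_)
      (fun c x hx => ?_),
    isProjectivelyCompact_scaleConn hD hU h.1 hdef (neg_ne_zero.2 one_ne_zero)
      (fun c x hx => ?_) (fun c x hx => ?_)⟩
  · rw [Set.mem_sdiff, σ.mem_negSet_iff hx, one_mul, not_lt]
  · rw [mem_inter_iff, σ.mem_posSet_iff hx, one_mul]
  · rw [Set.mem_sdiff, σ.mem_posSet_iff hx, neg_one_mul, neg_nonneg, not_lt]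
  · rw [mem_inter_iff, σ.mem_negSet_iff hx, neg_one_mul, neg_pos]

/-- Along its zero set, the Hessian of the component of a root is a multiple of its
differential. -/
lemma IsRootOn.hessian_eq [T2Space M] (hε : ε * ε = 1) (h : IsRootOn ε τ σ U) (hU : IsOpen U)
    (hL : p.RankOne τ) (hxU : x ∈ U) (hx : x ∈ dom n c) (h0 : σ.comp c x = 0) {D : Conn n M}
    (hD : D ∈ p.carrier) (a b : Fin n) :
    pd n c a (pd n c b (σ.comp c)) x
      - ∑ k, christoffel n D.toFun c k a b x * pd n c k (σ.comp c) x =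
      -(1 / (n + 1) * ∑ k, christoffel n D.toFun c k a k x) * pd n c b (σ.comp c) x
      + -(1 / (n + 1) * ∑ k, christoffel n D.toFun c k b k x) * pd n c a (σ.comp c) x := by
  have hA := p.isAffine D hD
  have hs := h.contMDiffAt hU hxU hx
  have hsd := hs.mdifferentiableAt (n := ∞) (by simp)
  have h1 := h.nabla2_add_schouten hε hU hL hxU hx hD a b
  rw [h0, mul_zero, add_zero, nabla2] at h1
  simp only [nabla_eq_pd h0] at h1
  have hg : MDifferentiableAt (𝓡 n) 𝓘(ℝ)
      (fun y => (1 : ℝ) / (n + 1) * ∑ k, christoffel n D.toFun c k b k y) x :=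
    (contMDiffAt_const.mul (contMDiffAt_finsetSum fun k _ =>
      contMDiffAt_christoffel hA.1 hx k b k)).mdifferentiableAt (n := ∞) (by simp)
  -- Of the derivative of the trace term, only the part that differentiates `σ` survives at a zero.
  have h2 : pd n c a (nabla D.toFun σ c b) x = pd n c a (pd n c b (σ.comp c)) x
      + (1 / (n + 1) * ∑ k, christoffel n D.toFun c k b k x) * pd n c a (σ.comp c) x := by
    have h3 := pd_add hx ((contMDiffAt_pd hx hs b).mdifferentiableAt (by simp))
      (g := fun y => 1 / (n + 1) * (∑ k, christoffel n D.toFun c k b k y) * σ.comp c y)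
      (hg.mul hsd) a
    rw [pd_mul hx hg hsd, h0, zero_mul, add_zero] at h3
    exact h3
  rw [h2] at h1
  linear_combination h1

end roots

section hypersurface

variable {m : ℕ} {M : Type*} [TopologicalSpace M] [T2Space M] [ChartedSpace (Model (m + 1)) M]
  [IsManifold (𝓡 (m + 1)) ∞ M] {τ : Density (m + 1) M 2} {ε : ℝ}
  {p : ProjectiveStructure (m + 1) M}

/-! ### The zero locus -/

/-- No global root is needed: around each zero of `τ` the component of a local root is a defining
function, and `IsRootOn.hessian_eq` supplies its Hessian condition. -/
theorem exists_zeroSet_structure (hε : ε * ε = 1) (hL : p.RankOne τ)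
    (hroot : ∀ x : M, ∃ U : Set M, IsOpen U ∧ x ∈ U ∧ ∃ σ : Density (m + 1) M 1,
      IsRootOn ε τ σ U) :
    ∃ (_ : ChartedSpace (Model m) τ.zeroSet) (_ : IsManifold (𝓡 m) ∞ τ.zeroSet),
      Manifold.IsSmoothEmbedding (𝓡 m) (𝓡 (m + 1)) ∞ (Subtype.val : τ.zeroSet → M) ∧
      (∀ D ∈ p.carrier,
        IsTotallyGeodesic (n := m + 1) (m := m) (Subtype.val : τ.zeroSet → M) D.toFun) ∧
      ∃ q : ProjectiveStructure m τ.zeroSet,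
        IsInherited (n := m + 1) (m := m) (Subtype.val : τ.zeroSet → M) p q := by
  obtain ⟨D₀, hD₀⟩ := p.nonempty
  choose U hU hzU σ hσ using fun z : τ.zeroSet => hroot z.1
  have hself := fun z : τ.zeroSet => mem_dom_self (n := m + 1) z.1
  have h0 : ∀ z, (σ z).comp z.1 z.1 = 0 := fun z =>
    ((hσ z).mem_zeroSet_iff hε (hzU z) (hself z)).1 z.2
  have hj : ∀ z : τ.zeroSet, ∃ j, pd (m + 1) z.1 j ((σ z).comp z.1) z.1 ≠ 0 := by
    intro z
    obtain ⟨a, ha⟩ := (hσ z).isDefiningOn hε (hU z) hL D₀ hD₀ z.1 z.1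
      ⟨⟨hzU z, ((σ z).mem_zeroSet_iff (hself z)).2 (h0 z)⟩, hself z⟩
    exact ⟨a, by rwa [nabla_eq_pd (h0 z)] at ha⟩
  choose j hj using hj
  have hs : ∀ z, ∀ y ∈ U z, y ∈ dom (m + 1) z.1 →
      ContMDiffAt (𝓡 (m + 1)) 𝓘(ℝ) ∞ ((σ z).comp z.1) y := fun z y hy hy' =>
    (hσ z).contMDiffAt (hU z) hy hy'
  set W : τ.zeroSet → Set M := fun z => {y | (y ∈ U z ∧ y ∈ dom (m + 1) z.1) ∧
    pd (m + 1) z.1 (j z) ((σ z).comp z.1) y ≠ 0} with hW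
  have hWo : ∀ z, IsOpen (W z) := fun z => isOpen_iff_mem_nhds.2 fun y hy => by
    filter_upwards [(hU z).mem_nhds hy.1.1, dom_mem_nhds hy.1.2, (contMDiffAt_pd hy.1.2
      (hs z y hy.1.1 hy.1.2) (j z)).continuousAt.eventually_ne hy.2] with x h1 h2 h3
      using ⟨⟨h1, h2⟩, h3⟩
  obtain ⟨cs, hman, hemb, hchart⟩ := exists_hypersurface_structure (Z := τ.zeroSet) j
    (fun z => (σ z).comp z.1) W hWo (fun z => ⟨⟨hzU z, hself z⟩, hj z⟩) (fun z y hy => hy.1.2)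
    (fun z y hy => hs z y hy.1.1 hy.1.2) (fun z y hy => hy.2)
    (fun z y hy => (hσ z).mem_zeroSet_iff hε hy.1.1 hy.1.2)
  have hadapted : IsAdapted (Subtype.val : τ.zeroSet → M) j :=
    ⟨hemb.contMDiff, fun z y hy => (hchart z y hy).1.1.2, fun z y hy => (hchart z y hy).2⟩
  have hgeod : ∀ D ∈ p.carrier,
      IsTotallyGeodesic (n := m + 1) (m := m) (Subtype.val : τ.zeroSet → M) D.toFun := by
    intro D hD
    refine hadapted.isTotallyGeodesic D fun z => ⟨(σ z).comp z.1, _, hs z _ (hzU z) (hself z),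
      hj z, ?_, (hσ z).hessian_eq hε (hU z) hL (hzU z) (hself z) (h0 z) hD⟩
    filter_upwards [continuous_subtype_val.continuousAt.preimage_mem_nhds
      (inter_mem ((hU z).mem_nhds (hzU z)) (dom_mem_nhds (hself z)))] with y hy
    exact ((hσ z).mem_zeroSet_iff hε hy.1 hy.2).1 y.2
  exact ⟨cs, hman, hemb, hgeod, hadapted.exists_isInherited hgeod⟩

end hypersurface

end ProjGeom

end

theorem proposition4p8 (n : ℕ) (hn : 2 ≤ n) {M : Type*} [TopologicalSpace M] [T2Space M]
    [SecondCountableTopology M] [ConnectedSpace M] [ChartedSpace (ProjGeom.Model n) M]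
    [IsManifold (𝓡 n) ∞ M] (p : ProjGeom.ProjectiveStructure n M)
    (τ : ProjGeom.Density n M 2) (hτ : τ.SmoothOn univ) (hL : p.RankOne τ) :
    -- local square roots, with the same sign `ε` everywhere
    (∃ ε : ℝ, (ε = 1 ∨ ε = -1) ∧
      (∀ x : M, ∃ U : Set M, IsOpen U ∧ x ∈ U ∧
        ∃ σ : ProjGeom.Density n M 1, ProjGeom.IsRootOn ε τ σ U) ∧
      -- the root is unique up to sign
      (∀ U : Set M, IsOpen U → IsPreconnected U → ∀ σ σ' : ProjGeom.Density n M 1,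
        ProjGeom.IsRootOn ε τ σ U → ProjGeom.IsRootOn ε τ σ' U →
          (∀ x ∈ U, ∀ b, σ'.toFun x b = σ.toFun x b) ∨
          (∀ x ∈ U, ∀ b, σ'.toFun x b = -σ.toFun x b)) ∧
      -- the properties of each such root
      (∀ U : Set M, IsOpen U → ∀ σ : ProjGeom.Density n M 1, ProjGeom.IsRootOn ε τ σ U →
        p.SplitEqOn τ ε σ U ∧
        p.IsDefiningOn σ U ∧
        U ∩ σ.zeroSet = U ∩ τ.zeroSet ∧
        U = (U ∩ σ.posSet) ∪ (U ∩ σ.zeroSet) ∪ (U ∩ σ.negSet) ∧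
        Disjoint (U ∩ σ.posSet) (U ∩ σ.zeroSet) ∧
        Disjoint (U ∩ σ.posSet) (U ∩ σ.negSet) ∧
        Disjoint (U ∩ σ.zeroSet) (U ∩ σ.negSet) ∧
        IsOpen (U ∩ σ.posSet) ∧ IsOpen (U ∩ σ.negSet) ∧
        (IsCompact U → IsCompact (U \ σ.negSet) ∧ IsCompact (U \ σ.posSet)) ∧
        ∃ D : ProjGeom.RawConn n M, p.IsScaleConn σ (U \ σ.zeroSet) D ∧
          ProjGeom.RicciFlatOn D (U \ σ.zeroSet) ∧
          ProjGeom.IsProjectivelyCompact 1 D (U \ σ.negSet) (U ∩ σ.posSet) (U ∩ σ.zeroSet) ∧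
          ProjGeom.IsProjectivelyCompact 1 D (U \ σ.posSet) (U ∩ σ.negSet) (U ∩ σ.zeroSet))) ∧
    -- the zero locus is a (possibly empty) totally geodesic hypersurface with a projective structure
    ∃ (_ : ChartedSpace (ProjGeom.Model (n - 1)) τ.zeroSet)
      (_ : IsManifold (𝓡 (n - 1)) ∞ τ.zeroSet),
      Manifold.IsSmoothEmbedding (𝓡 (n - 1)) (𝓡 n) ∞ (Subtype.val : τ.zeroSet → M) ∧
      (∀ D ∈ p.carrier,
        ProjGeom.IsTotallyGeodesic (n := n) (m := n - 1) (Subtype.val : τ.zeroSet → M) D.toFun) ∧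
      ∃ q : ProjGeom.ProjectiveStructure (n - 1) τ.zeroSet,
        ProjGeom.IsInherited (n := n) (m := n - 1) (Subtype.val : τ.zeroSet → M) p q := by
  obtain ⟨ε, hε, hroot⟩ := ProjGeom.exists_sign hτ hL
  have hεε : ε * ε = 1 := by rcases hε with rfl | rfl <;> norm_num
  refine ⟨⟨ε, hε, hroot, fun U hU hUc σ σ' h h' => h.eq_or_eq_neg hεε h' hU hUc hL,
    fun U hU σ h => ?_⟩, ?_⟩
  · obtain ⟨D, hD⟩ := ProjGeom.exists_scaleConn hn hεε h hU hL
    have hpos : IsOpen (U ∩ σ.posSet) := hD.2.2.1.isOpen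
    have hneg : IsOpen (U ∩ σ.negSet) := hD.2.2.2.isOpen
    refine ⟨h.splitEqOn hεε hU hL, h.isDefiningOn hεε hU hL, h.inter_zeroSet hεε, σ.eq_union U,
      σ.disjoint_posSet_zeroSet.mono inter_subset_right inter_subset_right,
      σ.disjoint_posSet_negSet.mono inter_subset_right inter_subset_right,
      σ.disjoint_zeroSet_negSet.mono inter_subset_right inter_subset_right, hpos, hneg,
      fun hc => ⟨?_, ?_⟩, D, hD⟩
    -- Removing `σ.negSet` from `U` amounts to removing the open set `U ∩ σ.negSet` from a compact
    -- set.
    · rw [← sdiff_self_inter]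
      exact hc.diff hneg
    · rw [← sdiff_self_inter]
      exact hc.diff hpos
  -- Written as `m + 1`, the dimension makes `n - 1` reduce to `m` by definition.
  · obtain ⟨m, rfl⟩ : ∃ m, n = m + 1 := ⟨n - 1, by omega⟩
    exact ProjGeom.exists_zeroSet_structure (m := m) hεε hL hroot
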